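/- **Setting.** Let $N\ge 1$ and $\Lambda=(\mathbb Z/N)^4$, with unit vectors $\hat\mu$ and $\hat s=\hat1+\hat2+\hat3+\hat4$; the dual lattice is $\tilde\Lambda=\Lambda+\tfrac12\hat s$ and $F(x)=x+\tfrac12\hat s$. An $r$-form on $\Lambda$ (or $\tilde\Lambda$) assigns a number $\alpha_{x,\mu_1\cdots\mu_r}$, antisymmetric in the directions, to every cell. Put $$(d\alpha)_{x,\mu_1\cdots\mu_{r}}=\sum_{j=1}^{r}(-1)^{j+1}\big[\alpha_{x+\hat\mu_j,\mu_1\cdots\mathring\mu_j\cdots\mu_r}-\alpha_{x,\mu_1\cdots\mathring\mu_j\cdots\mu_r}\big],\qquad (\partial\alpha)_{x,\mu_1\cdots\mu_r}=\sum_{\nu}\big[\alpha_{x,\mu_1\cdots\mu_r\nu}-\alpha_{x-\hat\nu,\mu_1\cdots\mu_r\nu}\big],$$ $$(\alpha\cup\beta)_{x,\mu_1\cdots\mu_{p+q}}=\sum_{\sigma\in\mathfrak S_{p+q}}\frac{\epsilon_\sigma}{p!\,q!}\,\alpha_{x,\mu_{\sigma(1)}\cdots\mu_{\sigma(p)}}\,\beta_{x+\sum_{i\le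 p}\hat\mu_{\sigma(i)},\,\mu_{\sigma(p+1)}\cdots\mu_{\sigma(p+q)}},$$ $$(\alpha\cup_1\beta)_{x,\mu_1\cdots\mu_{p+q-1}}=(-1)^q\sum_{a=1}^{p+q-1}(-1)^aP_{\mu_a}\big(P_{\mu_a}\iota_{\mu_a}\alpha\cup P_{\mu_a}\iota_{\mu_a}\beta\big)_{x,\mu_1\cdots\mathring\mu_a\cdots\mu_{p+q-1}}\qquad(\mu_1<\dots<\mu_{p+q-1})$$ for $\alpha$ a $p$-form and $\beta$ a $q$-form, where $(\iota_\mu\alpha)_{x,\mu_1\cdots}=\alpha_{x,\mu\mu_1\cdots}$, and $P_\mu$ acts on sites by $x_\nu\mapsto -x_\nu$ for $\nu\ge\mu$ and on forms by $(P_\mu\alpha)_{x,\mu_1\cdots\mu_r}=(-1)^{\#\{i:\mu_i\ge\mu\}}\alpha_{P_\mu x-\sum_{\mu_i\ge\mu}\hat\mu_i,\ \mu_1\cdots\mu_r}$. The dot denotes the Euclidean inner product of forms (sum over all cells), $\sum_x$ of a $4$-form its sum over the lattice, and $P_\partial$ is the orthogonal projection of real $2$-forms onto $\operatorname{Im}\partial$.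 For a real $1$-form $A^e$ and an integer $2$-form $n$ put $F^e=dA^e+2\pi n$ and $$Q_0=\sum_x\tfrac1{8\pi^2}F^e\cup F^e,\quad Q=Q_0+\sum_x\tfrac1{4\pi}F^e\cup_1dn,\quad \tilde Q=Q_0-\sum_x\tfrac1{4\pi}F^e\cup_1dn,\quad \mathfrak P(n)=\sum_x(n\cup n+n\cup_1dn).$$ Let $\int DA^e$, $\int DA^m$ be integration of all components of a $1$-form $A^e$ and of a $3$-form $A^m$ over $[-\pi,\pi)$ with measure $dA/2\pi$. Let $\beta>0$, $\theta\in\mathbb R$, $p,q_e,q_m\in\mathbb Z$. Let $\gamma$ be a contour (a finite collection of oriented lattice links that form closed paths) and let $\dot\gamma$ be its tangent $1$-form: $\dot\gamma_{x,\mu}$ is $+1$ if $(x,\mu)\in\gamma$, $-1$ if $(x+\hat\mu,-\mu)\in\gamma$, and $0$ otherwise, counted with multiplicity. Set $$Z[\beta,\theta]=\int DA^e\sum_{n:\,dn=0}e^{-\frac\beta2F^e\cdot F^e-i\theta Q_0},$$ $$\langle W_d^{(q_e,q_m)}(\gamma)\rangle^p_{\beta,\theta}=\frac1{Z[\beta,\theta]}\int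 DA^eDA^m\sum_n e^{-\frac\beta2F^e\cdot F^e-i\theta Q+\frac i{2\pi}\partial A^m\cdot F^e-ip\pi\mathfrak P(n)}\,e^{i\left(q_e\dot\gamma\cdot A^e-q_m\sum_x\dot\gamma\cup A^m\right)},$$ $$\langle\tilde W_d^{(q_e,q_m)}(\gamma)\rangle^p_{\beta,\theta}=\frac1{Z[\beta,\theta]}\int DA^eDA^m\sum_n e^{-\frac\beta2F^e\cdot F^e-i\theta\tilde Q+\frac i{2\pi}\partial A^m\cdot F^e-ip\pi\mathfrak P(n)}\,e^{i\left(q_e\dot\gamma\cdot A^e+q_m\sum_xA^m\cup\dot\gamma\right)},$$ where $n$ runs over the integer $2$-forms. The same definitions are used on $\tilde\Lambda$; in particular $\langle\tilde W_d(F(\gamma))\rangle$ refers to the contour $F(\gamma)$ in $\tilde\Lambda$. Finally let $$\tilde\beta=\frac{\beta}{(2\pi\beta)^2+(\theta/2\pi)^2},\qquad\tilde\theta=\frac{-\theta}{(2\pi\beta)^2+(\theta/2\pi)^2},\qquad\tau=\frac\theta{2\pi}+2\pi i\beta,\qquad q=q_e+\tau q_m .$$ **Lemma ($\mathcal S$-transformation).**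 Let $\gamma$ be a contour in $\Lambda$ and let $l$ be an integer $2$-form on $\Lambda$ with $\sum_{\nu<\rho<\sigma}\epsilon_{\mu\nu\rho\sigma}(dl)_{x+\hat\mu,\nu\rho\sigma}=-\dot\gamma_{x,\mu}$ for all $x,\mu$. Put $u=\sum_xP_\partial l\cup_1dP_\partial l\in\mathbb R$ and $v=\mathfrak P(l)\in\mathbb Z$. Poisson summation exchanges $W_d(\gamma)$ and $\tilde W_d(F(\gamma))$, replaces $(q_e,q_m)$ by $(q_m,-q_e)$ and $(\beta,\theta)$ by $(\tilde\beta,\tilde\theta)$; flipping the framing exchanges $W_d(\gamma)$ and $\tilde W_d(F(\gamma))$ and leaves the charges and couplings unchanged; the $\mathcal S$-transformation is Poisson summation followed by flipping the framing. Then $$\langle W_d^{(q_e,q_m)}(\gamma)\rangle^p_{\beta,\theta}=\exp\!\Big(-iu\pi\frac{q^2}\tau-2\pi^2u(\beta q_m^2-\tilde\beta q_e^2)\Big)(-1)^{pv(q_m^2+q_e^2)}\,\langle W_d^{(q_m,-q_e)}(\gamma)\rangle^p_{\tilde\beta,\tilde\theta},$$ $$\langle\tilde W_d^{(q_e,q_m)}(F(\gamma))\rangle^p_{\beta,\theta}=\exp\!\Big(iu\pi\frac{q^2}\tau+2\pi^2u(\beta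 q_m^2-\tilde\beta q_e^2)\Big)(-1)^{pv(q_m^2+q_e^2)}\,\langle\tilde W_d^{(q_m,-q_e)}(F(\gamma))\rangle^p_{\tilde\beta,\tilde\theta},$$ and $\mathcal S$ acts on the charges, in both framings, by $\begin{pmatrix}q_e\\q_m\end{pmatrix}\mapsto\begin{pmatrix}q_m\\-q_e\end{pmatrix}=\begin{pmatrix}0&1\\-1&0\end{pmatrix}\begin{pmatrix}q_e\\q_m\end{pmatrix}$. -/

import Mathlib

open Real MeasureTheory

namespace Villain

/-- Sites of the periodic hypercubic lattice of side `N`. For `half = false` this is the lattice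
`Λ` and the site is `coord`; for `half = true` it is the dual lattice `Λ + ŝ/2`,
`ŝ = (1,1,1,1)`, and the site is `coord + ŝ/2`. -/
structure Site (N : ℕ) (half : Bool) where
  coord : Fin 4 → ZMod N
  deriving DecidableEq

instance instFintypeSite (N : ℕ) [NeZero N] (half : Bool) : Fintype (Site N half) :=
  Fintype.ofEquiv (Fin 4 → ZMod N) ⟨Site.mk, Site.coord, fun _ => rfl, fun _ => rfl⟩

/-- The integer vector `∑_{μ ∈ S} μ̂`. -/
def dirs (N : ℕ) (S : Finset (Fin 4)) : Fin 4 → ZMod N := fun μ => if μ ∈ S then 1 else 0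

/-- The site `x + v`. -/
def Site.shift {N : ℕ} {half : Bool} (x : Site N half) (v : Fin 4 → ZMod N) : Site N half :=
  ⟨x.coord + v⟩

/-- The map `F(x) = x + ŝ/2` from the lattice to the dual lattice. -/
def toDual {N : ℕ} (x : Site N false) : Site N true := ⟨x.coord⟩

/-- The reflection `P_μ` of sites: it changes the sign of the position coordinates `x_ν`,
`ν ≥ μ`. On the dual lattice `-(c + 1/2) = (-c - 1) + 1/2`. -/
def Site.reflect {N : ℕ} {half : Bool} (μ : Fin 4) (x : Site N half) : Site N half :=
  ⟨fun ν => if μ ≤ ν then (if half then -x.coord ν - 1 else -x.coord ν) else x.coord ν⟩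

/-- An `r`-cell: a site and an increasing tuple of `r` directions, that is, an `r`-element set. -/
abbrev Cell (N : ℕ) (half : Bool) (r : ℕ) : Type :=
  Site N half × {S : Finset (Fin 4) // S.card = r}

/-- `R`-valued `r`-forms, given by their values `α_{x, μ₁…μ_r}` at `μ₁ < … < μ_r`. -/
abbrev Form (N : ℕ) (half : Bool) (r : ℕ) (R : Type) : Type := Cell N half r → R

section Calculus

variable {N : ℕ} {half : Bool} {R : Type} [CommRing R]

/-- The value of an `r`-form at the site `x` and the increasing tuple of directions with
underlying set `S`; zero when `S` does not have `r` elements. -/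
def val {r : ℕ} (α : Form N half r R) (x : Site N half) (S : Finset (Fin 4)) : R :=
  if h : S.card = r then α (x, ⟨S, h⟩) else 0

/-- The sign of the permutation that sorts the concatenation of the increasing tuples of the
disjoint sets `A` and `B`. -/
def shuffleSign (A B : Finset (Fin 4)) : ℤ :=
  (-1) ^ ((A ×ˢ B).filter (fun ab => ab.2 < ab.1)).card

/-- The exterior derivative
`(dα)_{x,μ₁…} = ∑ⱼ (-1)^(j+1) (α_{x+μ̂ⱼ,…μⱼ omitted…} - α_{x,…μⱼ omitted…})`. -/
def extDeriv {r : ℕ} (α : Form N half r R) : Form N half (r + 1) R := fun c =>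
  ∑ μ ∈ c.2.1, (shuffleSign {μ} (c.2.1.erase μ) : R) *
    (val α (c.1.shift (dirs N {μ})) (c.2.1.erase μ) - val α c.1 (c.2.1.erase μ))

/-- The boundary operator `(∂α)_{x,μ₁…μ_r} = ∑_ν (α_{x,μ₁…μ_r ν} - α_{x-ν̂,μ₁…μ_r ν})`. -/
def boundary {r : ℕ} (α : Form N half (r + 1) R) : Form N half r R := fun c =>
  ∑ ν ∈ c.2.1ᶜ, (shuffleSign c.2.1 {ν} : R) *
    (val α c.1 (insert ν c.2.1) - val α (c.1.shift (-dirs N {ν})) (insert ν c.2.1))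

/-- The cup product: the sum over the splittings of the directions into `A` (for `α`) and its
complement (for `β`) of `± α_{x,A} β_{x + ∑_{μ ∈ A} μ̂, Aᶜ}`. -/
def cup {p q : ℕ} (α : Form N half p R) (β : Form N half q R) : Form N half (p + q) R := fun c =>
  ∑ A ∈ c.2.1.powerset, (shuffleSign A (c.2.1 \ A) : R) *
    (val α c.1 A * val β (c.1.shift (dirs N A)) (c.2.1 \ A))

/-- The interior product `(ι_μ α)_{x,μ₁…μ_r} = α_{x,μ μ₁…μ_r}`. -/
def interiorProduct {r : ℕ} (μ : Fin 4) (α : Form N half (r + 1) R) : Form N half r R := fun c =>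
  (shuffleSign {μ} c.2.1 : R) * val α c.1 (insert μ c.2.1)

/-- The parity transformation `P_μ` of forms: the directions `ν ≥ μ` are reversed. -/
def parity {r : ℕ} (μ : Fin 4) (α : Form N half r R) : Form N half r R := fun c =>
  (-1) ^ (c.2.1.filter (fun ν => μ ≤ ν)).card *
    α ((c.1.reflect μ).shift (-dirs N (c.2.1.filter (fun ν => μ ≤ ν))), c.2)

/-- The higher cup product `∪₁` of a `(p+1)`-form `α` and a `(q+1)`-form `β`,
`(-1)^(q+1) ∑_a (-1)^a P_{μ_a} (P_{μ_a} ι_{μ_a} α ∪ P_{μ_a} ι_{μ_a} β)_{x,…μ_a omitted…}`,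
where `μ_a` is the `a`-th smallest direction, `a = 1, 2, …`. -/
def cupOne {p q : ℕ} (α : Form N half (p + 1) R) (β : Form N half (q + 1) R) :
    Form N half (p + q + 1) R := fun c =>
  (-1) ^ (q + 1) * ∑ μ ∈ c.2.1, (-1) ^ (c.2.1.filter (fun ν => ν ≤ μ)).card *
    val (parity μ (cup (parity μ (interiorProduct μ α)) (parity μ (interiorProduct μ β)))) c.1 (c.2.1.erase μ)

/-- The sum over the lattice of a `4`-form. -/
def total [NeZero N] (α : Form N half 4 R) : R := ∑ x, val α x Finset.univ

/-- The inner product of two forms of the same degree. -/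
def dot [NeZero N] {r : ℕ} (α β : Form N half r R) : R := ∑ c, α c * β c

end Calculus

/-- An integer-valued form, regarded as real-valued. -/
def toReal {N : ℕ} {half : Bool} {r : ℕ} (n : Form N half r ℤ) : Form N half r ℝ :=
  fun c => (n c : ℝ)

/-- An oriented link: `(x, +μ)` from `x` to `x + μ̂` or `(x, -μ)` from `x` to `x - μ̂`. -/
structure OrientedLink (N : ℕ) (half : Bool) where
  source : Site N half
  dir : Fin 4
  forward : Bool

/-- The end point of an oriented link. -/
def OrientedLink.target {N : ℕ} {half : Bool} (e : OrientedLink N half) : Site N half :=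
  if e.forward then e.source.shift (dirs N {e.dir}) else e.source.shift (-dirs N {e.dir})

/-- A contour: oriented links that fit together to closed paths, that is, every site is as often
the source as the target of a link. -/
structure Contour (N : ℕ) (half : Bool) where
  links : List (OrientedLink N half)
  closed : ∀ x, links.countP (fun e => decide (e.source = x)) =
    links.countP (fun e => decide (e.target = x))

/-- The tangent `γ̇`: `+1` on `(x, μ)` if `(x, +μ)` belongs to the contour, `-1` if `(x + μ̂, -μ)`
does, `0` otherwise (counted with multiplicity). -/
def Contour.tangent {N : ℕ} {half : Bool} (γ : Contour N half) : Form N half 1 ℤ := fun c =>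
  (γ.links.countP (fun e => e.forward && decide (e.source = c.1 ∧ c.2.1 = {e.dir})) : ℤ) -
  (γ.links.countP (fun e => !e.forward && decide (e.target = c.1 ∧ c.2.1 = {e.dir})) : ℤ)

/-- The oriented link of the dual lattice that is parallel to a given one. -/
def OrientedLink.toDual {N : ℕ} (e : OrientedLink N false) : OrientedLink N true :=
  ⟨Villain.toDual e.source, e.dir, e.forward⟩

theorem OrientedLink.target_toDual {N : ℕ} (e : OrientedLink N false) :
    e.toDual.target = Villain.toDual e.target := by
  unfold OrientedLink.target OrientedLink.toDual
  split <;> rfl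

/-- The contour `F(γ)` in the dual lattice. -/
def Contour.toDual {N : ℕ} (γ : Contour N false) : Contour N true where
  links := γ.links.map OrientedLink.toDual
  closed := fun x => by
    have h := γ.closed ⟨x.coord⟩
    have key : ∀ y : Site N false, Villain.toDual y = x ↔ y = ⟨x.coord⟩ := by
      rintro ⟨y⟩
      obtain ⟨x⟩ := x
      simp [Villain.toDual]
    simp only [List.countP_map, Function.comp_def, OrientedLink.target_toDual]
    simpa only [OrientedLink.toDual, key] using h

noncomputable section

/-- Integration of compact variables, `∏ ∫_{-π}^{π} dA_i / 2π`. -/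
def compactIntegral {ι : Type} [Fintype ι] (f : (ι → ℝ) → ℂ) : ℂ :=
  ((1 / (2 * π) : ℝ) : ℂ) ^ Fintype.card ι *
    ∫ A in Set.univ.pi (fun _ : ι => Set.Ico (-π) π), f A

section Theory

variable {N : ℕ} [NeZero N] {half : Bool}

/-- The field strength `F = dA + 2π n`. -/
def fieldStrength (A : Form N half 1 ℝ) (n : Form N half 2 ℤ) : Form N half 2 ℝ :=
  fun c => extDeriv A c + 2 * π * (n c : ℝ)

/-- `Q₀[F] = (1/8π²) ∑ F ∪ F`. -/
def charge₀ (F : Form N half 2 ℝ) : ℝ := 1 / (8 * π ^ 2) * total (cup F F)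

/-- `Q[F] = ∑ ((1/8π²) F ∪ F + (1/4π) F ∪₁ dn)`, `F = dA + 2π n`. -/
def charge (A : Form N half 1 ℝ) (n : Form N half 2 ℤ) : ℝ :=
  charge₀ (fieldStrength A n) +
    1 / (4 * π) * total (cupOne (fieldStrength A n) (extDeriv (toReal n)))

/-- `Q̃[F] = ∑ ((1/8π²) F ∪ F - (1/4π) F ∪₁ dn)`, `F = dA + 2π n`. -/
def dualCharge (A : Form N half 1 ℝ) (n : Form N half 2 ℤ) : ℝ :=
  charge₀ (fieldStrength A n) -
    1 / (4 * π) * total (cupOne (fieldStrength A n) (extDeriv (toReal n)))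

/-- The Pontryagin square `𝔓(n) = ∑ (n ∪ n + n ∪₁ dn)`. -/
def pontryagin (n : Form N half 2 ℤ) : ℤ := total (cup n n) + total (cupOne n (extDeriv n))

open Classical in
/-- The partition function
`Z[β,θ] = ∫ DA ∑_n exp(-(β/2) F² - iθ Q₀[F]) δ(dn)`, on the lattice (`half = false`) or on the
dual lattice (`half = true`). -/
def partition (N : ℕ) [NeZero N] (half : Bool) (β θ : ℝ) : ℂ :=
  compactIntegral fun A : Form N half 1 ℝ => ∑' n : Form N half 2 ℤ,
    if extDeriv n = 0 then
      Complex.exp (-(β / 2 * dot (fieldStrength A n) (fieldStrength A n) : ℝ)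
        - Complex.I * (θ * charge₀ (fieldStrength A n) : ℝ))
    else 0

/-- The expectation value of the dyonic Wilson loop
`W_d = exp(i ∑ (q_e γ̇ A^e - q_m γ̇ ∪ A^m))`, with the topological charge `Q`. -/
def evLoop (γ : Contour N half) (p qe qm : ℤ) (β θ : ℝ) : ℂ :=
  1 / partition N half β θ *
    compactIntegral fun Ae : Form N half 1 ℝ => compactIntegral fun Am : Form N half 3 ℝ =>
      ∑' n : Form N half 2 ℤ,
        Complex.exp (-(β / 2 * dot (fieldStrength Ae n) (fieldStrength Ae n) : ℝ)
          - Complex.I * (θ * charge Ae n : ℝ)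
          + Complex.I * (1 / (2 * π) * dot (boundary Am) (fieldStrength Ae n) : ℝ)
          - Complex.I * (p * π * pontryagin n : ℝ)) *
        Complex.exp (Complex.I *
          (qe * dot (toReal γ.tangent) Ae - qm * total (cup (toReal γ.tangent) Am) : ℝ))

/-- The expectation value of the dual dyonic Wilson loop
`W̃_d = exp(i ∑ (q_e γ̇ A^e + q_m A^m ∪ γ̇))`, with the topological charge `Q̃`. -/
def evDualLoop (γ : Contour N half) (p qe qm : ℤ) (β θ : ℝ) : ℂ :=
  1 / partition N half β θ *
    compactIntegral fun Ae : Form N half 1 ℝ => compactIntegral fun Am : Form N half 3 ℝ =>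
      ∑' n : Form N half 2 ℤ,
        Complex.exp (-(β / 2 * dot (fieldStrength Ae n) (fieldStrength Ae n) : ℝ)
          - Complex.I * (θ * dualCharge Ae n : ℝ)
          + Complex.I * (1 / (2 * π) * dot (boundary Am) (fieldStrength Ae n) : ℝ)
          - Complex.I * (p * π * pontryagin n : ℝ)) *
        Complex.exp (Complex.I *
          (qe * dot (toReal γ.tangent) Ae + qm * total (cup Am (toReal γ.tangent)) : ℝ))

/-- The image of `∂` in the real `2`-forms with the Euclidean inner product. -/
def coexact (N : ℕ) [NeZero N] (half : Bool) : Submodule ℝ (EuclideanSpace ℝ (Cell N half 2)) :=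
  Submodule.span ℝ (Set.range fun α : Form N half 3 ℝ => WithLp.toLp 2 (boundary α))

/-- The orthogonal projection `P_∂` of the real `2`-forms onto the image of `∂`. -/
def projBoundary (α : Form N half 2 ℝ) : Form N half 2 ℝ :=
  WithLp.ofLp ((coexact N half).starProjection (WithLp.toLp 2 α))

/-- `u = ∑ P_∂ l ∪₁ d P_∂ l`. -/
def uNumber (l : Form N half 2 ℤ) : ℝ :=
  total (cupOne (projBoundary (toReal l)) (extDeriv (projBoundary (toReal l))))

/-- `ε_{μνρσ} (dl)_{x+μ̂,νρσ} = -γ̇_{x,μ}` (with `ν < ρ < σ` the directions other than `μ`). -/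
def IsMonopoleSolution (γ : Contour N half) (l : Form N half 2 ℤ) : Prop :=
  ∀ (x : Site N half) (μ : Fin 4),
    shuffleSign {μ} {μ}ᶜ * val (extDeriv l) (x.shift (dirs N {μ})) {μ}ᶜ =
      -val γ.tangent x {μ}

end Theory

/-- `β̃ = β / ((2πβ)² + (θ/2π)²)`. -/
def dualBeta (β θ : ℝ) : ℝ := β / ((2 * π * β) ^ 2 + (θ / (2 * π)) ^ 2)

/-- `θ̃ = -θ / ((2πβ)² + (θ/2π)²)`. -/
def dualTheta (β θ : ℝ) : ℝ := -θ / ((2 * π * β) ^ 2 + (θ / (2 * π)) ^ 2)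

/-- The complex coupling `τ = θ/2π + 2πiβ`. -/
def coupling (β θ : ℝ) : ℂ := (θ / (2 * π) : ℝ) + Complex.I * (2 * π * β : ℝ)

/-- The complex charge `q = q_e + τ q_m`. -/
def complexCharge (qe qm : ℤ) (β θ : ℝ) : ℂ := qe + coupling β θ * qm

/-- The two framings of a dyonic loop: `plain` for `W_d(γ)`, `dual` for `W̃_d(F(γ))`. -/
inductive Framing
  | plain
  | dual

/-- The other framing. -/
def Framing.flip : Framing → Framing
  | plain => dual
  | dual => plain

/-- A dyonic loop operator along a fixed contour together with the couplings of the theory. -/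
structure LoopData where
  framing : Framing
  charges : Fin 2 → ℤ
  β : ℝ
  θ : ℝ

/-- The expectation value of a loop operator along `γ`: `⟨W_d(γ)⟩` or `⟨W̃_d(F(γ))⟩`. -/
def LoopData.ev {N : ℕ} [NeZero N] (γ : Contour N false) (p : ℤ) (D : LoopData) : ℂ :=
  match D.framing with
  | .plain => evLoop γ p (D.charges 0) (D.charges 1) D.β D.θ
  | .dual => evDualLoop γ.toDual p (D.charges 0) (D.charges 1) D.β D.θ

/-- Poisson summation: it passes to the dual couplings, exchanges the electric and the magnetic
loop, and thereby changes the framing. -/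
def LoopData.poisson (D : LoopData) : LoopData :=
  ⟨D.framing.flip, ![D.charges 1, -D.charges 0], dualBeta D.β D.θ, dualTheta D.β D.θ⟩

/-- Flipping the framing. -/
def LoopData.flipFraming (D : LoopData) : LoopData := { D with framing := D.framing.flip }

/-- The `𝒮`-transformation: Poisson summation followed by flipping the framing. -/
def LoopData.sTransform (D : LoopData) : LoopData := D.poisson.flipFraming

end

end Villain

open Villain

/-!
The contour is Poincaré dual to `dl`, so integrating out `A^m` imposes `dn = q_m dl`. On this set
of `n` the linking terms in `Q` and in `γ̇·A^e` complete the action to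
`(β/2) F·F + (iθ/8π²) F·KF + i q_e F·Kl`, up to phases made of the numbers `u` and `v`. Here `K` is
the duality operator of the framing: the Hodge translation of one framing on `Im ∂` and that of the
other framing on `Ker d`. It is a symmetric involution exchanging `Im d` with `Im ∂`, and an integer
operator up to the linking terms.

Poisson summation over `n` replaces the matrix `a + ibK` by its inverse `(a - ibK) / (a² + b²)`, and
the substitution of `K` turns the dual sum into one of the same shape with `q_e` and `q_m` exchanged
and with the couplings `β̃` and `θ̃`. The Gaussian determinant does not depend on the charges, hence
cancels against the one of the partition function, and only the phases remain.
-/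

namespace Villain

noncomputable section

section IntegerVectors

variable {ι : Type*}

/-- The inclusion of the lattice `ℤ^ι` in `ℝ^ι`. -/
def realVec : (ι → ℤ) →+ (ι → ℝ) := (Int.castAddHom ℝ).compLeft ι

@[simp]
theorem realVec_apply (n : ι → ℤ) (i : ι) : realVec n i = n i := rfl

theorem realVec_zsmul (k : ℤ) (n : ι → ℤ) : realVec (k • n) = (k : ℝ) • realVec n := by
  rw [map_zsmul, Int.cast_smul_eq_zsmul]

theorem realVec_dotProduct_realVec [Fintype ι] (m n : ι → ℤ) :
    realVec m ⬝ᵥ realVec n = ((m ⬝ᵥ n : ℤ) : ℝ) := by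
  simp [dotProduct]

theorem exp_I_mul_two_pi_mul_intCast (k : ℤ) : Complex.exp (Complex.I * (2 * π * k : ℝ)) = 1 := by
  rw [← Complex.exp_int_mul_two_pi_mul_I k]
  push_cast
  ring_nf

end IntegerVectors

section GaussianBounds

variable {ι : Type*} [Fintype ι]

theorem summable_exp_neg_mul_sq_int {c : ℝ} (hc : 0 < c) :
    Summable fun n : ℤ => Real.exp (-c * (n : ℝ) ^ 2) := by
  have h := ((summable_jacobiTheta₂_term_iff 0 (Complex.I * (c / π : ℝ))).2
    (by simpa using div_pos hc pi_pos)).norm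
  refine h.congr fun n => ?_
  rw [norm_jacobiTheta₂_term]
  congr 1
  simp
  field_simp

theorem summable_pi_prod {κ : Type*} {f : ι → κ → ℝ} (hf : ∀ i, Summable (f i))
    (hf_nonneg : ∀ i k, 0 ≤ f i k) : Summable fun n : ι → κ => ∏ i, f i (n i) := by
  classical
  have prod_nonneg (n : ι → κ) : 0 ≤ ∏ i, f i (n i) := Finset.prod_nonneg fun i _ => hf_nonneg i _
  refine summable_of_sum_le (c := ∏ i, ∑' k, f i k) prod_nonneg fun s => ?_
  let box : ι → Finset κ := fun i => s.image fun n => n i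
  have subset_box : s ⊆ Fintype.piFinset box :=
    fun n hn => Fintype.mem_piFinset.2 fun i => Finset.mem_image_of_mem _ hn
  calc ∑ n ∈ s, ∏ i, f i (n i) ≤ ∑ n ∈ Fintype.piFinset box, ∏ i, f i (n i) :=
        Finset.sum_le_sum_of_subset_of_nonneg subset_box fun n _ _ => prod_nonneg n
    _ = ∏ i, ∑ k ∈ box i, f i k := (Finset.prod_univ_sum box f).symm
    _ ≤ ∏ i, ∑' k, f i k :=
      Finset.prod_le_prod (fun i _ => Finset.sum_nonneg fun k _ => hf_nonneg i k)
        fun i _ => (hf i).sum_le_tsum _ fun k _ => hf_nonneg i k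

theorem summable_exp_neg_mul_sum_sq {c : ℝ} (hc : 0 < c) :
    Summable fun n : ι → ℤ => Real.exp (-c * ∑ i, (n i : ℝ) ^ 2) := by
  refine (summable_pi_prod (fun _ : ι => summable_exp_neg_mul_sq_int hc)
    fun _ _ => (Real.exp_pos _).le).congr fun n => ?_
  rw [← Real.exp_sum, Finset.mul_sum]

theorem integrable_exp_neg_mul_sum_sq {c : ℝ} (hc : 0 < c) :
    Integrable fun x : ι → ℝ => Real.exp (-c * ∑ i, x i ^ 2) := by
  refine (Integrable.fintype_prod (f := fun (_ : ι) (x : ℝ) => Real.exp (-c * x ^ 2))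
    (μ := fun _ => volume) fun _ => integrable_exp_neg_mul_sq hc).congr (.of_forall fun x => ?_)
  simp only [← Real.exp_sum, Finset.mul_sum]

theorem exp_neg_sum_sq_add_le {c : ℝ} (hc : 0 ≤ c) (x y : ι → ℝ) :
    Real.exp (-c * ∑ i, (x i + y i) ^ 2) ≤
      Real.exp (c * ∑ i, x i ^ 2) * Real.exp (-(c / 2) * ∑ i, y i ^ 2) := by
  rw [← Real.exp_add, Real.exp_le_exp, Finset.mul_sum, Finset.mul_sum, Finset.mul_sum,
    ← Finset.sum_add_distrib]
  refine Finset.sum_le_sum fun i _ => ?_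
  nlinarith [mul_nonneg hc (sq_nonneg (2 * x i + y i))]

theorem exists_summable_gaussian_bound {X : Type*} [TopologicalSpace X] {s : Set X}
    (hs : IsCompact s) {a t : ℝ} (ha : 0 < a) (ht : t ≠ 0) {c : X → ι → ℝ}
    (hc : ContinuousOn c s) :
    ∃ u : (ι → ℤ) → ℝ, Summable u ∧ ∀ n, ∀ x ∈ s,
      Real.exp (-a * ∑ i, (c x i + t * n i) ^ 2) ≤ u n := by
  obtain ⟨R, hR⟩ := hs.exists_bound_of_continuousOn
    (f := fun x => Real.exp (a * ∑ i, c x i ^ 2)) (by fun_prop)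
  have rate_pos : 0 < a / 2 * t ^ 2 := by positivity
  refine ⟨fun n => R * Real.exp (-(a / 2 * t ^ 2) * ∑ i, (n i : ℝ) ^ 2),
    (summable_exp_neg_mul_sum_sq rate_pos).mul_left _, fun n x hx => ?_⟩
  have exp_le_R : Real.exp (a * ∑ i, c x i ^ 2) ≤ R := (le_abs_self _).trans (hR x hx)
  calc Real.exp (-a * ∑ i, (c x i + t * n i) ^ 2)
      ≤ Real.exp (a * ∑ i, c x i ^ 2) * Real.exp (-(a / 2) * ∑ i, (t * n i) ^ 2) :=
        exp_neg_sum_sq_add_le ha.le _ _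
    _ ≤ R * Real.exp (-(a / 2) * ∑ i, (t * n i) ^ 2) := by gcongr
    _ = R * Real.exp (-(a / 2 * t ^ 2) * ∑ i, (n i : ℝ) ^ 2) := by
        simp only [mul_pow, ← Finset.mul_sum]
        ring_nf

end GaussianBounds

section UnitCube

variable {ι : Type*}

/-- The cube `∏ᵢ (nᵢ, nᵢ + 1]`; its translates by `ℤ^ι` tile `ℝ^ι`. -/
def unitCube (n : ι → ℤ) : Set (ι → ℝ) := Set.univ.pi fun i => Set.Ioc (n i : ℝ) (n i + 1)

theorem mem_unitCube_iff {n : ι → ℤ} {x : ι → ℝ} : x ∈ unitCube n ↔ n = fun i => ⌈x i⌉ - 1 := by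
  simp only [unitCube, Set.mem_univ_pi, Set.mem_Ioc, funext_iff, eq_sub_iff_add_eq]
  refine forall_congr' fun i => ?_
  rw [eq_comm, Int.ceil_eq_iff]
  push_cast
  rw [add_sub_cancel_right]

theorem pairwise_disjoint_unitCube : Pairwise (Function.onFun Disjoint (unitCube (ι := ι))) :=
  fun _ _ hmn => Set.disjoint_left.2 fun _ hm hn =>
    hmn ((mem_unitCube_iff.1 hm).trans (mem_unitCube_iff.1 hn).symm)

theorem iUnion_unitCube : ⋃ n, unitCube (ι := ι) n = Set.univ :=
  Set.eq_univ_of_forall fun _ => Set.mem_iUnion.2 ⟨_, mem_unitCube_iff.2 rfl⟩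

theorem measurableSet_unitCube [Countable ι] (n : ι → ℤ) : MeasurableSet (unitCube n) :=
  MeasurableSet.univ_pi fun _ => measurableSet_Ioc

variable [Fintype ι] {E : Type*} [NormedAddCommGroup E] [NormedSpace ℝ E]

theorem setIntegral_unitCube (h : (ι → ℝ) → E) (n : ι → ℤ) :
    ∫ x in unitCube n, h x = ∫ x in unitCube 0, h (x + realVec n) := by
  have hmp : MeasurePreserving (· + realVec n) (volume : Measure (ι → ℝ)) volume :=
    measurePreserving_add_right volume _
  rw [← hmp.setIntegral_preimage_emb (MeasurableEquiv.addRight _).measurableEmbedding h]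
  congr 2
  ext x
  simp only [unitCube, Set.mem_preimage, Set.mem_univ_pi, Set.mem_Ioc, Pi.add_apply, realVec_apply,
    Pi.zero_apply, Int.cast_zero, add_comm (x _), add_le_add_iff_left, lt_add_iff_pos_right,
    zero_add]

theorem hasSum_integral_unitCube {h : (ι → ℝ) → E} (hh : Integrable h) :
    HasSum (fun n : ι → ℤ => ∫ x in unitCube 0, h (x + realVec n)) (∫ x, h x) := by
  have := hasSum_integral_iUnion (μ := volume) (f := h) measurableSet_unitCube
    pairwise_disjoint_unitCube hh.integrableOn
  rw [iUnion_unitCube, setIntegral_univ] at this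
  simpa only [setIntegral_unitCube h] using this

end UnitCube

section PoissonSummation

variable {ι : Type*}

theorem exists_continuousMap_torus_of_periodic {X : Type*} [TopologicalSpace X]
    {Φ : (ι → ℝ) → X} (hΦ : Continuous Φ) (hper : ∀ x n, Φ (x + realVec n) = Φ x) :
    ∃ g : C(UnitAddTorus ι, X), ∀ x : ι → ℝ, g (fun i => (x i : UnitAddCircle)) = Φ x := by
  let proj : C(ι → ℝ, UnitAddTorus ι) := ⟨fun x i => (x i : UnitAddCircle), by fun_prop⟩
  have hproj : Topology.IsQuotientMap proj := (IsOpenQuotientMap.piMap fun _ : ι =>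
    QuotientAddGroup.isOpenQuotientMap_mk (G := ℝ) (N := AddSubgroup.zmultiples 1)).isQuotientMap
  have hconst : ∀ x y, proj x = proj y → Φ x = Φ y := by
    intro x y hxy
    have hn (i : ι) : ∃ n : ℤ, x i = y i + n := by
      have hi : ((x i - y i : ℝ) : UnitAddCircle) = 0 := sub_eq_zero.2 (congrFun hxy i)
      obtain ⟨n, hn⟩ := (AddCircle.coe_eq_zero_iff 1).1 hi
      exact ⟨n, by rw [zsmul_one] at hn; rw [hn, add_sub_cancel]⟩
    choose n hn using hn
    rw [show x = y + realVec n from funext hn, hper]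
  exact ⟨hproj.lift ⟨Φ, hΦ⟩ hconst,
    fun x => DFunLike.congr_fun (hproj.lift_comp ⟨Φ, hΦ⟩ hconst) x⟩

theorem periodization_periodic {M : Type*} [AddCommMonoid M] [TopologicalSpace M]
    (f : (ι → ℝ) → M) (x : ι → ℝ) (m : ι → ℤ) :
    ∑' n : ι → ℤ, f (x + realVec m + realVec n) = ∑' n : ι → ℤ, f (x + realVec n) := by
  simp only [add_assoc, ← map_add]
  exact (Equiv.addLeft m).tsum_eq fun n => f (x + realVec n)

variable [Fintype ι]

theorem mFourier_coe (k : ι → ℤ) (x : ι → ℝ) :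
    UnitAddTorus.mFourier k (fun i => (x i : UnitAddCircle)) =
      Complex.exp (Complex.I * (2 * π * (realVec k ⬝ᵥ x) : ℝ)) := by
  simp only [UnitAddTorus.mFourier, ContinuousMap.coe_mk, fourier_coe_apply, dotProduct]
  rw [← Complex.exp_sum]
  push_cast
  simp only [Finset.mul_sum]
  congr 1
  refine Finset.sum_congr rfl fun i _ => ?_
  simp only [realVec_apply, Complex.ofReal_intCast]
  ring

theorem continuous_periodization {f : (ι → ℝ) → ℂ} (hf : Continuous f) {C c : ℝ} (hc : 0 < c)
    (hbound : ∀ x, ‖f x‖ ≤ C * Real.exp (-c * ∑ i, x i ^ 2)) :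
    Continuous fun x : ι → ℝ => ∑' n : ι → ℤ, f (x + realVec n) := by
  have hC : 0 ≤ C := nonneg_of_mul_nonneg_left ((norm_nonneg _).trans (hbound 0)) (Real.exp_pos _)
  refine continuous_iff_continuousAt.2 fun x₀ => ?_
  obtain ⟨u, hu, hgu⟩ := exists_summable_gaussian_bound (isCompact_closedBall x₀ 1) hc one_ne_zero
    (c := fun x : ι → ℝ => x) continuousOn_id
  refine (continuousOn_tsum (fun n => by fun_prop) (hu.mul_left C)
    fun n x hx => ?_).continuousAt (Metric.closedBall_mem_nhds x₀ one_pos)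
  refine (hbound _).trans (mul_le_mul_of_nonneg_left ?_ hC)
  simpa using hgu n x hx

theorem exp_neg_I_mul_realVec_dotProduct_add (k n : ι → ℤ) (x : ι → ℝ) :
    Complex.exp (-Complex.I * (2 * π * (realVec k ⬝ᵥ (x + realVec n)) : ℝ)) =
      Complex.exp (-Complex.I * (2 * π * (realVec k ⬝ᵥ x) : ℝ)) := by
  rw [dotProduct_add, realVec_dotProduct_realVec, mul_add, Complex.ofReal_add, mul_add,
    Complex.exp_add, neg_mul, neg_mul, Complex.exp_neg (Complex.I * (2 * π * _ : ℝ)),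
    Complex.exp_neg (Complex.I * (2 * π * ((_ : ℤ) : ℝ) : ℝ)), exp_I_mul_two_pi_mul_intCast,
    inv_one, mul_one]

theorem mFourierCoeff_periodization {f : (ι → ℝ) → ℂ} (hf : Integrable f)
    {g : UnitAddTorus ι → ℂ}
    (hg : ∀ x : ι → ℝ, g (fun i => (x i : UnitAddCircle)) = ∑' n, f (x + realVec n)) (k : ι → ℤ) :
    UnitAddTorus.mFourierCoeff g k =
      ∫ x : ι → ℝ, Complex.exp (-Complex.I * (2 * π * (realVec k ⬝ᵥ x) : ℝ)) * f x := by
  set F : (ι → ℝ) → ℂ := fun x =>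
    Complex.exp (-Complex.I * (2 * π * (realVec k ⬝ᵥ x) : ℝ)) * f x with hF
  have hFint : Integrable F := by
    refine hf.bdd_mul (c := 1) (Continuous.aestronglyMeasurable ?_) (.of_forall fun x => ?_)
    · simp only [dotProduct]
      fun_prop
    · rw [neg_mul, ← mul_neg, ← Complex.ofReal_neg, mul_comm, Complex.norm_exp_ofReal_mul_I]
  have hcube : {x : ι → ℝ | ∀ i, x i ∈ Set.Ioc ((0 : ι → ℝ) i) ((0 : ι → ℝ) i + 1)} =
      unitCube 0 := by
    ext x
    simp [unitCube]
  rw [UnitAddTorus.mFourierCoeff_eq_integral g k 0, hcube,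
    ← (hasSum_integral_unitCube hFint).tsum_eq]
  have hswap := integral_tsum_of_summable_integral_norm (μ := volume.restrict (unitCube (ι := ι) 0))
    (F := fun (n : ι → ℤ) x => F (x + realVec n))
    (fun n => (hFint.comp_add_right (realVec n)).integrableOn)
    (hasSum_integral_unitCube hFint.norm).summable
  have hterm (x : ι → ℝ) (n : ι → ℤ) : F (x + realVec n) =
      Complex.exp (-Complex.I * (2 * π * (realVec k ⬝ᵥ x) : ℝ)) * f (x + realVec n) := by
    simp only [hF, exp_neg_I_mul_realVec_dotProduct_add]
  rw [hswap]
  refine integral_congr_ae (.of_forall fun x => ?_)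
  simp only [hterm, tsum_mul_left, ← hg, mFourier_coe, map_neg, neg_dotProduct, mul_neg,
    Complex.ofReal_neg, neg_mul, smul_eq_mul]

theorem tsum_eq_tsum_integral_of_gaussian_bound {f : (ι → ℝ) → ℂ} (hf : Continuous f)
    {C c : ℝ} (hc : 0 < c) (hbound : ∀ x, ‖f x‖ ≤ C * Real.exp (-c * ∑ i, x i ^ 2))
    (hsum : Summable fun k : ι → ℤ =>
      ∫ x : ι → ℝ, Complex.exp (-Complex.I * (2 * π * (realVec k ⬝ᵥ x) : ℝ)) * f x) :
    ∑' n : ι → ℤ, f (realVec n) = ∑' k : ι → ℤ,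
      ∫ x : ι → ℝ, Complex.exp (-Complex.I * (2 * π * (realVec k ⬝ᵥ x) : ℝ)) * f x := by
  obtain ⟨g, hg⟩ := exists_continuousMap_torus_of_periodic (continuous_periodization hf hc hbound)
    (periodization_periodic f)
  have hint : Integrable f := ((integrable_exp_neg_mul_sum_sq hc).const_mul C).mono'
    hf.aestronglyMeasurable (.of_forall hbound)
  have hcoeff := funext (mFourierCoeff_periodization hint hg)
  have hseries := (UnitAddTorus.hasSum_mFourier_series_apply_of_summable
    (hcoeff ▸ hsum) fun _ => ((0 : ℝ) : UnitAddCircle)).tsum_eq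
  have hg0 := hg 0
  simp only [zero_add] at hg0
  rw [← hg0]
  refine hseries.symm.trans (tsum_congr fun k => ?_)
  rw [hcoeff, show (fun _ : ι => ((0 : ℝ) : UnitAddCircle)) =
    fun i => (((0 : ι → ℝ) i : ℝ) : UnitAddCircle) from rfl, mFourier_coe]
  simp

end PoissonSummation

section CompactIntegral

/-- The normalized Lebesgue measure `dA / 2π` on `[-π, π)`; its powers are the measures of
`compactIntegral`. -/
def angleMeasure : Measure ℝ := ENNReal.ofReal (1 / (2 * π)) • volume.restrict (Set.Ico (-π) π)

theorem integral_angleMeasure (f : ℝ → ℂ) :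
    ∫ x, f x ∂angleMeasure = ((1 / (2 * π) : ℝ) : ℂ) * ∫ x in -π..π, f x := by
  rw [angleMeasure, integral_smul_measure, ENNReal.toReal_ofReal (by positivity),
    integral_Ico_eq_integral_Ioc, ← intervalIntegral.integral_of_le (by linarith [pi_pos]),
    Complex.real_smul]

instance : IsProbabilityMeasure angleMeasure := by
  refine ⟨?_⟩
  rw [angleMeasure, Measure.smul_apply, Measure.restrict_apply_univ, Real.volume_Ico, smul_eq_mul,
    ← ENNReal.ofReal_mul (by positivity), ENNReal.ofReal_eq_one]
  field_simp
  ring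

theorem measurePreserving_neg_angleMeasure :
    MeasurePreserving (fun x : ℝ => -x) angleMeasure angleMeasure := by
  have hIcc : volume.restrict (Set.Ico (-π) π) = volume.restrict (Set.Icc (-π) π) :=
    Measure.restrict_congr_set Ico_ae_eq_Icc
  have h := (Measure.measurePreserving_neg (volume : Measure ℝ)).restrict_preimage
    (measurableSet_Icc (a := -π) (b := π))
  rw [show (Neg.neg ⁻¹' Set.Icc (-π) π : Set ℝ) = Set.Icc (-π) π by simp] at h
  rw [angleMeasure, hIcc]
  exact h.smul_measure _

theorem measurePreserving_units_mul_angleMeasure (s : ℤˣ) :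
    MeasurePreserving (fun x : ℝ => (s : ℝ) * x) angleMeasure angleMeasure := by
  rcases Int.units_eq_one_or s with rfl | rfl
  · simpa [Function.id_def] using MeasurePreserving.id angleMeasure
  · simpa using measurePreserving_neg_angleMeasure

theorem integral_exp_I_mul_intCast (k : ℤ) :
    ∫ x, Complex.exp (Complex.I * (x * k : ℝ)) ∂angleMeasure = if k = 0 then 1 else 0 := by
  split_ifs with hk
  · simp [hk]
  · have hI : Complex.I * k ≠ 0 := mul_ne_zero Complex.I_ne_zero (by exact_mod_cast hk)
    have hcomm (x : ℝ) : Complex.I * (x * k : ℝ) = Complex.I * k * x := by push_cast; ring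
    have hperiod : Complex.I * k * (π : ℝ) =
        Complex.I * k * ((-π : ℝ) : ℂ) + k * (2 * π * Complex.I) := by push_cast; ring
    simp only [integral_angleMeasure, hcomm]
    rw [integral_exp_mul_complex hI, hperiod, Complex.exp_add, Complex.exp_int_mul_two_pi_mul_I,
      mul_one, sub_self, zero_div, mul_zero]

variable {ι : Type} [Fintype ι]

theorem pi_angleMeasure : Measure.pi (fun _ : ι => angleMeasure) =
    ENNReal.ofReal (1 / (2 * π)) ^ Fintype.card ι •
      volume.restrict (Set.univ.pi fun _ : ι => Set.Ico (-π) π) := by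
  rw [volume_pi, Measure.restrict_pi_pi]
  refine Measure.pi_eq fun s _ => ?_
  simp [angleMeasure, Finset.prod_mul_distrib]

theorem compactIntegral_eq_integral (f : (ι → ℝ) → ℂ) :
    compactIntegral f = ∫ A, f A ∂Measure.pi fun _ => angleMeasure := by
  rw [pi_angleMeasure, integral_smul_measure, ENNReal.toReal_pow,
    ENNReal.toReal_ofReal (by positivity), Complex.real_smul, compactIntegral, Complex.ofReal_pow]

theorem ae_mem_Icc_pi_angleMeasure : ∀ᵐ A ∂Measure.pi fun _ : ι => angleMeasure,
    A ∈ Set.univ.pi fun _ : ι => Set.Icc (-π) π := by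
  rw [pi_angleMeasure]
  refine Measure.ae_smul_measure ?_ _
  filter_upwards [ae_restrict_mem (.univ_pi fun _ => measurableSet_Ico)] with A hA
  exact fun i hi => Set.Ico_subset_Icc_self (hA i hi)

theorem compactIntegral_exp_intCast (m : ι → ℤ) [Decidable (m = 0)] :
    compactIntegral (fun A : ι → ℝ => Complex.exp (Complex.I * (A ⬝ᵥ realVec m : ℝ))) =
      if m = 0 then 1 else 0 := by
  simp only [compactIntegral_eq_integral, dotProduct, realVec_apply, Complex.ofReal_sum,
    Finset.mul_sum, Complex.exp_sum]
  rw [integral_fintype_prod_eq_prod fun i (x : ℝ) => Complex.exp (Complex.I * (x * m i : ℝ))]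
  simp only [integral_exp_I_mul_intCast]
  split_ifs with hm
  · simp [hm]
  · obtain ⟨i, hi⟩ := Function.ne_iff.1 hm
    exact Finset.prod_eq_zero (Finset.mem_univ i) (if_neg hi)

theorem norm_compactIntegral_le {f : (ι → ℝ) → ℂ} {C : ℝ}
    (hf : ∀ A ∈ Set.univ.pi fun _ : ι => Set.Icc (-π) π, ‖f A‖ ≤ C) :
    ‖compactIntegral f‖ ≤ C := by
  rw [compactIntegral_eq_integral]
  simpa using norm_integral_le_of_norm_le_const (ae_mem_Icc_pi_angleMeasure.mono hf)

theorem compactIntegral_const_mul (c : ℂ) (f : (ι → ℝ) → ℂ) :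
    compactIntegral (fun A => c * f A) = c * compactIntegral f := by
  simp only [compactIntegral_eq_integral, integral_const_mul]

theorem compactIntegral_tsum {κ : Type*} [Countable κ] {f : κ → (ι → ℝ) → ℂ}
    (hf : ∀ k, Continuous (f k)) {u : κ → ℝ} (hu : Summable u)
    (hfu : ∀ k, ∀ A ∈ Set.univ.pi fun _ : ι => Set.Icc (-π) π, ‖f k A‖ ≤ u k) :
    compactIntegral (fun A => ∑' k, f k A) = ∑' k, compactIntegral (f k) := by
  simp only [compactIntegral_eq_integral]
  refine (hasSum_integral_of_dominated_convergence (fun k _ => u k)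
    (fun k => (hf k).aestronglyMeasurable) (fun k => ae_mem_Icc_pi_angleMeasure.mono (hfu k))
    (.of_forall fun _ => hu) (integrable_const _) ?_).tsum_eq.symm
  filter_upwards [ae_mem_Icc_pi_angleMeasure] with A hA
  exact (Summable.of_norm_bounded hu fun k => hfu k A hA).hasSum

theorem compactIntegral_signedPerm {κ : Type} [Fintype κ] (e : ι ≃ κ) (s : ι → ℤˣ)
    (f : (ι → ℝ) → ℂ) :
    compactIntegral (fun y : κ → ℝ => f fun i => s i * y (e i)) = compactIntegral f := by
  simp only [compactIntegral_eq_integral]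
  let perm := MeasurableEquiv.arrowCongr' e.symm (MeasurableEquiv.refl ℝ)
  let sign := MeasurableEquiv.piCongrRight fun i =>
    MeasurableEquiv.mulLeft₀ ((s i : ℤ) : ℝ) (by exact_mod_cast (s i).ne_zero)
  have hperm : MeasurePreserving perm (.pi fun _ => angleMeasure) (.pi fun _ => angleMeasure) :=
    measurePreserving_arrowCongr' _ _ e.symm (MeasurableEquiv.refl ℝ) fun _ => .id _
  have hsign : MeasurePreserving sign (.pi fun _ => angleMeasure) (.pi fun _ => angleMeasure) :=
    measurePreserving_pi _ _ fun i => measurePreserving_units_mul_angleMeasure (s i)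
  exact (hsign.comp hperm).integral_comp (perm.trans sign).measurableEmbedding f

end CompactIntegral

section Gaussian

variable {ι : Type*} [Fintype ι]

theorem exists_orthogonal_diagonalization (K : (ι → ℝ) →ₗ[ℝ] (ι → ℝ))
    (hK : ∀ x y, x ⬝ᵥ K y = K x ⬝ᵥ y) :
    ∃ (Ψ : (ι → ℝ) ≃ₗ[ℝ] (ι → ℝ)) (ev : ι → ℝ), MeasurePreserving Ψ volume volume ∧
      (∀ x y, Ψ x ⬝ᵥ Ψ y = x ⬝ᵥ y) ∧ ∀ x, K (Ψ x) = Ψ fun i => ev i * x i := by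
  classical
  have hM : K.toMatrix'.IsHermitian := by
    ext i j
    simpa [LinearMap.toMatrix'_apply] using (hK (Pi.single j 1) (Pi.single i 1)).trans (by simp)
  let b := hM.eigenvectorBasis
  let Ψ : (ι → ℝ) ≃ₗ[ℝ] (ι → ℝ) :=
    (WithLp.linearEquiv 2 ℝ (ι → ℝ)).symm.trans
      (b.repr.symm.toLinearEquiv.trans (WithLp.linearEquiv 2 ℝ (ι → ℝ)))
  have hΨ (x) : Ψ x = WithLp.ofLp (b.repr.symm (WithLp.toLp 2 x)) := rfl
  have hΨ_sum (x) : Ψ x = ∑ i, x i • WithLp.ofLp (b i) := by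
    rw [hΨ, ← b.sum_repr (b.repr.symm (WithLp.toLp 2 x))]
    simp
  refine ⟨Ψ, hM.eigenvalues, ?_, fun x y => ?_, fun x => ?_⟩
  · exact (PiLp.volume_preserving_ofLp ι).comp
      (b.repr.symm.measurePreserving.comp (PiLp.volume_preserving_toLp ι))
  · have := b.repr.symm.inner_map_map (WithLp.toLp 2 y) (WithLp.toLp 2 x)
    rw [EuclideanSpace.inner_eq_star_dotProduct, EuclideanSpace.inner_eq_star_dotProduct] at this
    simpa only [hΨ, star_trivial] using this
  · rw [hΨ_sum, hΨ_sum, map_sum]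
    refine Finset.sum_congr rfl fun i _ => ?_
    rw [map_smul, ← K.toMatrix'_mulVec, hM.mulVec_eigenvectorBasis, smul_smul, mul_comm]

/-- The Gaussian density `exp (-a/2 F·F - i b/2 F·KF - i w·F)`, with complex covariance
`(a + i b K)⁻¹` and source `w`. -/
def gaussianWeight (K : (ι → ℝ) →ₗ[ℝ] (ι → ℝ)) (a b : ℝ) (w F : ι → ℝ) : ℂ :=
  Complex.exp (-(a / 2 * (F ⬝ᵥ F) : ℝ) - Complex.I * (b / 2 * (F ⬝ᵥ K F) : ℝ)
    - Complex.I * (w ⬝ᵥ F : ℝ))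

theorem norm_exp_I_mul_ofReal (x : ℝ) : ‖Complex.exp (Complex.I * x)‖ = 1 := by
  rw [mul_comm, Complex.norm_exp_ofReal_mul_I]

theorem norm_gaussianWeight (K : (ι → ℝ) →ₗ[ℝ] (ι → ℝ)) (a b : ℝ) (w F : ι → ℝ) :
    ‖gaussianWeight K a b w F‖ = Real.exp (-(a / 2) * ∑ i, F i ^ 2) := by
  rw [gaussianWeight, Complex.norm_exp]
  simp [dotProduct, sq]

theorem continuous_gaussianWeight (K : (ι → ℝ) →ₗ[ℝ] (ι → ℝ)) (a b : ℝ) (w : ι → ℝ) :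
    Continuous (gaussianWeight K a b w) := by
  have := K.continuous_of_finiteDimensional
  unfold gaussianWeight dotProduct
  fun_prop

theorem summable_gaussianWeight (K : (ι → ℝ) →ₗ[ℝ] (ι → ℝ)) {a : ℝ} (ha : 0 < a) (b : ℝ)
    (w c : ι → ℝ) {t : ℝ} (ht : t ≠ 0) :
    Summable fun n : ι → ℤ => gaussianWeight K a b w (c + t • realVec n) := by
  obtain ⟨u, hu, hgu⟩ := exists_summable_gaussian_bound (isCompact_singleton (x := ()))
    (half_pos ha) ht (c := fun _ => c) continuousOn_const
  refine .of_norm_bounded hu fun n => ?_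
  rw [norm_gaussianWeight]
  exact hgu n () rfl

theorem inv_add_I_mul_eq {a b ε : ℝ} (hab : a ^ 2 + b ^ 2 ≠ 0) (hε : ε ^ 2 = 1) :
    ((a + Complex.I * (b * ε)) / 2 : ℂ)⁻¹ =
      2 * ((a / (a ^ 2 + b ^ 2) : ℝ) + Complex.I * ((-b / (a ^ 2 + b ^ 2) : ℝ) * ε)) := by
  have hab' : (a : ℂ) ^ 2 + (b : ℂ) ^ 2 ≠ 0 := by exact_mod_cast hab
  have hε' : (ε : ℂ) ^ 2 = 1 := by exact_mod_cast hε
  refine inv_eq_of_mul_eq_one_right ?_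
  push_cast
  field_simp
  linear_combination (-(b : ℂ) ^ 2 * (ε : ℂ) ^ 2) * Complex.I_sq + (b : ℂ) ^ 2 * hε'

theorem exists_integral_gaussian_diagonal {a : ℝ} (ha : 0 < a) (b : ℝ) {ε : ι → ℝ}
    (hε : ∀ i, ε i ^ 2 = 1) :
    ∃ C : ℂ, C ≠ 0 ∧ ∀ v : ι → ℝ,
      ∫ x : ι → ℝ, Complex.exp (-(a / 2 * (x ⬝ᵥ x) : ℝ)
        - Complex.I * (b / 2 * (x ⬝ᵥ fun i => ε i * x i) : ℝ) - Complex.I * (v ⬝ᵥ x : ℝ)) =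
      C * Complex.exp (-(a / (a ^ 2 + b ^ 2) / 2 * (v ⬝ᵥ v) : ℝ) -
        Complex.I * (-b / (a ^ 2 + b ^ 2) / 2 * (v ⬝ᵥ fun i => ε i * v i) : ℝ)) := by
  set B : ι → ℂ := fun i => (a + Complex.I * (b * ε i)) / 2 with hB
  have hBre (i : ι) : 0 < (B i).re := by simp [hB, ha]
  have hB0 (i : ι) : B i ≠ 0 := fun h => (hBre i).ne' (by rw [h, Complex.zero_re])
  refine ⟨∏ i, (π / B i) ^ (1 / 2 : ℂ), ?_, fun v => ?_⟩
  · refine Finset.prod_ne_zero_iff.2 fun i _ => ?_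
    rw [Ne, Complex.cpow_eq_zero_iff, not_and_or]
    exact Or.inl (div_ne_zero (by exact_mod_cast pi_ne_zero) (hB0 i))
  · have hexp (x : ι → ℝ) : Complex.exp (-(a / 2 * (x ⬝ᵥ x) : ℝ)
        - Complex.I * (b / 2 * (x ⬝ᵥ fun i => ε i * x i) : ℝ) - Complex.I * (v ⬝ᵥ x : ℝ)) =
        Complex.exp (-∑ i, B i * (x i : ℂ) ^ 2 + ∑ i, (-Complex.I * v i) * x i) := by
      congr 1
      simp only [dotProduct, hB]
      push_cast
      simp only [Finset.mul_sum, ← Finset.sum_neg_distrib, ← Finset.sum_sub_distrib,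
        ← Finset.sum_add_distrib]
      exact Finset.sum_congr rfl fun i _ => by ring
    simp only [hexp]
    rw [GaussianFourier.integral_cexp_neg_sum_mul_add hBre, Finset.prod_mul_distrib,
      ← Complex.exp_sum]
    congr 2
    simp only [dotProduct, Complex.ofReal_mul, Complex.ofReal_sum,
      Finset.mul_sum, ← Finset.sum_neg_distrib, ← Finset.sum_sub_distrib]
    refine Finset.sum_congr rfl fun i _ => ?_
    rw [div_eq_mul_inv, mul_inv, inv_add_I_mul_eq (by positivity) (hε i), mul_pow, neg_sq,
      Complex.I_sq]
    push_cast
    ring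

theorem exists_integral_gaussianWeight {K : (ι → ℝ) →ₗ[ℝ] (ι → ℝ)}
    (hK : ∀ x y, x ⬝ᵥ K y = K x ⬝ᵥ y) (hKK : Function.Involutive K) {a : ℝ} (ha : 0 < a) (b : ℝ) :
    ∃ C : ℂ, C ≠ 0 ∧ ∀ w : ι → ℝ, ∫ x, gaussianWeight K a b w x =
      C * gaussianWeight K (a / (a ^ 2 + b ^ 2)) (-b / (a ^ 2 + b ^ 2)) 0 w := by
  obtain ⟨Ψ, ev, hmp, horth, hdiag⟩ := exists_orthogonal_diagonalization K hK
  have hev (i : ι) : ev i ^ 2 = 1 := by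
    classical
    have h := hKK (Ψ (Pi.single i 1))
    rw [hdiag, hdiag] at h
    simpa [sq] using congrFun (Ψ.injective h) i
  obtain ⟨C, hC, hint⟩ := exists_integral_gaussian_diagonal ha b hev
  refine ⟨C, hC, fun w => ?_⟩
  obtain ⟨v, rfl⟩ := Ψ.surjective w
  rw [← hmp.integral_comp Ψ.toContinuousLinearEquiv.toHomeomorph.measurableEmbedding]
  simp only [gaussianWeight, hdiag, horth, hint, zero_dotProduct, Complex.ofReal_zero, mul_zero,
    sub_zero]

end Gaussian

section GaussianPoisson

variable {ι : Type*} [Fintype ι] (K : (ι → ℝ) →ₗ[ℝ] (ι → ℝ))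

theorem norm_gaussianWeight_add_smul_le {a : ℝ} (ha : 0 < a) (b : ℝ) (w c x : ι → ℝ) (t : ℝ) :
    ‖gaussianWeight K a b w (c + t • x)‖ ≤ Real.exp (a / 2 * ∑ i, c i ^ 2) *
      Real.exp (-(a / 4 * t ^ 2) * ∑ i, x i ^ 2) := by
  rw [norm_gaussianWeight]
  refine (exp_neg_sum_sq_add_le (half_pos ha).le c (t • x)).trans_eq ?_
  simp only [Pi.smul_apply, smul_eq_mul, mul_pow, ← Finset.mul_sum]
  ring_nf

theorem integral_gaussianWeight_comp_affine (a b : ℝ) (v c : ι → ℝ) {t : ℝ} (ht : 0 < t) :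
    ∫ x, gaussianWeight K a b v (c + t • x) =
      ((t ^ Fintype.card ι)⁻¹ : ℝ) * ∫ x, gaussianWeight K a b v x := by
  rw [Measure.integral_comp_smul volume (fun F => gaussianWeight K a b v (c + F)),
    integral_add_left_eq_self (gaussianWeight K a b v), Module.finrank_fintype_fun_eq_card,
    abs_of_pos (by positivity), Complex.real_smul]

theorem exp_mul_gaussianWeight_affine (a b : ℝ) (w z c x : ι → ℝ) (k : ι → ℤ) :
    Complex.exp (-Complex.I * (2 * π * (realVec k ⬝ᵥ x) : ℝ)) *
        (gaussianWeight K a b w (c + (2 * π) • x) * Complex.exp (Complex.I * (z ⬝ᵥ x : ℝ))) =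
      Complex.exp (Complex.I * ((realVec k - (1 / (2 * π)) • z) ⬝ᵥ c : ℝ)) *
        gaussianWeight K a b (w - (1 / (2 * π)) • z + realVec k) (c + (2 * π) • x) := by
  rw [gaussianWeight, gaussianWeight, ← Complex.exp_add, ← Complex.exp_add, ← Complex.exp_add]
  simp only [add_dotProduct, sub_dotProduct, smul_dotProduct, dotProduct_add, dotProduct_smul,
    smul_eq_mul]
  have hπ : (π : ℂ) ≠ 0 := by exact_mod_cast pi_ne_zero
  congr 1
  push_cast
  field_simp
  ring

variable {K}

theorem summable_exp_mul_gaussianWeight {a : ℝ} (ha : 0 < a) (b : ℝ) (w c : ι → ℝ)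
    (φ : (ι → ℤ) → ℝ) :
    Summable fun k : ι → ℤ =>
      Complex.exp (Complex.I * φ k) * gaussianWeight K a b w (c + realVec k) := by
  have h := (summable_gaussianWeight K ha b w c one_ne_zero).norm
  simp only [one_smul] at h
  refine .of_norm_bounded h fun k => ?_
  rw [norm_mul, norm_exp_I_mul_ofReal, one_mul]

theorem exists_poisson_gaussianWeight (hK : ∀ x y, x ⬝ᵥ K y = K x ⬝ᵥ y)
    (hKK : Function.Involutive K) {a : ℝ} (ha : 0 < a) (b : ℝ) :
    ∃ C : ℂ, C ≠ 0 ∧ ∀ w z c : ι → ℝ,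
      ∑' n, gaussianWeight K a b w (c + (2 * π) • realVec n) *
        Complex.exp (Complex.I * (z ⬝ᵥ realVec n : ℝ)) =
      C * ∑' k, Complex.exp (Complex.I * ((realVec k - (1 / (2 * π)) • z) ⬝ᵥ c : ℝ)) *
        gaussianWeight K (a / (a ^ 2 + b ^ 2)) (-b / (a ^ 2 + b ^ 2)) 0
          (w - (1 / (2 * π)) • z + realVec k) := by
  obtain ⟨C, hC, hint⟩ := exists_integral_gaussianWeight hK hKK ha b
  have hscale : (((2 * π) ^ Fintype.card ι)⁻¹ : ℝ) ≠ 0 := by positivity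
  refine ⟨(((2 * π) ^ Fintype.card ι)⁻¹ : ℝ) * C, mul_ne_zero (by exact_mod_cast hscale) hC,
    fun w z c => ?_⟩
  set f : (ι → ℝ) → ℂ := fun x => gaussianWeight K a b w (c + (2 * π) • x) *
    Complex.exp (Complex.I * (z ⬝ᵥ x : ℝ)) with hf
  have hcont : Continuous f := by
    refine ((continuous_gaussianWeight K a b w).comp (by fun_prop)).mul ?_
    simp only [dotProduct]
    fun_prop
  have hbound (x : ι → ℝ) : ‖f x‖ ≤ Real.exp (a / 2 * ∑ i, c i ^ 2) *
      Real.exp (-(a / 4 * (2 * π) ^ 2) * ∑ i, x i ^ 2) := by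
    rw [hf, norm_mul, norm_exp_I_mul_ofReal, mul_one]
    exact norm_gaussianWeight_add_smul_le K ha b w c x _
  have hcoeff (k : ι → ℤ) :
      ∫ x : ι → ℝ, Complex.exp (-Complex.I * (2 * π * (realVec k ⬝ᵥ x) : ℝ)) * f x =
        (((2 * π) ^ Fintype.card ι)⁻¹ : ℝ) * C *
        (Complex.exp (Complex.I * ((realVec k - (1 / (2 * π)) • z) ⬝ᵥ c : ℝ)) *
          gaussianWeight K (a / (a ^ 2 + b ^ 2)) (-b / (a ^ 2 + b ^ 2)) 0
            (w - (1 / (2 * π)) • z + realVec k)) := by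
    simp only [hf, exp_mul_gaussianWeight_affine]
    rw [integral_const_mul, integral_gaussianWeight_comp_affine K _ _ _ _ (by positivity), hint]
    ring
  have hsum : Summable fun k : ι → ℤ =>
      ∫ x : ι → ℝ, Complex.exp (-Complex.I * (2 * π * (realVec k ⬝ᵥ x) : ℝ)) * f x := by
    simp only [hcoeff]
    exact .mul_left _ (summable_exp_mul_gaussianWeight (by positivity) _ _ _ _)
  rw [← tsum_mul_left]
  simpa only [hcoeff] using
    tsum_eq_tsum_integral_of_gaussian_bound hcont (by positivity) hbound hsum

end GaussianPoisson

/-- The piece of a lattice complex around the middle dimension: `d` from `1`-forms and `b` from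
`3`-forms to `2`-forms with orthogonal images and with integral transposes `dT`, `bT`, and a
symmetric involution `K` of the `2`-forms which takes the image of `b` to that of `d`, through the
signed bijection `(e, s)` of the cells, and preserves integrality on the kernel of `dT`. -/
structure SelfDualComplex (ι₁ ι₂ ι₃ : Type) [Fintype ι₁] [Fintype ι₂] [Fintype ι₃] where
  d : (ι₁ → ℝ) →ₗ[ℝ] (ι₂ → ℝ)
  b : (ι₃ → ℝ) →ₗ[ℝ] (ι₂ → ℝ)
  dT : (ι₂ → ℤ) → (ι₁ → ℤ)
  bT : (ι₂ → ℤ) →+ (ι₃ → ℤ)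
  d_dotProduct : ∀ A k, d A ⬝ᵥ realVec k = A ⬝ᵥ realVec (dT k)
  b_dotProduct : ∀ y n, b y ⬝ᵥ realVec n = y ⬝ᵥ realVec (bT n)
  b_dotProduct_d : ∀ y A, b y ⬝ᵥ d A = 0
  K : (ι₂ → ℝ) →ₗ[ℝ] (ι₂ → ℝ)
  K_symm : ∀ x y, x ⬝ᵥ K y = K x ⬝ᵥ y
  K_involutive : Function.Involutive K
  Kint : (ι₂ → ℤ) ≃ (ι₂ → ℤ)
  K_realVec : ∀ k, dT k = 0 → K (realVec k) = realVec (Kint k)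
  bT_Kint_eq_zero_iff : ∀ k, bT (Kint k) = 0 ↔ dT k = 0
  e : ι₁ ≃ ι₃
  s : ι₁ → ℤˣ
  K_b : ∀ y, K (b y) = d fun i => s i * y (e i)

namespace SelfDualComplex

variable {ι₁ ι₂ ι₃ : Type} [Fintype ι₁] [Fintype ι₂] [Fintype ι₃] (S : SelfDualComplex ι₁ ι₂ ι₃)

theorem K_dotProduct_K (x y : ι₂ → ℝ) : S.K x ⬝ᵥ S.K y = x ⬝ᵥ y := by
  rw [S.K_symm, S.K_involutive]

open Classical in
/-- The sum of Gaussian weights over the integral `2`-forms `n` with `bT (n - qm l) = 0`,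
integrated over the compact `1`-forms. -/
def theta (a b : ℝ) (l : ι₂ → ℤ) (qe qm : ℤ) : ℂ :=
  compactIntegral fun A : ι₁ → ℝ => ∑' n : ι₂ → ℤ, if S.bT (n - qm • l) = 0 then
    gaussianWeight S.K a b ((qe : ℝ) • S.K (realVec l)) (S.d A + (2 * π) • realVec n) else 0

/-- The summand of the Poisson dual of `theta`, before the integration over the multiplier `y` of
the constraint `bT (n - m) = 0`. -/
def dualWeight (a b : ℝ) (w : ι₂ → ℝ) (m k : ι₂ → ℤ) (y : ι₃ → ℝ) : ℂ :=
  Complex.exp (-Complex.I * (S.b y ⬝ᵥ realVec m : ℝ)) *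
    gaussianWeight S.K a b 0 (w - (1 / (2 * π)) • S.b y + realVec k)

theorem continuous_dualWeight (a b : ℝ) (w : ι₂ → ℝ) (m k : ι₂ → ℤ) :
    Continuous (S.dualWeight a b w m k) := by
  have hb := S.b.continuous_of_finiteDimensional
  refine .mul ?_ ((continuous_gaussianWeight S.K a b 0).comp (by fun_prop))
  simp only [dotProduct]
  fun_prop

theorem exists_summable_norm_dualWeight_le {a : ℝ} (ha : 0 < a) (b : ℝ) (w : ι₂ → ℝ)
    (m : ι₂ → ℤ) :
    ∃ u : (ι₂ → ℤ) → ℝ, Summable u ∧ ∀ k, ∀ y ∈ Set.univ.pi fun _ : ι₃ => Set.Icc (-π) π,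
      ‖S.dualWeight a b w m k y‖ ≤ u k := by
  have hb := S.b.continuous_of_finiteDimensional
  obtain ⟨u, hu, hgu⟩ := exists_summable_gaussian_bound
    (isCompact_univ_pi fun _ : ι₃ => isCompact_Icc (a := -π) (b := π)) (half_pos ha) one_ne_zero
    (c := fun y => w - (1 / (2 * π)) • S.b y) (by fun_prop)
  refine ⟨u, hu, fun k y hy => ?_⟩
  rw [dualWeight, norm_mul, neg_mul, ← mul_neg, ← Complex.ofReal_neg, norm_exp_I_mul_ofReal,
    one_mul, norm_gaussianWeight]
  simp only [one_mul] at hgu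
  exact hgu k y hy

open Classical in
theorem compactIntegral_tsum_constraint {c : (ι₂ → ℤ) → ℂ} (hc : Summable c) (m : ι₂ → ℤ) :
    compactIntegral (fun y : ι₃ → ℝ => ∑' n : ι₂ → ℤ,
      c n * Complex.exp (Complex.I * (S.b y ⬝ᵥ realVec (n - m) : ℝ))) =
      ∑' n, if S.bT (n - m) = 0 then c n else 0 := by
  simp only [S.b_dotProduct]
  rw [compactIntegral_tsum (u := fun n => ‖c n‖)]
  · simp only [compactIntegral_const_mul, compactIntegral_exp_intCast, mul_ite, mul_one, mul_zero]
  · intro n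
    simp only [dotProduct]
    fun_prop
  · exact hc.norm
  · intro n y _
    rw [norm_mul, norm_exp_I_mul_ofReal, mul_one]

open Classical in
theorem exists_poisson_constraint {a : ℝ} (ha : 0 < a) (b : ℝ) :
    ∃ C : ℂ, C ≠ 0 ∧ ∀ (w : ι₂ → ℝ) (m : ι₂ → ℤ) (A : ι₁ → ℝ),
      (∑' n : ι₂ → ℤ, if S.bT (n - m) = 0 then
        gaussianWeight S.K a b w (S.d A + (2 * π) • realVec n) else 0) =
      C * ∑' k : ι₂ → ℤ, compactIntegral (S.dualWeight (a / (a ^ 2 + b ^ 2)) (-b / (a ^ 2 + b ^ 2))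
        w m k) * Complex.exp (Complex.I * (A ⬝ᵥ realVec (S.dT k) : ℝ)) := by
  obtain ⟨C, hC, hpoisson⟩ := exists_poisson_gaussianWeight S.K_symm S.K_involutive ha b
  refine ⟨C, hC, fun w m A => ?_⟩
  have hexp (n : ι₂ → ℤ) (y : ι₃ → ℝ) : Complex.exp (Complex.I * (S.b y ⬝ᵥ realVec (n - m) : ℝ)) =
      Complex.exp (Complex.I * (S.b y ⬝ᵥ realVec n : ℝ)) *
        Complex.exp (-Complex.I * (S.b y ⬝ᵥ realVec m : ℝ)) := by
    rw [← Complex.exp_add, map_sub, dotProduct_sub]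
    push_cast
    ring_nf
  have hphase (k : ι₂ → ℤ) (y : ι₃ → ℝ) :
      (realVec k - (1 / (2 * π)) • S.b y) ⬝ᵥ S.d A = A ⬝ᵥ realVec (S.dT k) := by
    rw [sub_dotProduct, smul_dotProduct, S.b_dotProduct_d, smul_zero, sub_zero, dotProduct_comm,
      S.d_dotProduct]
  have hdual (y : ι₃ → ℝ) : (∑' n, gaussianWeight S.K a b w (S.d A + (2 * π) • realVec n) *
      Complex.exp (Complex.I * (S.b y ⬝ᵥ realVec (n - m) : ℝ))) =
      C * ∑' k, Complex.exp (Complex.I * (A ⬝ᵥ realVec (S.dT k) : ℝ)) *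
        S.dualWeight (a / (a ^ 2 + b ^ 2)) (-b / (a ^ 2 + b ^ 2)) w m k y := by
    simp only [hexp, ← mul_assoc, tsum_mul_right, hpoisson, hphase, dualWeight]
    rw [mul_assoc, ← tsum_mul_right]
    exact congrArg _ (tsum_congr fun k => by ring)
  obtain ⟨u, hu, hbound⟩ := S.exists_summable_norm_dualWeight_le (a := a / (a ^ 2 + b ^ 2))
    (by positivity) (-b / (a ^ 2 + b ^ 2)) w m
  rw [← S.compactIntegral_tsum_constraint (summable_gaussianWeight S.K ha b w _ two_pi_pos.ne')]
  simp only [hdual]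
  rw [compactIntegral_const_mul, compactIntegral_tsum (f := fun k y =>
      Complex.exp (Complex.I * (A ⬝ᵥ realVec (S.dT k) : ℝ)) * S.dualWeight _ _ w m k y)
    (fun k => continuous_const.mul (S.continuous_dualWeight _ _ w m k)) hu fun k y hy => ?_]
  · exact congrArg _ (tsum_congr fun k => by rw [compactIntegral_const_mul, mul_comm])
  · rw [norm_mul, norm_exp_I_mul_ofReal, one_mul]
    exact hbound k y hy

open Classical in
theorem exists_theta_eq_tsum_dualWeight {a : ℝ} (ha : 0 < a) (b : ℝ) :
    ∃ C : ℂ, C ≠ 0 ∧ ∀ (l : ι₂ → ℤ) (qe qm : ℤ), S.theta a b l qe qm =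
      C * ∑' k, if S.dT k = 0 then compactIntegral (S.dualWeight (a / (a ^ 2 + b ^ 2))
        (-b / (a ^ 2 + b ^ 2)) ((qe : ℝ) • S.K (realVec l)) (qm • l) k) else 0 := by
  obtain ⟨C, hC, hpoisson⟩ := S.exists_poisson_constraint ha b
  refine ⟨C, hC, fun l qe qm => ?_⟩
  obtain ⟨u, hu, hbound⟩ := S.exists_summable_norm_dualWeight_le (a := a / (a ^ 2 + b ^ 2))
    (by positivity) (-b / (a ^ 2 + b ^ 2)) ((qe : ℝ) • S.K (realVec l)) (qm • l)
  simp only [theta, hpoisson]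
  rw [compactIntegral_const_mul, compactIntegral_tsum (fun k => ?_) hu fun k A _ => ?_]
  · simp only [compactIntegral_const_mul, compactIntegral_exp_intCast, mul_ite, mul_one, mul_zero]
  · simp only [dotProduct]
    fun_prop
  · rw [norm_mul, norm_exp_I_mul_ofReal, mul_one]
    exact norm_compactIntegral_le (hbound k)

open Classical in
theorem theta_eq_tsum {a : ℝ} (ha : 0 < a) (b : ℝ) (l : ι₂ → ℤ) (qe qm : ℤ) :
    S.theta a b l qe qm = ∑' n, if S.bT (n - qm • l) = 0 then
      compactIntegral (fun A => gaussianWeight S.K a b ((qe : ℝ) • S.K (realVec l))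
        (S.d A + (2 * π) • realVec n)) else 0 := by
  have hd := S.d.continuous_of_finiteDimensional
  obtain ⟨u, hu, hbound⟩ := exists_summable_gaussian_bound
    (isCompact_univ_pi fun _ : ι₁ => isCompact_Icc (a := -π) (b := π)) (half_pos ha)
    two_pi_pos.ne' hd.continuousOn
  have hcompact_zero : compactIntegral (fun _ : ι₁ → ℝ => 0) = 0 := by simp [compactIntegral]
  rw [theta, compactIntegral_tsum (fun n => ?_) hu fun n A hA => ?_]
  · exact tsum_congr fun n => by split_ifs <;> simp only [hcompact_zero]
  · split_ifs
    · exact (continuous_gaussianWeight ..).comp (by fun_prop)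
    · exact continuous_const
  · split_ifs
    · rw [norm_gaussianWeight]
      exact hbound n A hA
    · rw [norm_zero]
      exact (Real.exp_pos _).le.trans (hbound n A hA)

-- With `v = qe K l - b y / 2π + k`, the field strength on the right-hand side is `-2π K v`.
theorem dualWeight_eq_gaussianWeight (a b : ℝ) (l : ι₂ → ℤ) (qe qm : ℤ) {k : ι₂ → ℤ}
    (hk : S.dT k = 0) (y : ι₃ → ℝ) :
    S.dualWeight a b ((qe : ℝ) • S.K (realVec l)) (qm • l) k y =
      Complex.exp (-Complex.I * (2 * π * (qe * qm) * (realVec l ⬝ᵥ S.K (realVec l)) : ℝ)) *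
        gaussianWeight S.K (a / (4 * π ^ 2)) (b / (4 * π ^ 2)) ((qm : ℝ) • S.K (realVec l))
          ((S.d fun i => S.s i * y (S.e i)) + (2 * π) • realVec (-S.Kint k - qe • l)) := by
  set L := realVec l
  set v := (qe : ℝ) • S.K L - (1 / (2 * π)) • S.b y + realVec k with hv
  have field_eq : (S.d fun i => S.s i * y (S.e i)) + (2 * π) • realVec (-S.Kint k - qe • l) =
      -(2 * π) • S.K v := by
    rw [map_sub, map_neg, realVec_zsmul, ← S.K_b, ← S.K_realVec k hk, hv, map_add, map_sub,
      map_smul, map_smul, S.K_involutive]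
    match_scalars <;> field_simp
  have hvL : L ⬝ᵥ v = qe * (L ⬝ᵥ S.K L) - 1 / (2 * π) * (S.b y ⬝ᵥ L) + (l ⬝ᵥ k : ℤ) := by
    rw [hv, dotProduct_add, dotProduct_sub, dotProduct_smul, dotProduct_smul,
      dotProduct_comm L (S.b y), realVec_dotProduct_realVec, smul_eq_mul, smul_eq_mul]
  have hbL : S.b y ⬝ᵥ realVec (qm • l) = qm * (S.b y ⬝ᵥ L) := by
    rw [realVec_zsmul, dotProduct_smul, smul_eq_mul]
  rw [dualWeight, field_eq, hbL, ← mul_one (_ * _), ← exp_I_mul_two_pi_mul_intCast (qm * (l ⬝ᵥ k)),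
    gaussianWeight, gaussianWeight, ← Complex.exp_add, ← Complex.exp_add, ← Complex.exp_add]
  simp only [smul_dotProduct, dotProduct_smul, map_smul, S.K_dotProduct_K, smul_eq_mul,
    zero_dotProduct, hvL]
  have hπ : (π : ℂ) ≠ 0 := by exact_mod_cast pi_ne_zero
  congr 1
  push_cast
  field_simp
  ring

theorem exists_theta_duality {a : ℝ} (ha : 0 < a) (b : ℝ) :
    ∃ C : ℂ, C ≠ 0 ∧ ∀ (l : ι₂ → ℤ) (qe qm : ℤ), S.theta a b l qe qm = C *
      (Complex.exp (-Complex.I * (2 * π * (qe * qm) * (realVec l ⬝ᵥ S.K (realVec l)) : ℝ)) *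
        S.theta (a / (a ^ 2 + b ^ 2) / (4 * π ^ 2)) (-b / (a ^ 2 + b ^ 2) / (4 * π ^ 2))
          l qm (-qe)) := by
  classical
  obtain ⟨C, hC, hdual⟩ := S.exists_theta_eq_tsum_dualWeight ha b
  refine ⟨C, hC, fun l qe qm => ?_⟩
  let shift : (ι₂ → ℤ) ≃ (ι₂ → ℤ) := S.Kint.trans ((Equiv.neg _).trans (Equiv.subRight (qe • l)))
  have bT_shift (k : ι₂ → ℤ) : S.bT (-S.Kint k - qe • l - -qe • l) = 0 ↔ S.dT k = 0 := by
    rw [neg_smul, sub_neg_eq_add, sub_add_cancel, map_neg, neg_eq_zero, S.bT_Kint_eq_zero_iff]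
  rw [hdual, S.theta_eq_tsum (by positivity), ← tsum_mul_left (a := Complex.exp _)]
  congr 1
  rw [← shift.tsum_eq (fun _ => _ * _)]
  refine tsum_congr fun k => ?_
  change _ = _ * ite (S.bT (-S.Kint k - qe • l - -qe • l) = 0)
    (compactIntegral fun A => gaussianWeight _ _ _ _ (_ + (2 * π) • realVec (-S.Kint k - qe • l))) 0
  by_cases hk : S.dT k = 0
  · rw [if_pos hk, if_pos ((bT_shift k).2 hk), ← compactIntegral_signedPerm S.e S.s,
      ← compactIntegral_const_mul]
    exact congrArg _ (funext fun y => S.dualWeight_eq_gaussianWeight _ _ l qe qm hk y)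
  · rw [if_neg hk, if_neg (mt (bT_shift k).1 hk), mul_zero]

end SelfDualComplex

section Site

variable {N : ℕ} {half : Bool}

theorem Site.shift_shift (x : Site N half) (v w : Fin 4 → ZMod N) :
    (x.shift v).shift w = x.shift (v + w) := by
  simp only [Site.shift, add_assoc]

theorem Site.shift_zero (x : Site N half) : x.shift 0 = x := by
  simp only [Site.shift, add_zero]

/-- Translations as permutations of the sites. -/
def shiftEquiv (N : ℕ) (half : Bool) (v : Fin 4 → ZMod N) : Site N half ≃ Site N half where
  toFun x := x.shift v
  invFun x := x.shift (-v)
  left_inv x := by simp only [Site.shift_shift, add_neg_cancel, Site.shift_zero]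
  right_inv x := by simp only [Site.shift_shift, neg_add_cancel, Site.shift_zero]

theorem sum_shift [NeZero N] {M : Type*} [AddCommMonoid M] (f : Site N half → M)
    (v : Fin 4 → ZMod N) : ∑ x : Site N half, f (x.shift v) = ∑ x, f x :=
  (shiftEquiv N half v).sum_comp f

theorem sum_shift_mul [NeZero N] {R : Type*} [NonUnitalNonAssocSemiring R] (f g : Site N half → R)
    (v : Fin 4 → ZMod N) :
    ∑ x : Site N half, f (x.shift v) * g x = ∑ x, f x * g (x.shift (-v)) := by
  rw [← sum_shift (fun x => f x * g (x.shift (-v))) v]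
  simp only [Site.shift_shift, add_neg_cancel, Site.shift_zero]

theorem dirs_singleton (N : ℕ) (μ : Fin 4) : dirs N {μ} = Pi.single μ 1 := by
  ext ν
  simp only [dirs, Finset.mem_singleton, Pi.single_apply]

theorem dirs_insert (N : ℕ) {S : Finset (Fin 4)} {μ : Fin 4} (h : μ ∉ S) :
    dirs N (insert μ S) = dirs N S + dirs N {μ} := by
  ext ν
  by_cases hν : ν = μ
  · subst hν
    simp [dirs, h]
  · simp [dirs, hν]

-- On the dual lattice the constant `-1` of the reflection enters twice and cancels.
theorem Site.reflect_shift_reflect (μ : Fin 4) (x : Site N half) (v : Fin 4 → ZMod N) :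
    ((x.reflect μ).shift v).reflect μ = x.shift fun ν => if μ ≤ ν then -v ν else v ν := by
  refine congrArg Site.mk (funext fun ν => ?_)
  cases half <;> by_cases hν : μ ≤ ν <;> simp [Site.shift, Site.reflect, hν] <;> ring

end Site

section Components

variable {N : ℕ} {half : Bool} {R : Type} [CommRing R]

theorem val_of_card {r : ℕ} (α : Form N half r R) (x : Site N half) {S : Finset (Fin 4)}
    (h : S.card = r) : val α x S = α (x, ⟨S, h⟩) := dif_pos h

theorem val_of_card_ne {r : ℕ} (α : Form N half r R) (x : Site N half) {S : Finset (Fin 4)}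
    (h : S.card ≠ r) : val α x S = 0 := dif_neg h

theorem form_ext {r : ℕ} {α β : Form N half r R}
    (h : ∀ x S, S.card = r → val α x S = val β x S) : α = β := by
  ext ⟨x, S, hS⟩
  simpa only [val_of_card _ _ hS] using h x S hS

theorem val_add {r : ℕ} (α β : Form N half r R) (x : Site N half) (S : Finset (Fin 4)) :
    val (α + β) x S = val α x S + val β x S := by
  by_cases h : S.card = r
  · simp only [val_of_card _ _ h, Pi.add_apply]
  · simp only [val_of_card_ne _ _ h, add_zero]

theorem val_smul {r : ℕ} (a : R) (α : Form N half r R) (x : Site N half) (S : Finset (Fin 4)) :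
    val (a • α) x S = a * val α x S := by
  by_cases h : S.card = r
  · simp only [val_of_card _ _ h, Pi.smul_apply, smul_eq_mul]
  · simp only [val_of_card_ne _ _ h, mul_zero]

theorem val_sub {r : ℕ} (α β : Form N half r R) (x : Site N half) (S : Finset (Fin 4)) :
    val (α - β) x S = val α x S - val β x S := by
  rw [eq_sub_iff_add_eq, ← val_add, sub_add_cancel]

theorem val_zero (r : ℕ) (x : Site N half) (S : Finset (Fin 4)) :
    val (0 : Form N half r R) x S = 0 := by
  unfold val
  split_ifs <;> rfl

theorem val_realVec {r : ℕ} (n : Form N half r ℤ) (x : Site N half) (S : Finset (Fin 4)) :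
    val (realVec n : Form N half r ℝ) x S = (val n x S : ℤ) := by
  by_cases h : S.card = r
  · simp only [val_of_card _ _ h, realVec_apply]
  · simp only [val_of_card_ne _ _ h, Int.cast_zero]

theorem val_extDeriv {r : ℕ} (α : Form N half r R) (x : Site N half) {S : Finset (Fin 4)}
    (h : S.card = r + 1) : val (extDeriv α) x S = ∑ μ ∈ S, (shuffleSign {μ} (S.erase μ) : R) *
      (val α (x.shift (dirs N {μ})) (S.erase μ) - val α x (S.erase μ)) :=
  val_of_card _ _ h

theorem val_boundary {r : ℕ} (α : Form N half (r + 1) R) (x : Site N half) {S : Finset (Fin 4)}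
    (h : S.card = r) : val (boundary α) x S = ∑ ν ∈ Sᶜ, (shuffleSign S {ν} : R) *
      (val α x (insert ν S) - val α (x.shift (-dirs N {ν})) (insert ν S)) :=
  val_of_card _ _ h

theorem val_cup {p q : ℕ} (α : Form N half p R) (β : Form N half q R) (x : Site N half)
    {S : Finset (Fin 4)} (h : S.card = p + q) : val (cup α β) x S =
      ∑ A ∈ S.powerset, (shuffleSign A (S \ A) : R) *
        (val α x A * val β (x.shift (dirs N A)) (S \ A)) :=
  val_of_card _ _ h

theorem val_parity {r : ℕ} (μ : Fin 4) (α : Form N half r R) (x : Site N half)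
    (S : Finset (Fin 4)) : val (parity μ α) x S = (-1) ^ (S.filter (μ ≤ ·)).card *
      val α ((x.reflect μ).shift (-dirs N (S.filter (μ ≤ ·)))) S := by
  by_cases h : S.card = r
  · rw [val_of_card _ _ h, val_of_card _ _ h, parity]
  · rw [val_of_card_ne _ _ h, val_of_card_ne _ _ h, mul_zero]

theorem val_interiorProduct {r : ℕ} {μ : Fin 4} (α : Form N half (r + 1) R) (x : Site N half)
    {S : Finset (Fin 4)} (h : μ ∉ S) :
    val (interiorProduct μ α) x S = (shuffleSign {μ} S : R) * val α x (insert μ S) := by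
  by_cases hS : S.card = r
  · rw [val_of_card _ _ hS, interiorProduct]
  · rw [val_of_card_ne _ _ hS, val_of_card_ne, mul_zero]
    rwa [Finset.card_insert_of_notMem h, Ne, Nat.add_right_cancel_iff]

theorem val_interiorProduct_of_mem {r : ℕ} {μ : Fin 4} (α : Form N half (r + 1) R)
    (x : Site N half) {S : Finset (Fin 4)} (h : μ ∈ S) : val (interiorProduct μ α) x S = 0 := by
  by_cases hS : S.card = r
  · rw [val_of_card _ _ hS, interiorProduct, val_of_card_ne, mul_zero]
    rw [Finset.insert_eq_of_mem h, hS]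
    exact r.succ_ne_self.symm
  · exact val_of_card_ne _ _ hS

theorem val_parity_mul_val_parity {p q : ℕ} (μ : Fin 4) (α : Form N half p R)
    (β : Form N half q R) (x : Site N half) {A B : Finset (Fin 4)} (h : Disjoint A B) :
    (-1) ^ ((A ∪ B).filter (μ ≤ ·)).card *
      (val (parity μ α) ((x.reflect μ).shift (-dirs N ((A ∪ B).filter (μ ≤ ·)))) A *
        val (parity μ β)
          (((x.reflect μ).shift (-dirs N ((A ∪ B).filter (μ ≤ ·)))).shift (dirs N A)) B) =
      val α (x.shift (dirs N (B.filter (μ ≤ ·)))) A *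
        val β (x.shift (dirs N (A.filter (· < μ)))) B := by
  have sign_eq : ((-1) ^ ((A ∪ B).filter (μ ≤ ·)).card : R) =
      (-1) ^ (A.filter (μ ≤ ·)).card * (-1) ^ (B.filter (μ ≤ ·)).card := by
    rw [← pow_add, Finset.filter_union,
      Finset.card_union_of_disjoint (Finset.disjoint_filter_filter h)]
  have sign_sq (n : ℕ) : ((-1) ^ n * (-1) ^ n : R) = 1 := by
    rw [← mul_pow, neg_one_mul, neg_neg, one_pow]
  have notMem_right {ν : Fin 4} : ν ∈ A → ν ∉ B := fun hA hB => Finset.disjoint_left.1 h hA hB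
  rw [val_parity, val_parity, Site.shift_shift (x.reflect μ), Site.reflect_shift_reflect,
    Site.reflect_shift_reflect, Site.shift_shift, Site.shift_shift, sign_eq]
  have shift_left : ((fun ν => if μ ≤ ν then -(-dirs N ((A ∪ B).filter (μ ≤ ·))) ν
      else (-dirs N ((A ∪ B).filter (μ ≤ ·))) ν) + -dirs N (A.filter (μ ≤ ·))) =
      dirs N (B.filter (μ ≤ ·)) := by
    ext ν
    by_cases hν : μ ≤ ν <;> by_cases hA : ν ∈ A <;> by_cases hB : ν ∈ B <;>
      first | exact (notMem_right hA hB).elim | simp [dirs, hν, hA, hB]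
  have shift_right : ((fun ν => if μ ≤ ν then -(-dirs N ((A ∪ B).filter (μ ≤ ·)) + dirs N A) ν
      else (-dirs N ((A ∪ B).filter (μ ≤ ·)) + dirs N A) ν) + -dirs N (B.filter (μ ≤ ·))) =
      dirs N (A.filter (· < μ)) := by
    ext ν
    by_cases hν : μ ≤ ν <;> by_cases hA : ν ∈ A <;> by_cases hB : ν ∈ B <;>
      first | exact (notMem_right hA hB).elim | simp [dirs, hν, hA, hB, not_lt.2, lt_of_not_ge]
  rw [shift_left, shift_right]
  linear_combination (val α (x.shift (dirs N (B.filter (μ ≤ ·)))) A *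
    val β (x.shift (dirs N (A.filter (· < μ)))) B) * (sign_sq (A.filter (μ ≤ ·)).card *
      (-1) ^ (B.filter (μ ≤ ·)).card * (-1) ^ (B.filter (μ ≤ ·)).card +
      sign_sq (B.filter (μ ≤ ·)).card)

theorem val_parity_cup_parity {p q : ℕ} (μ : Fin 4) (α : Form N half p R) (β : Form N half q R)
    (x : Site N half) {S : Finset (Fin 4)} (h : S.card = p + q) :
    val (parity μ (cup (parity μ α) (parity μ β))) x S =
      ∑ A ∈ S.powerset, (shuffleSign A (S \ A) : R) *
        (val α (x.shift (dirs N ((S \ A).filter (μ ≤ ·)))) A *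
          val β (x.shift (dirs N (A.filter (· < μ)))) (S \ A)) := by
  rw [val_parity, val_cup _ _ _ h, Finset.mul_sum]
  refine Finset.sum_congr rfl fun A hA => ?_
  have key := val_parity_mul_val_parity μ α β x (Finset.disjoint_sdiff (s := A) (t := S))
  rw [Finset.union_sdiff_of_subset (Finset.mem_powerset.1 hA)] at key
  rw [mul_left_comm, key]

theorem val_cupOne {p q : ℕ} (α : Form N half (p + 1) R) (β : Form N half (q + 1) R)
    (x : Site N half) {S : Finset (Fin 4)} (h : S.card = p + q + 1) :
    val (cupOne α β) x S = (-1) ^ (q + 1) * ∑ μ ∈ S, (-1) ^ (S.filter (· ≤ μ)).card *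
      ∑ A ∈ (S.erase μ).powerset, (shuffleSign A (S.erase μ \ A) : R) *
        (((shuffleSign {μ} A : R) *
            val α (x.shift (dirs N ((S.erase μ \ A).filter (μ ≤ ·)))) (insert μ A)) *
          ((shuffleSign {μ} (S.erase μ \ A) : R) *
            val β (x.shift (dirs N (A.filter (· < μ)))) (insert μ (S.erase μ \ A)))) := by
  rw [val_of_card _ _ h, cupOne]
  congr 1
  refine Finset.sum_congr rfl fun μ hμ => ?_
  have card_erase : (S.erase μ).card = p + q := by
    rw [Finset.card_erase_of_mem hμ, h, Nat.add_sub_cancel]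
  rw [val_parity_cup_parity _ _ _ _ card_erase]
  congr 1
  refine Finset.sum_congr rfl fun A hA => ?_
  have hμA : μ ∉ A := fun hμA => S.notMem_erase μ (Finset.mem_powerset.1 hA hμA)
  have hμAc : μ ∉ S.erase μ \ A := fun hμA => S.notMem_erase μ (Finset.mem_sdiff.1 hμA).1
  rw [val_interiorProduct _ _ hμA, val_interiorProduct _ _ hμAc]

theorem sum_powerset_of_card_one {ι M : Type*} [AddCommMonoid M] {S : Finset ι}
    {g : Finset ι → M} (hg : ∀ A ⊆ S, A.card ≠ 1 → g A = 0) :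
    ∑ A ∈ S.powerset, g A = ∑ i ∈ S, g {i} := by
  rw [← Finset.sum_filter_of_ne fun A hA h => not_imp_comm.1 (hg A (Finset.mem_powerset.1 hA)) h,
    ← Finset.powersetCard_eq_filter, Finset.powersetCard_one, Finset.sum_map]
  rfl

theorem sum_powerset_sdiff {ι M : Type*} [DecidableEq ι] [AddCommMonoid M] (S : Finset ι)
    (g : Finset ι → M) : ∑ A ∈ S.powerset, g (S \ A) = ∑ A ∈ S.powerset, g A := by
  have sdiff_sdiff {A : Finset ι} (hA : A ∈ S.powerset) : S \ (S \ A) = A :=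
    Finset.sdiff_sdiff_eq_self (Finset.mem_powerset.1 hA)
  exact Finset.sum_nbij' (S \ ·) (S \ ·) (by simp) (by simp) (fun _ => sdiff_sdiff)
    (fun _ => sdiff_sdiff) fun _ _ => rfl

end Components

section Sign

theorem shuffleSign_mul_self (A B : Finset (Fin 4)) : shuffleSign A B * shuffleSign A B = 1 := by
  rw [shuffleSign, ← mul_pow, neg_one_mul, neg_neg, one_pow]

theorem shuffleSign_singleton_insert : ∀ {μ ν : Fin 4} {S : Finset (Fin 4)}, ν ∉ S →
    shuffleSign {μ} (insert ν S) = shuffleSign {μ} {ν} * shuffleSign {μ} S := by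
  decide

theorem shuffleSign_singleton_swap : ∀ {μ ν : Fin 4}, μ ≠ ν →
    shuffleSign {μ} {ν} = -shuffleSign {ν} {μ} := by
  decide

theorem shuffleSign_singleton_right : ∀ {S : Finset (Fin 4)} {μ : Fin 4}, μ ∉ S →
    shuffleSign S {μ} = (-1) ^ S.card * shuffleSign {μ} S := by
  decide

end Sign

section Translate

variable {N : ℕ} {half : Bool} {R : Type} {r : ℕ}

/-- The translate of a form by `v`. -/
def translate (v : Fin 4 → ZMod N) (α : Form N half r R) : Form N half r R :=
  fun c => α (c.1.shift v, c.2)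

theorem translate_add (v w : Fin 4 → ZMod N) (α : Form N half r R) :
    translate (v + w) α = translate v (translate w α) := by
  ext c
  simp only [translate, Site.shift_shift]

theorem translate_zero (α : Form N half r R) : translate 0 α = α := by
  ext c
  simp only [translate, Site.shift_zero]

end Translate

section Exterior

variable {N : ℕ} {half : Bool} {R : Type} [CommRing R] {r : ℕ}

/-- The exterior derivative as a linear map. -/
def extDerivHom (N : ℕ) (half : Bool) (r : ℕ) (R : Type) [CommRing R] :
    Form N half r R →ₗ[R] Form N half (r + 1) R where
  toFun := extDeriv
  map_add' α β := by
    ext c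
    simp only [extDeriv, Pi.add_apply, val_add, ← Finset.sum_add_distrib]
    exact Finset.sum_congr rfl fun _ _ => by ring
  map_smul' a α := by
    ext c
    simp only [extDeriv, Pi.smul_apply, val_smul, smul_eq_mul, Finset.mul_sum, RingHom.id_apply]
    exact Finset.sum_congr rfl fun _ _ => by ring

/-- The boundary operator as a linear map. -/
def boundaryHom (N : ℕ) (half : Bool) (r : ℕ) (R : Type) [CommRing R] :
    Form N half (r + 1) R →ₗ[R] Form N half r R where
  toFun := boundary
  map_add' α β := by
    ext c
    simp only [boundary, Pi.add_apply, val_add, ← Finset.sum_add_distrib]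
    exact Finset.sum_congr rfl fun _ _ => by ring
  map_smul' a α := by
    ext c
    simp only [boundary, Pi.smul_apply, val_smul, smul_eq_mul, Finset.mul_sum, RingHom.id_apply]
    exact Finset.sum_congr rfl fun _ _ => by ring

theorem extDeriv_add (α β : Form N half r R) : extDeriv (α + β) = extDeriv α + extDeriv β :=
  (extDerivHom N half r R).map_add α β

theorem extDeriv_sub (α β : Form N half r R) : extDeriv (α - β) = extDeriv α - extDeriv β :=
  (extDerivHom N half r R).map_sub α β

theorem extDeriv_smul (a : R) (α : Form N half r R) : extDeriv (a • α) = a • extDeriv α :=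
  (extDerivHom N half r R).map_smul a α

theorem boundary_sub (α β : Form N half (r + 1) R) :
    boundary (α - β) = boundary α - boundary β :=
  (boundaryHom N half r R).map_sub α β

theorem realVec_extDeriv (n : Form N half r ℤ) :
    realVec (extDeriv n) = extDeriv (realVec n : Form N half r ℝ) := by
  ext c
  simp only [realVec_apply, extDeriv, val_realVec]
  push_cast
  rfl

theorem realVec_boundary (n : Form N half (r + 1) ℤ) :
    realVec (boundary n) = boundary (realVec n : Form N half (r + 1) ℝ) := by
  ext c
  simp only [realVec_apply, boundary, val_realVec]
  push_cast
  rfl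

theorem sum_sum_erase_eq_zero {ι M : Type*} [DecidableEq ι] [AddCommGroup M] {S : Finset ι}
    {g : ι → ι → M} (hg : ∀ i ∈ S, ∀ j ∈ S, i ≠ j → g i j + g j i = 0) :
    ∑ i ∈ S, ∑ j ∈ S.erase i, g i j = 0 := by
  rw [Finset.sum_sigma']
  refine Finset.sum_involution (fun p _ => ⟨p.2, p.1⟩) ?_ ?_ ?_ fun _ _ => rfl
  all_goals
    rintro ⟨i, j⟩ hij
    simp only [Finset.mem_sigma, Finset.mem_erase] at hij
  · exact hg i hij.1 j hij.2.2 hij.2.1.symm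
  · exact fun _ h => hij.2.1 (congrArg Sigma.fst h)
  · simp only [Finset.mem_sigma, Finset.mem_erase]
    exact ⟨hij.2.2, hij.2.1.symm, hij.1⟩

theorem extDeriv_extDeriv (α : Form N half r R) : extDeriv (extDeriv α) = 0 := by
  refine form_ext fun x S hS => ?_
  have card_erase {μ : Fin 4} (hμ : μ ∈ S) : (S.erase μ).card = r + 1 := by
    rw [Finset.card_erase_of_mem hμ, hS, Nat.add_sub_cancel]
  rw [val_extDeriv _ _ hS, val_zero, Finset.sum_congr rfl fun μ hμ => by
    rw [val_extDeriv _ _ (card_erase hμ), val_extDeriv _ _ (card_erase hμ),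
      ← Finset.sum_sub_distrib, Finset.mul_sum]]
  refine sum_sum_erase_eq_zero fun μ hμ ν hν hne => ?_
  set T := (S.erase μ).erase ν with hT
  have erase_left : S.erase μ = insert ν T :=
    (Finset.insert_erase (Finset.mem_erase.2 ⟨hne.symm, hν⟩)).symm
  have erase_right : S.erase ν = insert μ T := by
    rw [hT, Finset.erase_right_comm, Finset.insert_erase (Finset.mem_erase.2 ⟨hne, hμ⟩)]
  have hμT : μ ∉ T := fun h => S.notMem_erase μ (Finset.mem_of_mem_erase h)
  have hνT : ν ∉ T := Finset.notMem_erase ν _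
  rw [erase_right, erase_left, Finset.erase_insert hμT, shuffleSign_singleton_insert hνT,
    shuffleSign_singleton_insert hμT, shuffleSign_singleton_swap hne]
  simp only [Site.shift_shift, add_comm (dirs N {ν})]
  push_cast
  ring

theorem val_translate (v : Fin 4 → ZMod N) (α : Form N half r R) (x : Site N half)
    (S : Finset (Fin 4)) : val (translate v α) x S = val α (x.shift v) S := rfl

theorem boundary_translate (v : Fin 4 → ZMod N) (α : Form N half (r + 1) R) :
    boundary (translate v α) = translate v (boundary α) := by
  ext c
  simp only [boundary, translate, val_translate, Site.shift_shift, add_comm]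

-- Cartan's formula; the Lie derivative along a lattice direction is the difference operator.
theorem extDeriv_interiorProduct_add_interiorProduct_extDeriv (μ : Fin 4)
    (α : Form N half (r + 1) R) :
    extDeriv (interiorProduct μ α) + interiorProduct μ (extDeriv α) =
      translate (dirs N {μ}) α - α := by
  refine form_ext fun x S hS => ?_
  have sign_sq (T : Finset (Fin 4)) : (shuffleSign {μ} T * shuffleSign {μ} T : R) = 1 := by
    exact_mod_cast congrArg (Int.cast (R := R)) (shuffleSign_mul_self {μ} T)
  rw [val_add, val_sub, val_translate, val_extDeriv _ _ hS]
  by_cases hμ : μ ∈ S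
  · have notMem_erase := S.notMem_erase μ
    rw [val_interiorProduct_of_mem _ _ hμ, add_zero, Finset.sum_eq_single_of_mem μ hμ,
      val_interiorProduct _ _ notMem_erase, val_interiorProduct _ _ notMem_erase,
      Finset.insert_erase hμ, ← mul_sub, ← mul_assoc, sign_sq, one_mul]
    intro ν _ hνμ
    have hμ' : μ ∈ S.erase ν := Finset.mem_erase.2 ⟨hνμ.symm, hμ⟩
    rw [val_interiorProduct_of_mem _ _ hμ', val_interiorProduct_of_mem _ _ hμ', sub_zero, mul_zero]
  · rw [val_interiorProduct _ _ hμ, val_extDeriv _ _ (by rw [Finset.card_insert_of_notMem hμ, hS]),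
      Finset.sum_insert hμ, Finset.erase_insert hμ, mul_add, ← mul_assoc, sign_sq, one_mul,
      add_left_comm, add_eq_left, Finset.mul_sum, ← Finset.sum_add_distrib]
    refine Finset.sum_eq_zero fun ν hν => ?_
    have hμν : μ ≠ ν := fun h => hμ (h ▸ hν)
    obtain ⟨T, hνT, rfl⟩ : ∃ T, ν ∉ T ∧ S = insert ν T :=
      ⟨S.erase ν, S.notMem_erase ν, (Finset.insert_erase hν).symm⟩
    have hμT : μ ∉ T := fun h => hμ (Finset.mem_insert_of_mem h)
    rw [Finset.erase_insert hνT, Finset.insert_comm, Finset.erase_insert,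
      val_interiorProduct _ _ hμT, val_interiorProduct _ _ hμT, shuffleSign_singleton_insert hνT,
      shuffleSign_singleton_insert hμT, shuffleSign_singleton_swap hμν.symm]
    · have sign_pair := sign_sq {ν}
      push_cast
      linear_combination -(shuffleSign {ν} T * shuffleSign {μ} T : R) *
        (val α (x.shift (dirs N {ν})) (insert μ T) - val α x (insert μ T)) * sign_pair
    · exact fun h => (Finset.mem_insert.1 h).elim hμν.symm hνT

end Exterior

section Adjoint

variable {N : ℕ} [NeZero N] {half : Bool} {R : Type} [CommRing R] {r : ℕ}

theorem dotProduct_eq_sum_val (α β : Form N half r R) :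
    α ⬝ᵥ β = ∑ S : Finset (Fin 4), ∑ x, val α x S * val β x S := by
  rw [dotProduct, Fintype.sum_prod_type_right]
  refine Finset.sum_bij_ne_zero (fun S _ _ => S.1) (by simp only [Finset.mem_univ, implies_true])
    (fun _ _ _ _ _ _ => Subtype.ext) (fun S _ hS => ?_) fun S _ _ => ?_
  · by_cases h : S.card = r
    · simp only [val_of_card _ _ h] at hS
      exact ⟨⟨S, h⟩, Finset.mem_univ _, hS, rfl⟩
    · simp only [val_of_card_ne _ _ h, zero_mul, Finset.sum_const_zero, ne_eq,
        not_true_eq_false] at hS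
  · simp only [val_of_card _ _ S.2]

theorem sum_sum_mem_erase {ι M : Type*} [Fintype ι] [DecidableEq ι] [AddCommMonoid M]
    (f : Finset ι → ι → M) :
    ∑ S : Finset ι, ∑ i ∈ S, f (S.erase i) i = ∑ S : Finset ι, ∑ i ∈ Sᶜ, f S i := by
  rw [Finset.sum_sigma', Finset.sum_sigma']
  refine Finset.sum_bij' (fun p _ => ⟨p.1.erase p.2, p.2⟩) (fun p _ => ⟨insert p.2 p.1, p.2⟩)
    ?_ ?_ ?_ ?_ fun _ _ => rfl
  all_goals
    rintro ⟨S, i⟩ hi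
    simp only [Finset.mem_sigma, Finset.mem_univ, true_and, Finset.mem_compl] at hi
  · simp only [Finset.mem_sigma, Finset.mem_univ, true_and, Finset.mem_compl,
      Finset.notMem_erase, not_false_eq_true]
  · simp only [Finset.mem_sigma, Finset.mem_univ, true_and, Finset.mem_insert_self]
  · simp only [Finset.insert_erase hi]
  · simp only [Finset.erase_insert hi]

theorem sum_sub_shift_mul (f g : Site N half → R) (v : Fin 4 → ZMod N) :
    ∑ x, (f (x.shift v) - f x) * g x = -∑ x, f x * (g x - g (x.shift (-v))) := by
  simp only [sub_mul, mul_sub, Finset.sum_sub_distrib, sum_shift_mul, neg_sub]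

theorem extDeriv_dotProduct_eq_sum (α : Form N half r R) (β : Form N half (r + 1) R) :
    extDeriv α ⬝ᵥ β = ∑ S : Finset (Fin 4), ∑ μ ∈ S, shuffleSign {μ} (S.erase μ) *
      ∑ x, (val α (x.shift (dirs N {μ})) (S.erase μ) - val α x (S.erase μ)) *
        val β x (insert μ (S.erase μ)) := by
  rw [dotProduct_eq_sum_val]
  refine Finset.sum_congr rfl fun S _ => ?_
  simp only [Finset.mul_sum]
  rw [Finset.sum_comm]
  refine Finset.sum_congr rfl fun x _ => ?_
  by_cases hS : S.card = r + 1
  · rw [val_extDeriv _ _ hS, Finset.sum_mul]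
    exact Finset.sum_congr rfl fun μ hμ => by rw [Finset.insert_erase hμ, mul_assoc]
  · rw [val_of_card_ne β _ hS, mul_zero]
    refine (Finset.sum_eq_zero fun μ hμ => ?_).symm
    rw [Finset.insert_erase hμ, val_of_card_ne β _ hS, mul_zero, mul_zero]

theorem dotProduct_boundary_eq_sum (α : Form N half r R) (β : Form N half (r + 1) R) :
    α ⬝ᵥ boundary β = ∑ S : Finset (Fin 4), ∑ μ ∈ Sᶜ, shuffleSign S {μ} *
      ∑ x, val α x S * (val β x (insert μ S) - val β (x.shift (-dirs N {μ})) (insert μ S)) := by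
  rw [dotProduct_eq_sum_val]
  refine Finset.sum_congr rfl fun S _ => ?_
  simp only [Finset.mul_sum]
  rw [Finset.sum_comm]
  refine Finset.sum_congr rfl fun x _ => ?_
  by_cases hS : S.card = r
  · rw [val_boundary _ _ hS, Finset.mul_sum]
    exact Finset.sum_congr rfl fun _ _ => mul_left_comm _ _ _
  · simp only [val_of_card_ne _ _ hS, zero_mul, mul_zero, Finset.sum_const_zero]

theorem extDeriv_dotProduct (α : Form N half r R) (β : Form N half (r + 1) R) :
    extDeriv α ⬝ᵥ β = (-1) ^ (r + 1) * (α ⬝ᵥ boundary β) := by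
  rw [extDeriv_dotProduct_eq_sum, dotProduct_boundary_eq_sum,
    sum_sum_mem_erase fun S μ => (shuffleSign {μ} S : R) *
      ∑ x : Site N half, (val α (x.shift (dirs N {μ})) S - val α x S) * val β x (insert μ S)]
  simp only [Finset.mul_sum (Finset.univ : Finset (Finset (Fin 4))), Finset.mul_sum (_ᶜ)]
  refine Finset.sum_congr rfl fun S _ => Finset.sum_congr rfl fun μ hμ => ?_
  rw [sum_sub_shift_mul (val α · S), shuffleSign_singleton_right (Finset.mem_compl.1 hμ)]
  by_cases hS : S.card = r
  · have sign_sq : ((-1) ^ r * (-1) ^ r : R) = 1 := by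
      rw [← mul_pow, neg_one_mul, neg_neg, one_pow]
    rw [hS, pow_succ]
    push_cast
    linear_combination (shuffleSign {μ} S : R) * (∑ x : Site N half, val α x S *
      (val β x (insert μ S) - val β (x.shift (-dirs N {μ})) (insert μ S))) * sign_sq
  · simp only [val_of_card_ne _ _ hS, zero_mul, Finset.sum_const_zero, neg_zero, mul_zero]

theorem boundary_boundary (y : Form N half (r + 2) R) : boundary (boundary y) = 0 := by
  refine dotProduct_eq_zero_iff.1 fun A => ?_
  have unit_cancel (k : ℕ) {a : R} (h : (-1) ^ k * a = 0) : a = 0 :=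
    ((isUnit_neg_one.pow k).mul_right_eq_zero).1 h
  rw [dotProduct_comm]
  refine unit_cancel (r + 1) ?_
  rw [← extDeriv_dotProduct]
  refine unit_cancel (r + 1 + 1) ?_
  rw [← extDeriv_dotProduct, extDeriv_extDeriv, zero_dotProduct]

theorem boundary_dotProduct_extDeriv (y : Form N half (r + 2) R) (A : Form N half r R) :
    boundary y ⬝ᵥ extDeriv A = 0 := by
  rw [dotProduct_comm, extDeriv_dotProduct, boundary_boundary, dotProduct_zero, mul_zero]

theorem extDeriv_dotProduct_of_one (A : Form N half 1 R) (α : Form N half 2 R) :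
    extDeriv A ⬝ᵥ α = A ⬝ᵥ boundary α := by
  rw [extDeriv_dotProduct, one_add_one_eq_two, neg_one_sq, one_mul]

theorem boundary_dotProduct_of_three (y : Form N half 3 R) (α : Form N half 2 R) :
    boundary y ⬝ᵥ α = -(y ⬝ᵥ extDeriv α) := by
  rw [dotProduct_comm, dotProduct_comm y, extDeriv_dotProduct]
  ring

theorem total_extDeriv (ω : Form N half 3 R) : total (extDeriv ω) = 0 := by
  simp only [total, val_extDeriv ω _ (S := Finset.univ) rfl]
  rw [Finset.sum_comm]
  refine Finset.sum_eq_zero fun μ _ => ?_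
  rw [← Finset.mul_sum, Finset.sum_sub_distrib, sum_shift (val ω · _), sub_self, mul_zero]

end Adjoint

section CupOneOfTwo

variable {N : ℕ} {half : Bool} {R : Type} [CommRing R]

theorem val_cupOne_left {q : ℕ} (α : Form N half 2 R) (β : Form N half (q + 1) R)
    (x : Site N half) {S : Finset (Fin 4)} (h : S.card = 1 + q + 1) :
    val (cupOne α β) x S = (-1) ^ (q + 1) * ∑ μ ∈ S, (-1) ^ (S.filter (· ≤ μ)).card *
      ∑ ν ∈ S.erase μ, (shuffleSign {ν} ((S.erase μ).erase ν) : R) *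
        (((shuffleSign {μ} {ν} : R) *
            val α (x.shift (dirs N (((S.erase μ).erase ν).filter (μ ≤ ·)))) {μ, ν}) *
          ((shuffleSign {μ} ((S.erase μ).erase ν) : R) *
            val β (x.shift (dirs N (({ν} : Finset (Fin 4)).filter (· < μ)))) (S.erase ν))) := by
  rw [val_cupOne _ _ _ h]
  congr 1
  refine Finset.sum_congr rfl fun μ hμ => ?_
  rw [sum_powerset_of_card_one]
  · congr 1
    refine Finset.sum_congr rfl fun ν hν => ?_
    rw [Finset.sdiff_singleton_eq_erase]
    congr 4
    rw [Finset.erase_right_comm,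
      Finset.insert_erase (Finset.mem_erase.2 ⟨(Finset.ne_of_mem_erase hν).symm, hμ⟩)]
  · intro A hA hcard
    rw [val_of_card_ne α, mul_zero, zero_mul, mul_zero]
    rw [Finset.card_insert_of_notMem fun hμA => S.notMem_erase μ (hA hμA)]
    exact fun h => hcard (Nat.succ_injective h)

theorem val_cupOne_right {p : ℕ} (α : Form N half (p + 1) R) (β : Form N half 2 R)
    (x : Site N half) {S : Finset (Fin 4)} (h : S.card = p + 1 + 1) :
    val (cupOne α β) x S = ∑ μ ∈ S, (-1) ^ (S.filter (· ≤ μ)).card *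
      ∑ ν ∈ S.erase μ, (shuffleSign ((S.erase μ).erase ν) {ν} : R) *
        (((shuffleSign {μ} ((S.erase μ).erase ν) : R) *
            val α (x.shift (dirs N (({ν} : Finset (Fin 4)).filter (μ ≤ ·)))) (S.erase ν)) *
          ((shuffleSign {μ} {ν} : R) *
            val β (x.shift (dirs N (((S.erase μ).erase ν).filter (· < μ)))) {μ, ν})) := by
  have sign_eq : (-1 : R) ^ (1 + 1) = 1 := neg_one_sq
  rw [val_cupOne _ _ _ h, sign_eq, one_mul]
  refine Finset.sum_congr rfl fun μ hμ => ?_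
  rw [← sum_powerset_sdiff, sum_powerset_of_card_one]
  · congr 1
    refine Finset.sum_congr rfl fun ν hν => ?_
    rw [Finset.sdiff_sdiff_eq_self (Finset.singleton_subset_iff.2 hν),
      Finset.sdiff_singleton_eq_erase]
    congr 4
    rw [Finset.erase_right_comm,
      Finset.insert_erase (Finset.mem_erase.2 ⟨(Finset.ne_of_mem_erase hν).symm, hμ⟩)]
  · intro A hA hcard
    rw [Finset.sdiff_sdiff_eq_self hA, val_of_card_ne β, mul_zero, mul_zero, mul_zero]
    rw [Finset.card_insert_of_notMem fun hμA => S.notMem_erase μ (hA hμA)]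
    exact fun h => hcard (Nat.succ_injective h)

end CupOneOfTwo

section CupCommutator

variable {N : ℕ} {half : Bool} {R : Type} [CommRing R]

theorem shuffleSign_eq_prod_ite : ∀ A B : Finset (Fin 4), shuffleSign A B =
    (if 1 ∈ A ∧ 0 ∈ B then -1 else 1) * (if 2 ∈ A ∧ 0 ∈ B then -1 else 1) *
    (if 3 ∈ A ∧ 0 ∈ B then -1 else 1) * (if 2 ∈ A ∧ 1 ∈ B then -1 else 1) *
    (if 3 ∈ A ∧ 1 ∈ B then -1 else 1) * (if 3 ∈ A ∧ 2 ∈ B then -1 else 1) := by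
  unfold shuffleSign
  decide

theorem dirs_eq_vec (N : ℕ) (S : Finset (Fin 4)) : dirs N S =
    ![if 0 ∈ S then 1 else 0, if 1 ∈ S then 1 else 0, if 2 ∈ S then 1 else 0,
      if 3 ∈ S then 1 else 0] := by
  ext i
  fin_cases i <;> rfl

theorem val_extDeriv_pair (A : Form N half 1 R) (x : Site N half) {i j : Fin 4} (hij : i < j) :
    val (extDeriv A) x {i, j} = (val A (x.shift (dirs N {i})) {j} - val A x {j}) -
      (val A (x.shift (dirs N {j})) {i} - val A x {i}) := by
  have sign_eq : ∀ i j : Fin 4, i < j → shuffleSign {i} {j} = 1 ∧ shuffleSign {j} {i} = -1 := by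
    decide
  have erase_left : ({i, j} : Finset (Fin 4)).erase i = {j} :=
    Finset.erase_insert (Finset.notMem_singleton.2 hij.ne)
  have erase_right : ({i, j} : Finset (Fin 4)).erase j = {i} := by
    rw [Finset.pair_comm, Finset.erase_insert (Finset.notMem_singleton.2 hij.ne')]
  rw [val_extDeriv _ _ (Finset.card_pair hij.ne), Finset.sum_pair hij.ne, erase_left, erase_right,
    (sign_eq i j hij).1, (sign_eq i j hij).2]
  push_cast
  ring

theorem dirs_empty (N : ℕ) : dirs N ∅ = 0 := rfl

theorem sum_triple {M : Type*} [AddCommMonoid M] (f : Fin 4 → M) {i j k : Fin 4} (hij : i < j)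
    (hjk : j < k) : ∑ μ ∈ {i, j, k}, f μ = f i + (f j + f k) := by
  rw [Finset.sum_insert, Finset.sum_pair hjk.ne]
  simp only [Finset.mem_insert, Finset.mem_singleton, hij.ne, (hij.trans hjk).ne, or_self,
    not_false_eq_true]

theorem erase_triple : ∀ {i j k : Fin 4}, i < j → j < k →
    ({i, j, k} : Finset (Fin 4)).erase i = {j, k} ∧ ({i, j, k} : Finset (Fin 4)).erase j = {i, k} ∧
      ({i, j, k} : Finset (Fin 4)).erase k = {i, j} := by
  decide

theorem erase_pair : ∀ {i j : Fin 4}, i < j →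
    ({i, j} : Finset (Fin 4)).erase i = {j} ∧ ({i, j} : Finset (Fin 4)).erase j = {i} := by
  decide

theorem val_extDeriv_triple (a : Form N half 2 R) (x : Site N half) {i j k : Fin 4} (hij : i < j)
    (hjk : j < k) : val (extDeriv a) x {i, j, k} =
      (val a (x.shift (dirs N {i})) {j, k} - val a x {j, k}) -
      (val a (x.shift (dirs N {j})) {i, k} - val a x {i, k}) +
      (val a (x.shift (dirs N {k})) {i, j} - val a x {i, j}) := by
  have card_eq : ∀ {i j k : Fin 4}, i < j → j < k → ({i, j, k} : Finset (Fin 4)).card = 3 := by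
    decide
  have sign_eq : ∀ i j k : Fin 4, i < j → j < k → shuffleSign {i} {j, k} = 1 ∧
      shuffleSign {j} {i, k} = -1 ∧ shuffleSign {k} {i, j} = 1 := by
    decide
  obtain ⟨sign_i, sign_j, sign_k⟩ := sign_eq i j k hij hjk
  obtain ⟨erase_i, erase_j, erase_k⟩ := erase_triple hij hjk
  rw [val_extDeriv _ _ (card_eq hij hjk), sum_triple _ hij hjk, erase_i, erase_j, erase_k, sign_i,
    sign_j, sign_k]
  push_cast
  ring

theorem val_cupOne_triple (a b : Form N half 2 R) (x : Site N half) {i j k : Fin 4} (hij : i < j)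
    (hjk : j < k) : val (cupOne a b) x {i, j, k} =
      val a (x.shift (dirs N {j})) {i, k} * val b x {i, j} -
      val a (x.shift (dirs N {k})) {i, j} * (val b x {i, k} + val b (x.shift (dirs N {i})) {j, k}) +
      val a x {j, k} * (val b x {i, j} + val b (x.shift (dirs N {j})) {i, k}) -
      val a x {i, k} * val b (x.shift (dirs N {i})) {j, k} := by
  have card_eq : ∀ {i j k : Fin 4}, i < j → j < k → ({i, j, k} : Finset (Fin 4)).card = 3 := by
    decide
  have hik := hij.trans hjk
  have sign_eq : ∀ {i j : Fin 4}, i < j → shuffleSign {i} {j} = 1 ∧ shuffleSign {j} {i} = -1 := by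
    decide
  have rank_eq : ∀ {i j k : Fin 4}, i < j → j < k →
      (({i, j, k} : Finset (Fin 4)).filter (· ≤ i)).card = 1 ∧
      (({i, j, k} : Finset (Fin 4)).filter (· ≤ j)).card = 2 ∧
      (({i, j, k} : Finset (Fin 4)).filter (· ≤ k)).card = 3 := by
    decide
  obtain ⟨erase_i, erase_j, erase_k⟩ := erase_triple hij hjk
  obtain ⟨rank_i, rank_j, rank_k⟩ := rank_eq hij hjk
  rw [val_cupOne_left _ _ _ (card_eq hij hjk), sum_triple _ hij hjk, erase_i, erase_j, erase_k,
    Finset.sum_pair hjk.ne, Finset.sum_pair hik.ne, Finset.sum_pair hij.ne, rank_i, rank_j, rank_k]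
  simp only [erase_i, erase_j, erase_k, (erase_pair hij).1, (erase_pair hij).2, (erase_pair hik).1,
    (erase_pair hik).2, (erase_pair hjk).1, (erase_pair hjk).2, (sign_eq hij).1, (sign_eq hij).2,
    (sign_eq hik).1, (sign_eq hik).2, (sign_eq hjk).1, (sign_eq hjk).2, Finset.filter_singleton,
    hij.le, hij.not_ge, hik.le, hik.not_ge, hjk.le, hjk.not_ge, hij, hik, hjk, hij.not_gt,
    hik.not_gt, hjk.not_gt, if_true, if_false, dirs_empty, Site.shift_zero,
    Finset.pair_comm j i, Finset.pair_comm k i, Finset.pair_comm k j]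
  push_cast
  ring

theorem erase_univ :
    (Finset.univ.erase 0 : Finset (Fin 4)) = {1, 2, 3} ∧
    (Finset.univ.erase 1 : Finset (Fin 4)) = {0, 2, 3} ∧
    (Finset.univ.erase 2 : Finset (Fin 4)) = {0, 1, 3} ∧
    (Finset.univ.erase 3 : Finset (Fin 4)) = {0, 1, 2} := by
  decide

theorem val_cupOne_univ_left (a : Form N half 2 R) (c : Form N half 3 R) (x : Site N half) :
    val (cupOne a c) x Finset.univ =
      val a (x.shift (dirs N {2, 3})) {0, 1} *
        (val c x {0, 2, 3} + val c (x.shift (dirs N {0})) {1, 2, 3}) -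
      val a (x.shift (dirs N {1, 3})) {0, 2} * val c x {0, 1, 3} +
      val a (x.shift (dirs N {3})) {0, 2} * val c (x.shift (dirs N {0})) {1, 2, 3} +
      val a (x.shift (dirs N {1, 2})) {0, 3} * val c x {0, 1, 2} +
      val a x {0, 3} * val c (x.shift (dirs N {0})) {1, 2, 3} -
      val a (x.shift (dirs N {3})) {1, 2} *
        (val c x {0, 1, 3} + val c (x.shift (dirs N {1})) {0, 2, 3}) +
      val a (x.shift (dirs N {2})) {1, 3} * val c x {0, 1, 2} -
      val a x {1, 3} * val c (x.shift (dirs N {1})) {0, 2, 3} +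
      val a x {2, 3} * (val c x {0, 1, 2} + val c (x.shift (dirs N {2})) {0, 1, 3}) := by
  rw [val_cupOne_left _ _ _ rfl, Fin.sum_univ_four]
  have rank_eq : ∀ μ : Fin 4, (Finset.univ.filter (· ≤ μ)).card = μ.val + 1 := by decide
  have swap : ∀ μ ν : Fin 4, ({μ, ν} : Finset (Fin 4)) = {ν, μ} := Finset.pair_comm
  obtain ⟨erase_zero, erase_one, erase_two, erase_three⟩ := erase_univ
  simp only [rank_eq]
  simp only [Nat.reduceAdd, Fin.coe_ofNat_eq_mod, Nat.zero_mod, zero_add, pow_one, erase_zero,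
    shuffleSign_eq_prod_ite, Finset.mem_singleton, Finset.mem_erase, ne_eq, Finset.mem_insert,
    zero_ne_one, Fin.reduceEq, or_self, and_false, ↓reduceIte, mul_one, or_false, and_true,
    Int.reduceNeg, mul_ite, mul_neg, or_true, Int.cast_ite, Int.cast_neg, Int.cast_one,
    one_ne_zero, false_and, zero_le, Finset.filter_true, one_mul, and_self, not_lt_zero,
    Finset.filter_singleton, dirs_empty, Site.shift_zero, ite_mul, neg_mul, not_false_eq_true,
    Finset.sum_insert, not_true_eq_false, Finset.erase_insert_eq_erase, Finset.erase_eq_of_notMem,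
    erase_one, Finset.erase_insert_of_ne, erase_two, Finset.sum_singleton, Finset.erase_singleton,
    insert_empty_eq, erase_three, neg_neg, neg_add_rev, Nat.one_mod, even_two, Even.neg_pow,
    one_pow, true_and, ite_not, Fin.lt_one_iff, Finset.filter_insert, Fin.reduceLE, swap 1 0,
    nonpos_iff_eq_zero, Nat.reduceMod, swap 2 0, Fin.reduceLT, swap 2 1, Nat.mod_succ, swap 3 0,
    swap 3 1, swap 3 2]
  ring

theorem val_cupOne_univ_right (c : Form N half 3 R) (b : Form N half 2 R) (x : Site N half) :
    val (cupOne c b) x Finset.univ =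
      -((val c x {1, 2, 3} + val c (x.shift (dirs N {1})) {0, 2, 3}) * val b x {0, 1}) +
      val c (x.shift (dirs N {2})) {0, 1, 3} * val b x {0, 2} -
      val c x {1, 2, 3} * val b (x.shift (dirs N {1})) {0, 2} -
      val c (x.shift (dirs N {3})) {0, 1, 2} * val b x {0, 3} -
      val c x {1, 2, 3} * val b (x.shift (dirs N {1, 2})) {0, 3} +
      (val c x {0, 2, 3} + val c (x.shift (dirs N {2})) {0, 1, 3}) *
        val b (x.shift (dirs N {0})) {1, 2} -
      val c (x.shift (dirs N {3})) {0, 1, 2} * val b (x.shift (dirs N {0})) {1, 3} +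
      val c x {0, 2, 3} * val b (x.shift (dirs N {0, 2})) {1, 3} -
      (val c x {0, 1, 3} + val c (x.shift (dirs N {3})) {0, 1, 2}) *
        val b (x.shift (dirs N {0, 1})) {2, 3} := by
  rw [val_cupOne_right _ _ _ rfl, Fin.sum_univ_four]
  have rank_eq : ∀ μ : Fin 4, (Finset.univ.filter (· ≤ μ)).card = μ.val + 1 := by decide
  have swap : ∀ μ ν : Fin 4, ({μ, ν} : Finset (Fin 4)) = {ν, μ} := Finset.pair_comm
  obtain ⟨erase_zero, erase_one, erase_two, erase_three⟩ := erase_univ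
  simp only [rank_eq]
  simp only [Fin.coe_ofNat_eq_mod, Nat.zero_mod, zero_add, pow_one, erase_zero,
    shuffleSign_eq_prod_ite, Finset.mem_erase, ne_eq, Finset.mem_insert, Fin.reduceEq,
    Finset.mem_singleton, or_self, or_false, and_true, Int.reduceNeg, or_true, mul_ite, mul_neg,
    mul_one, Int.cast_ite, Int.cast_neg, Int.cast_one, one_ne_zero, zero_ne_one, and_false,
    and_self, ↓reduceIte, false_and, Nat.reduceAdd, zero_le, Finset.filter_singleton, one_mul,
    not_lt_zero, Finset.filter_false, dirs_empty, Site.shift_zero, ite_mul, neg_mul,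
    not_false_eq_true, Finset.sum_insert, not_true_eq_false, erase_one, neg_neg, erase_two,
    Finset.sum_singleton, erase_three, neg_add_rev, Nat.one_mod, even_two, Even.neg_pow, one_pow,
    true_and, ite_not, Fin.lt_one_iff, nonpos_iff_eq_zero, Finset.erase_insert_eq_erase,
    Finset.erase_eq_of_notMem, Finset.filter_insert, swap 1 0, Fin.reduceLE,
    Finset.erase_insert_of_ne, insert_empty_eq, Finset.erase_singleton, Nat.reduceMod,
    Fin.reduceLT, swap 2 0, swap 2 1, Nat.mod_succ, swap 3 0, swap 3 1, swap 3 2]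
  ring

theorem val_cup_univ (a b : Form N half 2 R) (x : Site N half) :
    val (cup a b) x Finset.univ =
      val a x {0, 1} * val b (x.shift (dirs N {0, 1})) {2, 3} -
      val a x {0, 2} * val b (x.shift (dirs N {0, 2})) {1, 3} +
      val a x {0, 3} * val b (x.shift (dirs N {0, 3})) {1, 2} +
      val a x {1, 2} * val b (x.shift (dirs N {1, 2})) {0, 3} -
      val a x {1, 3} * val b (x.shift (dirs N {1, 3})) {0, 2} +
      val a x {2, 3} * val b (x.shift (dirs N {2, 3})) {0, 1} := by
  have pairs_eq : (Finset.univ : Finset (Fin 4)).powerset.filter (·.card = 2) =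
      {{0, 1}, {0, 2}, {0, 3}, {1, 2}, {1, 3}, {2, 3}} := by decide
  have complement_eq : (Finset.univ \ {0, 1} : Finset (Fin 4)) = {2, 3} ∧
      (Finset.univ \ {0, 2} : Finset (Fin 4)) = {1, 3} ∧
      (Finset.univ \ {0, 3} : Finset (Fin 4)) = {1, 2} ∧
      (Finset.univ \ {1, 2} : Finset (Fin 4)) = {0, 3} ∧
      (Finset.univ \ {1, 3} : Finset (Fin 4)) = {0, 2} ∧
      (Finset.univ \ {2, 3} : Finset (Fin 4)) = {0, 1} := by decide
  have other_eq_zero : ∀ A ∈ (Finset.univ : Finset (Fin 4)).powerset, A ∉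
      (Finset.univ : Finset (Fin 4)).powerset.filter (·.card = 2) →
      (shuffleSign A (Finset.univ \ A) : R) *
        (val a x A * val b (x.shift (dirs N A)) (Finset.univ \ A)) = 0 := fun A hA hcard => by
    rw [val_of_card_ne a x fun h => hcard (Finset.mem_filter.2 ⟨hA, h⟩), zero_mul, mul_zero]
  rw [val_cup _ _ _ rfl, ← Finset.sum_subset (Finset.filter_subset _ _) other_eq_zero, pairs_eq,
    Finset.sum_insert (by decide), Finset.sum_insert (by decide), Finset.sum_insert (by decide),
    Finset.sum_insert (by decide), Finset.sum_insert (by decide), Finset.sum_singleton]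
  simp only [complement_eq, shuffleSign_eq_prod_ite, Finset.mem_insert, one_ne_zero,
    Finset.mem_singleton, or_true, Fin.reduceEq, or_self, and_false, ↓reduceIte, and_self, mul_one,
    or_false, and_true, Int.cast_one, one_mul, zero_ne_one, Int.reduceNeg, mul_neg, Int.cast_neg,
    neg_mul, neg_neg]
  ring

theorem cup_sub_cup_swap (a b : Form N half 2 R) (x : Site N half) :
    val (cup a b) x Finset.univ - val (cup b a) x Finset.univ =
      val (cupOne a (extDeriv b)) x Finset.univ + val (cupOne (extDeriv a) b) x Finset.univ -
        val (extDeriv (cupOne a b)) x Finset.univ := by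
  have val_extDeriv_univ (c : Form N half 3 R) : val (extDeriv c) x Finset.univ =
      (val c (x.shift (dirs N {0})) {1, 2, 3} - val c x {1, 2, 3}) -
      (val c (x.shift (dirs N {1})) {0, 2, 3} - val c x {0, 2, 3}) +
      (val c (x.shift (dirs N {2})) {0, 1, 3} - val c x {0, 1, 3}) -
      (val c (x.shift (dirs N {3})) {0, 1, 2} - val c x {0, 1, 2}) := by
    obtain ⟨erase_zero, erase_one, erase_two, erase_three⟩ := erase_univ
    rw [val_extDeriv _ _ rfl, Fin.sum_univ_four, erase_zero, erase_one, erase_two, erase_three]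
    simp only [shuffleSign_eq_prod_ite, Finset.mem_singleton, one_ne_zero, Finset.mem_insert,
      zero_ne_one, Fin.reduceEq, or_self, and_self, ↓reduceIte, mul_one, or_false, and_true,
      or_true, Int.cast_one, one_mul, Int.reduceNeg, Int.cast_neg, neg_mul, neg_sub, mul_neg,
      neg_neg]
    ring
  have lt_one : (0 : Fin 4) < 1 := by decide
  have lt_two : (1 : Fin 4) < 2 := by decide
  have lt_three : (2 : Fin 4) < 3 := by decide
  have lt_three' : (1 : Fin 4) < 3 := by decide
  have lt_two' : (0 : Fin 4) < 2 := by decide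
  rw [val_extDeriv_univ, val_cup_univ, val_cup_univ, val_cupOne_univ_left, val_cupOne_univ_right]
  simp only [val_extDeriv_triple _ _ lt_one lt_two, val_extDeriv_triple _ _ lt_one lt_three',
    val_extDeriv_triple _ _ lt_two' lt_three, val_extDeriv_triple _ _ lt_two lt_three,
    val_cupOne_triple _ _ _ lt_one lt_two, val_cupOne_triple _ _ _ lt_one lt_three',
    val_cupOne_triple _ _ _ lt_two' lt_three, val_cupOne_triple _ _ _ lt_two lt_three,
    Site.shift_shift]
  simp only [dirs_eq_vec, Nat.succ_eq_add_one, Nat.reduceAdd, Finset.mem_insert,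
    Finset.mem_singleton, zero_ne_one, or_false, ↓reduceIte, one_ne_zero, or_true, Fin.reduceEq,
    or_self, Matrix.add_cons, Matrix.head_cons, add_zero, Matrix.tail_cons, zero_add,
    Matrix.empty_add_empty]
  ring

theorem total_cup_sub_total_cup [NeZero N] (a b : Form N half 2 R) :
    total (cup a b) - total (cup b a) =
      total (cupOne a (extDeriv b)) + total (cupOne (extDeriv a) b) := by
  calc total (cup a b) - total (cup b a)
    _ = total (cupOne a (extDeriv b)) + total (cupOne (extDeriv a) b) -
          total (extDeriv (cupOne a b)) := by
        simp only [total, ← Finset.sum_sub_distrib, ← Finset.sum_add_distrib, cup_sub_cup_swap]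
    _ = total (cupOne a (extDeriv b)) + total (cupOne (extDeriv a) b) := by
        rw [total_extDeriv, sub_zero]

end CupCommutator

namespace Framing

theorem flip_flip (fr : Framing) : fr.flip.flip = fr := by cases fr <;> rfl

/-- The sign by which the two framings differ: `1` for the plain one and `-1` for the dual one. -/
def sign : Framing → ℤ
  | plain => 1
  | dual => -1

theorem sign_mul_self (fr : Framing) : fr.sign * fr.sign = 1 := by cases fr <;> rfl

/-- The sign with which the complementary cells in the directions `S` and `Sᶜ` are paired by the
cup product (`plain`) or by the cup product of the reversed factors (`dual`). -/
def cellSign : Framing → Finset (Fin 4) → ℤ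
  | plain, S => shuffleSign S Sᶜ
  | dual, S => shuffleSign Sᶜ S

/-- The displacement between the complementary cells that are paired by the cup product (`plain`)
or by the cup product of the reversed factors (`dual`). -/
def offset (N : ℕ) : Framing → Finset (Fin 4) → Fin 4 → ZMod N
  | plain, S => dirs N S
  | dual, S => -dirs N Sᶜ

theorem cellSign_flip_compl (fr : Framing) (S : Finset (Fin 4)) :
    fr.flip.cellSign Sᶜ = fr.cellSign S := by
  cases fr <;> simp only [flip, cellSign, compl_compl]

theorem cellSign_mul_self (fr : Framing) (S : Finset (Fin 4)) :
    fr.cellSign S * fr.cellSign S = 1 := by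
  cases fr <;> exact shuffleSign_mul_self _ _

theorem offset_flip_compl (N : ℕ) (fr : Framing) (S : Finset (Fin 4)) :
    fr.flip.offset N Sᶜ = -fr.offset N S := by
  cases fr <;> simp only [flip, offset, compl_compl, neg_neg]

theorem offset_insert (N : ℕ) (fr : Framing) {S : Finset (Fin 4)} {ν : Fin 4} (h : ν ∉ S) :
    fr.offset N (insert ν S) = fr.offset N S + dirs N {ν} := by
  cases fr with
  | plain => exact dirs_insert N h
  | dual =>
    have compl_eq : insert ν (insert ν S)ᶜ = Sᶜ := by
      rw [← Finset.compl_erase, Finset.erase_insert h]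
    have notMem : ν ∉ (insert ν S)ᶜ :=
      fun hν => Finset.mem_compl.1 hν (Finset.mem_insert_self ν S)
    simp only [offset]
    rw [← compl_eq, dirs_insert N notMem]
    abel

theorem cellSign_mul_shuffleSign_compl (fr : Framing) : ∀ {S : Finset (Fin 4)} {ν : Fin 4}, ν ∈ S →
    fr.cellSign S * shuffleSign Sᶜ {ν} =
      -fr.sign * (shuffleSign {ν} (S.erase ν) * fr.cellSign (S.erase ν)) := by
  cases fr <;> simp only [cellSign, sign] <;> decide

theorem shuffleSign_mul_cellSign_insert (fr : Framing) :
    ∀ {S : Finset (Fin 4)} {ν : Fin 4}, ν ∉ S →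
      shuffleSign S {ν} * fr.cellSign (insert ν S) =
        fr.sign * (fr.cellSign S * shuffleSign {ν} (Sᶜ.erase ν)) := by
  cases fr <;> simp only [cellSign, sign] <;> decide

end Framing

section Hodge

variable {N : ℕ} {half : Bool} {R : Type} [CommRing R] {p q : ℕ}

/-- The lattice Hodge star that represents the cup product with values in the `4`-forms
(`plain`), or the cup product of the reversed factors (`dual`), by the Euclidean inner product.
The degree `p` of the result is explicit; it is meant to be `4 - q`. -/
def hodge (fr : Framing) (p : ℕ) : Form N half q R →ₗ[R] Form N half p R where
  toFun β c := (fr.cellSign c.2.1 : R) * val β (c.1.shift (fr.offset N c.2.1)) c.2.1ᶜ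
  map_add' α β := by
    ext c
    simp only [val_add, Pi.add_apply, mul_add]
  map_smul' a β := by
    ext c
    simp only [val_smul, Pi.smul_apply, smul_eq_mul, RingHom.id_apply, mul_left_comm]

theorem val_hodge (fr : Framing) (β : Form N half q R) (x : Site N half) {S : Finset (Fin 4)}
    (h : S.card = p) : val (hodge fr p β) x S =
      (fr.cellSign S : R) * val β (x.shift (fr.offset N S)) Sᶜ := val_of_card _ _ h

theorem card_compl_of_add_eq (h : p + q = 4) {S : Finset (Fin 4)} (hS : S.card = p) :
    Sᶜ.card = q := by
  rw [Finset.card_compl, hS, Fintype.card_fin]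
  omega

theorem hodge_flip_hodge (h : p + q = 4) (fr : Framing) (β : Form N half q R) :
    hodge fr.flip q (hodge fr p β) = β := by
  refine form_ext fun x S hS => ?_
  have offset_compl := fr.flip.offset_flip_compl N S
  have cellSign_compl := fr.flip.cellSign_flip_compl S
  rw [Framing.flip_flip] at offset_compl cellSign_compl
  rw [val_hodge _ _ _ hS, val_hodge _ _ _ (card_compl_of_add_eq ((add_comm q p).trans h) hS),
    Site.shift_shift, offset_compl, cellSign_compl, compl_compl, add_neg_cancel, Site.shift_zero,
    ← mul_assoc, ← Int.cast_mul, Framing.cellSign_mul_self, Int.cast_one, one_mul]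

theorem realVec_hodge (fr : Framing) (n : Form N half q ℤ) :
    realVec (hodge fr p n) = hodge fr p (realVec n) := by
  refine form_ext fun x S hS => ?_
  rw [val_realVec, val_hodge _ _ _ hS, val_hodge _ _ _ hS, val_realVec]
  push_cast
  rfl

theorem hodge_boundary (h : p + 1 + q = 4) (fr : Framing) (y : Form N half (q + 1) R) :
    hodge fr (p + 1) (boundary y) = (-fr.sign : R) • extDeriv (hodge fr p y) := by
  refine form_ext fun x S hS => ?_
  rw [val_hodge _ _ _ hS, val_smul, val_boundary _ _ (card_compl_of_add_eq h hS),
    val_extDeriv _ _ hS, Finset.mul_sum, Finset.mul_sum, compl_compl]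
  refine Finset.sum_congr rfl fun ν hν => ?_
  have card_erase : (S.erase ν).card = p := by rw [Finset.card_erase_of_mem hν, hS]; rfl
  have offset_eq : fr.offset N S = fr.offset N (S.erase ν) + dirs N {ν} := by
    rw [← fr.offset_insert N (Finset.notMem_erase ν S), Finset.insert_erase hν]
  have sign_eq := congrArg (Int.cast (R := R)) (fr.cellSign_mul_shuffleSign_compl hν)
  push_cast at sign_eq
  rw [val_hodge _ _ _ card_erase, val_hodge _ _ _ card_erase, Site.shift_shift, Site.shift_shift,
    offset_eq, Finset.compl_erase, add_neg_cancel_right, add_comm (dirs N {ν})]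
  linear_combination (val y (x.shift (fr.offset N (S.erase ν) + dirs N {ν})) (insert ν Sᶜ) -
    val y (x.shift (fr.offset N (S.erase ν))) (insert ν Sᶜ)) * sign_eq

theorem boundary_hodge (h : p + (q + 1) = 4) (fr : Framing) (l : Form N half q R) :
    boundary (hodge fr (p + 1) l) = (fr.sign : R) • hodge fr p (extDeriv l) := by
  refine form_ext fun x S hS => ?_
  rw [val_boundary _ _ hS, val_smul, val_hodge _ _ _ hS,
    val_extDeriv _ _ (card_compl_of_add_eq h hS), Finset.mul_sum, Finset.mul_sum]
  refine Finset.sum_congr rfl fun ν hν => ?_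
  have notMem : ν ∉ S := Finset.mem_compl.1 hν
  have card_insert : (insert ν S).card = p + 1 := by rw [Finset.card_insert_of_notMem notMem, hS]
  have sign_eq := congrArg (Int.cast (R := R)) (fr.shuffleSign_mul_cellSign_insert notMem)
  push_cast at sign_eq
  rw [val_hodge _ _ _ card_insert, val_hodge _ _ _ card_insert, Site.shift_shift, Site.shift_shift,
    fr.offset_insert N notMem, Finset.compl_insert, neg_add_cancel_comm_assoc]
  linear_combination (val l (x.shift (fr.offset N S + dirs N {ν})) (Sᶜ.erase ν) -
    val l (x.shift (fr.offset N S)) (Sᶜ.erase ν)) * sign_eq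

theorem boundary_hodge_of_closed (h : p + (q + 1) = 4) (fr : Framing) {l : Form N half q R}
    (hl : extDeriv l = 0) : boundary (hodge fr (p + 1) l) = 0 := by
  rw [boundary_hodge h, hl, map_zero, smul_zero]

variable [NeZero N]

theorem dotProduct_hodge (h : p + q = 4) (fr : Framing) (α : Form N half p R)
    (β : Form N half q R) : α ⬝ᵥ hodge fr p β = hodge fr.flip q α ⬝ᵥ β := by
  rw [dotProduct_eq_sum_val, dotProduct_eq_sum_val]
  refine Fintype.sum_equiv (Equiv.mk compl compl compl_compl compl_compl) _ _ fun S => ?_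
  simp only [Equiv.coe_fn_mk]
  by_cases hS : S.card = p
  · simp only [val_hodge _ _ _ hS, val_hodge _ _ _ (card_compl_of_add_eq h hS),
      fr.offset_flip_compl, compl_compl, fr.cellSign_flip_compl]
    rw [← sum_shift (fun x => _ * val α (x.shift _) S * _) (fr.offset N S)]
    refine Finset.sum_congr rfl fun x _ => ?_
    rw [Site.shift_shift, add_neg_cancel, Site.shift_zero]
    ring
  · have card_compl : Sᶜ.card ≠ q := fun hc =>
      hS (compl_compl S ▸ card_compl_of_add_eq ((add_comm q p).trans h) hc)
    simp only [val_of_card_ne _ _ hS, val_of_card_ne _ _ card_compl, mul_zero]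

theorem hodge_dotProduct_hodge (h : p + q = 4) (fr : Framing) (α β : Form N half q R) :
    hodge fr p α ⬝ᵥ hodge fr p β = α ⬝ᵥ β := by
  rw [dotProduct_hodge h, hodge_flip_hodge h]

theorem sum_val_cup (h : p + q = 4) (α : Form N half p R) (β : Form N half q R) :
    ∑ x, val (cup α β) x Finset.univ = α ⬝ᵥ hodge .plain p β := by
  rw [dotProduct_eq_sum_val, Finset.sum_comm]
  refine Finset.sum_congr rfl fun x _ => ?_
  rw [val_cup _ _ _ (by rw [Finset.card_univ, Fintype.card_fin, h]), Finset.powerset_univ]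
  refine Finset.sum_congr rfl fun S _ => ?_
  by_cases hS : S.card = p
  · rw [val_hodge _ _ _ hS, ← Finset.compl_eq_univ_sdiff]
    simp only [Framing.cellSign, Framing.offset]
    ring
  · simp only [val_of_card_ne _ _ hS, zero_mul, mul_zero]

theorem total_cup_eq_dotProduct (a b : Form N half 2 R) :
    total (cup a b) = a ⬝ᵥ hodge .plain 2 b := sum_val_cup rfl a b

theorem total_cup_eq_dotProduct_dual (a b : Form N half 2 R) :
    total (cup a b) = b ⬝ᵥ hodge .dual 2 a := by
  rw [total_cup_eq_dotProduct, dotProduct_hodge rfl, dotProduct_comm]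
  rfl

end Hodge

section Projection

variable {N : ℕ} [NeZero N] {half : Bool}

theorem coexact_eq_range : coexact N half = LinearMap.range
    ((WithLp.linearEquiv 2 ℝ (Form N half 2 ℝ)).symm.toLinearMap ∘ₗ boundaryHom N half 2 ℝ) := by
  rw [coexact, ← Submodule.span_eq (LinearMap.range _)]
  rfl

theorem exists_boundary_eq_projBoundary (a : Form N half 2 ℝ) :
    ∃ y : Form N half 3 ℝ, boundary y = projBoundary a := by
  obtain ⟨y, hy⟩ :=
    coexact_eq_range.le ((coexact N half).starProjection_apply_mem (WithLp.toLp 2 a))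
  exact ⟨y, congrArg WithLp.ofLp hy⟩

theorem extDeriv_projBoundary (a : Form N half 2 ℝ) :
    extDeriv (projBoundary a) = extDeriv a := by
  have orthogonal (y : Form N half 3 ℝ) : boundary y ⬝ᵥ (a - projBoundary a) = 0 :=
    (coexact N half).starProjection_inner_eq_zero (WithLp.toLp 2 a)
      (WithLp.toLp 2 (boundary y)) (Submodule.subset_span ⟨y, rfl⟩)
  refine (sub_eq_zero.1 (dotProduct_eq_zero _ fun y => ?_)).symm
  rw [← extDeriv_sub, dotProduct_comm, ← neg_eq_zero, ← boundary_dotProduct_of_three, orthogonal]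

theorem exists_eq_extDeriv_add_harmonic {m : Form N half 2 ℝ} (hm : extDeriv m = 0) :
    ∃ (A : Form N half 1 ℝ) (h : Form N half 2 ℝ),
      m = extDeriv A + h ∧ extDeriv h = 0 ∧ boundary h = 0 := by
  set b : Form N half 2 ℝ := hodge .plain 2 m
  obtain ⟨y, hy⟩ := exists_boundary_eq_projBoundary b
  have hodge_boundary_y : hodge .dual 2 (boundary y) = extDeriv (hodge .dual 1 y) := by
    rw [hodge_boundary rfl]
    simp only [Framing.sign, Int.cast_neg, Int.cast_one, neg_neg, one_smul]
  have decomposition : m = extDeriv (hodge .dual 1 y) + hodge .dual 2 (b - projBoundary b) := by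
    rw [← hodge_boundary_y, hy, ← map_add, add_sub_cancel]
    exact (hodge_flip_hodge rfl .plain m).symm
  refine ⟨_, _, decomposition, ?_, boundary_hodge_of_closed rfl _ ?_⟩
  · rwa [decomposition, extDeriv_add, extDeriv_extDeriv, zero_add] at hm
  · rw [extDeriv_sub, extDeriv_projBoundary, sub_self]

end Projection

section Harmonic

variable {N : ℕ} [NeZero N] {half : Bool} {r : ℕ} {h : Form N half (r + 1) ℝ}

-- By Cartan's formula the difference is exact; it is also coclosed, hence orthogonal to itself.
theorem translate_dirs_of_harmonic (hd : extDeriv h = 0) (hb : boundary h = 0) (μ : Fin 4) :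
    translate (dirs N {μ}) h = h := by
  have cartan := extDeriv_interiorProduct_add_interiorProduct_extDeriv μ h
  have interiorProduct_zero :
      interiorProduct μ (0 : Form N half (r + 2) ℝ) = (0 : Form N half (r + 1) ℝ) := by
    ext c
    simp only [interiorProduct, val_zero, mul_zero, Pi.zero_apply]
  rw [hd, interiorProduct_zero, add_zero] at cartan
  have coclosed : boundary (translate (dirs N {μ}) h - h) = 0 := by
    rw [boundary_sub, boundary_translate, hb, sub_zero]
    rfl
  refine sub_eq_zero.1 (dotProduct_self_eq_zero.1 ?_)
  nth_rw 1 [← cartan]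
  rw [extDeriv_dotProduct, coclosed, dotProduct_zero, mul_zero]

theorem translate_of_harmonic (hd : extDeriv h = 0) (hb : boundary h = 0)
    (v : Fin 4 → ZMod N) : translate v h = h := by
  let stabilizer : AddSubmonoid (Fin 4 → ZMod N) :=
    { carrier := {w | translate w h = h}
      zero_mem' := translate_zero h
      add_mem' := fun {w w'} hw hw' =>
        (translate_add w w' h).trans ((congrArg _ hw').trans hw) }
  change v ∈ stabilizer
  rw [← Finset.univ_sum_single v]
  refine sum_mem fun μ _ => ?_
  have single_eq : Pi.single μ (v μ) = (v μ).val • dirs N {μ} := by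
    rw [dirs_singleton, ← Pi.single_smul, nsmul_one, ZMod.natCast_zmod_val]
  rw [single_eq]
  exact nsmul_mem (translate_dirs_of_harmonic hd hb μ) _

end Harmonic

section Flux

variable {N : ℕ} [NeZero N] {half : Bool} {R : Type} [CommRing R]

/-- The flux of a `2`-form through the coordinate plane in the directions `i < j` that contains
the site `x`. -/
def flux (α : Form N half 2 R) (x : Site N half) (i j : Fin 4) : R :=
  ∑ a : ZMod N, ∑ b : ZMod N, val α (x.shift (Pi.single i a + Pi.single j b)) {i, j}

theorem flux_add (α β : Form N half 2 R) (x : Site N half) (i j : Fin 4) :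
    flux (α + β) x i j = flux α x i j + flux β x i j := by
  simp only [flux, val_add, Finset.sum_add_distrib]

theorem flux_realVec (m : Form N half 2 ℤ) (x : Site N half) (i j : Fin 4) :
    flux (realVec m : Form N half 2 ℝ) x i j = (flux m x i j : ℤ) := by
  simp only [flux, val_realVec, Int.cast_sum]

theorem flux_extDeriv (A : Form N half 1 R) (x : Site N half) {i j : Fin 4} (hij : i < j) :
    flux (extDeriv A) x i j = 0 := by
  let site (a b : ZMod N) : Site N half := x.shift (Pi.single i a + Pi.single j b)
  have shift_left (a b : ZMod N) : (site a b).shift (dirs N {i}) = site (a + 1) b := by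
    rw [Site.shift_shift, dirs_singleton, add_right_comm, ← Pi.single_add]
  have shift_right (a b : ZMod N) : (site a b).shift (dirs N {j}) = site a (b + 1) := by
    rw [Site.shift_shift, dirs_singleton, add_assoc, ← Pi.single_add]
  have sum_left : ∑ a, ∑ b, val A (site (a + 1) b) {j} = ∑ a, ∑ b, val A (site a b) {j} :=
    Equiv.sum_comp (Equiv.addRight (1 : ZMod N)) fun a => ∑ b, val A (site a b) {j}
  have sum_right (a : ZMod N) :
      ∑ b, val A (site a (b + 1)) {i} = ∑ b, val A (site a b) {i} :=
    Equiv.sum_comp (Equiv.addRight (1 : ZMod N)) fun b => val A (site a b) {i}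
  calc flux (extDeriv A) x i j
      = ∑ a, ∑ b, ((val A (site (a + 1) b) {j} - val A (site a b) {j}) -
          (val A (site a (b + 1)) {i} - val A (site a b) {i})) := by
        simp only [flux, val_extDeriv_pair A _ hij, ← shift_left, ← shift_right, site]
    _ = 0 := by
        simp only [Finset.sum_sub_distrib, sum_left, sum_right, sub_self, Finset.sum_const_zero]

theorem flux_of_translate_eq {h : Form N half 2 R} (hh : ∀ v, translate v h = h)
    (x : Site N half) (i j : Fin 4) : flux h x i j = (N : R) ^ 2 * val h x {i, j} := by
  simp only [flux, ← val_translate, hh, Finset.sum_const, Finset.card_univ, ZMod.card,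
    nsmul_eq_mul]
  ring

end Flux

section IntersectionForm

variable {N : ℕ} [NeZero N] {half : Bool}

theorem card_site : Fintype.card (Site N half) = N ^ 4 := by
  rw [Fintype.card_congr (⟨Site.coord, Site.mk, fun _ => rfl, fun _ => rfl⟩ :
    Site N half ≃ (Fin 4 → ZMod N)), Fintype.card_fun, ZMod.card, Fintype.card_fin]

theorem total_cup_self_of_translate_eq {R : Type} [CommRing R] {h : Form N half 2 R}
    (hh : ∀ v, translate v h = h) (x : Site N half) :
    total (cup h h) = 2 * (flux h x 0 1 * flux h x 2 3 - flux h x 0 2 * flux h x 1 3 +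
      flux h x 0 3 * flux h x 1 2) := by
  have val_eq (y : Site N half) (S : Finset (Fin 4)) : val h y S = val h x S := by
    conv_rhs => rw [← hh (y.coord - x.coord), val_translate, Site.shift, add_sub_cancel]
  simp only [total, val_cup_univ, flux_of_translate_eq hh]
  simp only [val_eq, Finset.sum_const, Finset.card_univ, card_site, nsmul_eq_mul, Nat.cast_pow]
  ring

theorem total_cup_realVec (m n : Form N half 2 ℤ) :
    total (cup (realVec m : Form N half 2 ℝ) (realVec n)) = (total (cup m n) : ℤ) := by
  simp only [total_cup_eq_dotProduct, ← realVec_hodge, realVec_dotProduct_realVec]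

theorem extDeriv_dotProduct_hodge (fr : Framing) {R : Type} [CommRing R] (A : Form N half 1 R)
    {c : Form N half 2 R} (hc : extDeriv c = 0) : extDeriv A ⬝ᵥ hodge fr 2 c = 0 := by
  rw [extDeriv_dotProduct_of_one, boundary_hodge_of_closed rfl _ hc, dotProduct_zero]

theorem total_cup_extDeriv_add {R : Type} [CommRing R] (A : Form N half 1 R)
    {h : Form N half 2 R} (hd : extDeriv h = 0) :
    total (cup (extDeriv A + h) (extDeriv A + h)) = total (cup h h) := by
  have closed : extDeriv (extDeriv A + h) = 0 := by
    rw [extDeriv_add, extDeriv_extDeriv, hd, zero_add]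
  rw [total_cup_eq_dotProduct, total_cup_eq_dotProduct, add_dotProduct,
    extDeriv_dotProduct_hodge _ A closed, zero_add, map_add, dotProduct_add,
    dotProduct_hodge rfl, dotProduct_comm, extDeriv_dotProduct_hodge _ A hd, zero_add]

-- A closed form has the intersection number of its harmonic part, which is constant and has the
-- integral fluxes of the form itself.
theorem even_total_cup_self {m : Form N half 2 ℤ} (hm : extDeriv m = 0) :
    Even (total (cup m m)) := by
  have closed : extDeriv (realVec m : Form N half 2 ℝ) = 0 := by
    rw [← realVec_extDeriv, hm, map_zero]
  obtain ⟨A, h, decomposition, hd, hb⟩ := exists_eq_extDeriv_add_harmonic closed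
  let o : Site N half := ⟨0⟩
  have flux_eq {i j : Fin 4} (hij : i < j) : flux h o i j = (flux m o i j : ℤ) := by
    rw [← flux_realVec, decomposition, flux_add, flux_extDeriv A o hij, zero_add]
  refine (even_iff_exists_two_mul).2 ⟨flux m o 0 1 * flux m o 2 3 - flux m o 0 2 * flux m o 1 3 +
    flux m o 0 3 * flux m o 1 2, Int.cast_injective (α := ℝ) ?_⟩
  rw [← total_cup_realVec, decomposition, total_cup_extDeriv_add A hd,
    total_cup_self_of_translate_eq (translate_of_harmonic hd hb) o]
  push_cast
  simp only [flux_eq (by decide : (0 : Fin 4) < 1), flux_eq (by decide : (2 : Fin 4) < 3),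
    flux_eq (by decide : (0 : Fin 4) < 2), flux_eq (by decide : (1 : Fin 4) < 3),
    flux_eq (by decide : (0 : Fin 4) < 3), flux_eq (by decide : (1 : Fin 4) < 2)]

end IntersectionForm

section CupOneBilinear

variable {N : ℕ} {half : Bool} {R : Type} [CommRing R] {p q : ℕ}

theorem cupOne_add_left (a a' : Form N half (p + 1) R) (b : Form N half (q + 1) R) :
    cupOne (a + a') b = cupOne a b + cupOne a' b := by
  refine form_ext fun x S hS => ?_
  simp only [val_add, val_cupOne _ _ _ hS, mul_add, add_mul, Finset.sum_add_distrib]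

theorem cupOne_add_right (a : Form N half (p + 1) R) (b b' : Form N half (q + 1) R) :
    cupOne a (b + b') = cupOne a b + cupOne a b' := by
  refine form_ext fun x S hS => ?_
  simp only [val_add, val_cupOne _ _ _ hS, mul_add, Finset.sum_add_distrib]

theorem cupOne_smul_left (t : R) (a : Form N half (p + 1) R) (b : Form N half (q + 1) R) :
    cupOne (t • a) b = t • cupOne a b := by
  refine form_ext fun x S hS => ?_
  simp only [val_smul, val_cupOne _ _ _ hS, Finset.mul_sum]
  exact Finset.sum_congr rfl fun _ _ => Finset.sum_congr rfl fun _ _ => by ring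

theorem cupOne_smul_right (t : R) (a : Form N half (p + 1) R) (b : Form N half (q + 1) R) :
    cupOne a (t • b) = t • cupOne a b := by
  refine form_ext fun x S hS => ?_
  simp only [val_smul, val_cupOne _ _ _ hS, Finset.mul_sum]
  exact Finset.sum_congr rfl fun _ _ => Finset.sum_congr rfl fun _ _ => by ring

variable [NeZero N]

theorem total_add (α β : Form N half 4 R) : total (α + β) = total α + total β := by
  simp only [total, val_add, Finset.sum_add_distrib]

theorem total_smul (t : R) (α : Form N half 4 R) : total (t • α) = t * total α := by
  simp only [total, val_smul, Finset.mul_sum]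

/-- The sum over the lattice of the higher cup product of a `2`-form and a `3`-form, with the sign
of the framing: the amount by which the Hodge stars of the two framings differ. -/
def framingForm (fr : Framing) : Form N half 2 R →ₗ[R] Form N half 3 R →ₗ[R] R :=
  LinearMap.mk₂ R (fun a b => fr.sign * total (cupOne a b))
    (fun a a' b => by
      rw [← mul_add]
      exact congrArg _ ((congrArg total (cupOne_add_left a a' b)).trans (total_add _ _)))
    (fun t a b => by
      rw [smul_eq_mul, mul_left_comm]
      exact congrArg _ ((congrArg total (cupOne_smul_left t a b)).trans (total_smul _ _)))
    (fun a b b' => by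
      rw [← mul_add]
      exact congrArg _ ((congrArg total (cupOne_add_right a b b')).trans (total_add _ _)))
    fun t a b => by
      rw [smul_eq_mul, mul_left_comm]
      exact congrArg _ ((congrArg total (cupOne_smul_right t a b)).trans (total_smul _ _))

theorem framingForm_apply (fr : Framing) (a : Form N half 2 R) (b : Form N half 3 R) :
    framingForm fr a b = fr.sign * total (cupOne a b) := rfl

theorem dotProduct_hodge_sub_dotProduct_hodge_flip (fr : Framing) {f : Form N half 2 R}
    (hf : extDeriv f = 0) (l : Form N half 2 R) :
    f ⬝ᵥ hodge fr 2 l - f ⬝ᵥ hodge fr.flip 2 l = framingForm fr f (extDeriv l) := by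
  have commutator := total_cup_sub_total_cup f l
  have total_cupOne_zero_left : total (cupOne (0 : Form N half 3 R) l) = 0 := by
    have h := total_smul 0 (cupOne (0 : Form N half 3 R) l)
    rwa [← cupOne_smul_left, zero_smul, zero_mul] at h
  rw [hf, total_cupOne_zero_left, add_zero, total_cup_eq_dotProduct,
    total_cup_eq_dotProduct_dual] at commutator
  rw [framingForm_apply]
  cases fr <;> simp only [Framing.flip, Framing.sign] <;> push_cast
  · rw [commutator, one_mul]
  · rw [← commutator]
    ring

theorem dotProduct_hodge_flip_of_closed (fr : Framing) {f l : Form N half 2 R}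
    (hf : extDeriv f = 0) (hl : extDeriv l = 0) :
    f ⬝ᵥ hodge fr.flip 2 l = f ⬝ᵥ hodge fr 2 l := by
  rw [← sub_eq_zero, ← neg_eq_zero, neg_sub, dotProduct_hodge_sub_dotProduct_hodge_flip fr hf, hl,
    map_zero]

end CupOneBilinear

section DualityOperator

variable {N : ℕ} {half : Bool} {R : Type} [CommRing R]

theorem hodge_hodge_flip {p q : ℕ} (h : p + q = 4) (fr : Framing) (β : Form N half q R) :
    hodge fr q (hodge fr.flip p β) = β := by
  simpa only [Framing.flip_flip] using hodge_flip_hodge h fr.flip β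

theorem extDeriv_hodge_eq_zero_iff (fr : Framing) (k : Form N half 2 R) :
    extDeriv (hodge fr 2 k) = 0 ↔ boundary k = 0 := by
  constructor <;> intro h
  · rw [← hodge_flip_hodge rfl fr k, boundary_hodge_of_closed rfl _ h]
  · have sign_sq : (fr.flip.sign : R) * fr.flip.sign = 1 := by
      rw [← Int.cast_mul, Framing.sign_mul_self, Int.cast_one]
    have hodge_boundary_k := boundary_hodge rfl fr.flip (hodge fr 2 k)
    rw [hodge_flip_hodge rfl, h] at hodge_boundary_k
    rw [← hodge_hodge_flip rfl fr (extDeriv _), ← one_smul R (hodge fr.flip 1 _), ← sign_sq,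
      mul_smul, ← hodge_boundary_k, smul_zero, map_zero]

variable [NeZero N]

theorem boundary_eq_zero_of_closed {y : Form N half 3 ℝ} (h : extDeriv (boundary y) = 0) :
    boundary y = 0 := by
  rw [← dotProduct_self_eq_zero, boundary_dotProduct_of_three, h, dotProduct_zero, neg_zero]

theorem projBoundary_of_closed {x : Form N half 2 ℝ} (h : extDeriv x = 0) :
    projBoundary x = 0 := by
  obtain ⟨y, hy⟩ := exists_boundary_eq_projBoundary x
  rw [← hy]
  exact boundary_eq_zero_of_closed (by rw [hy, extDeriv_projBoundary, h])

theorem projBoundary_boundary (y : Form N half 3 ℝ) : projBoundary (boundary y) = boundary y := by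
  obtain ⟨z, hz⟩ := exists_boundary_eq_projBoundary (boundary y)
  have closed : extDeriv (boundary (z - y)) = 0 := by
    rw [boundary_sub, hz, extDeriv_sub, extDeriv_projBoundary, sub_self]
  rw [← sub_eq_zero, ← hz, ← boundary_sub, boundary_eq_zero_of_closed closed]

theorem extDeriv_sub_projBoundary (x : Form N half 2 ℝ) : extDeriv (x - projBoundary x) = 0 := by
  rw [extDeriv_sub, extDeriv_projBoundary, sub_self]

theorem exists_extDeriv_eq_hodge_projBoundary (fr : Framing) (x : Form N half 2 ℝ) :
    ∃ A : Form N half 1 ℝ, extDeriv A = hodge fr 2 (projBoundary x) := by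
  obtain ⟨y, hy⟩ := exists_boundary_eq_projBoundary x
  exact ⟨(-fr.sign : ℝ) • hodge fr 1 y, by rw [← hy, hodge_boundary rfl, extDeriv_smul]⟩

theorem extDeriv_hodge_projBoundary (fr : Framing) (x : Form N half 2 ℝ) :
    extDeriv (hodge fr 2 (projBoundary x)) = 0 := by
  obtain ⟨A, hA⟩ := exists_extDeriv_eq_hodge_projBoundary fr x
  rw [← hA, extDeriv_extDeriv]

theorem projBoundary_dotProduct_hodge_projBoundary (fr : Framing) (x y : Form N half 2 ℝ) :
    projBoundary x ⬝ᵥ hodge fr 2 (projBoundary y) = 0 := by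
  obtain ⟨z, hz⟩ := exists_boundary_eq_projBoundary x
  rw [← hz, boundary_dotProduct_of_three, extDeriv_hodge_projBoundary, dotProduct_zero, neg_zero]

theorem hodge_eq_hodge_flip_of_harmonic (fr : Framing) {h : Form N half 2 ℝ}
    (hd : extDeriv h = 0) (hb : boundary h = 0) : hodge fr 2 h = hodge fr.flip 2 h := by
  have closed : extDeriv (hodge fr 2 h - hodge fr.flip 2 h) = 0 := by
    rw [extDeriv_sub, (extDeriv_hodge_eq_zero_iff fr h).2 hb,
      (extDeriv_hodge_eq_zero_iff fr.flip h).2 hb, sub_zero]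
  rw [← sub_eq_zero, ← dotProduct_self_eq_zero, dotProduct_sub,
    dotProduct_hodge_flip_of_closed fr closed hd, sub_self]

/-- The projection `P_∂` as a linear map. -/
def projBoundaryHom (N : ℕ) [NeZero N] (half : Bool) : Form N half 2 ℝ →ₗ[ℝ] Form N half 2 ℝ where
  toFun := projBoundary
  map_add' x y := by simp only [projBoundary, WithLp.toLp_add, map_add, WithLp.ofLp_add]
  map_smul' t x := by
    simp only [projBoundary, WithLp.toLp_smul, map_smul, WithLp.ofLp_smul, RingHom.id_apply]

/-- The lattice duality operator: the Hodge star of the framing on the image of `∂` and the Hodge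
star of the other framing on its orthogonal complement. Neither star alone is symmetric. -/
def dualityOperator (fr : Framing) : Form N half 2 ℝ →ₗ[ℝ] Form N half 2 ℝ :=
  hodge fr 2 ∘ₗ projBoundaryHom N half + hodge fr.flip 2 ∘ₗ (.id - projBoundaryHom N half)

theorem dualityOperator_apply (fr : Framing) (x : Form N half 2 ℝ) :
    dualityOperator fr x = hodge fr 2 (projBoundary x) + hodge fr.flip 2 (x - projBoundary x) :=
  rfl

theorem dualityOperator_of_closed (fr : Framing) {x : Form N half 2 ℝ} (h : extDeriv x = 0) :
    dualityOperator fr x = hodge fr.flip 2 x := by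
  rw [dualityOperator_apply, projBoundary_of_closed h, sub_zero, map_zero, zero_add]

theorem dualityOperator_boundary (fr : Framing) (y : Form N half 3 ℝ) :
    dualityOperator fr (boundary y) = hodge fr 2 (boundary y) := by
  rw [dualityOperator_apply, projBoundary_boundary, sub_self, map_zero, add_zero]

theorem dualityOperator_of_coclosed (fr : Framing) {k : Form N half 2 ℝ} (hk : boundary k = 0) :
    dualityOperator fr k = hodge fr 2 k := by
  obtain ⟨y, hy⟩ := exists_boundary_eq_projBoundary k
  have coclosed : boundary (k - projBoundary k) = 0 := by
    rw [boundary_sub, ← hy, hk, boundary_boundary, sub_zero]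
  rw [dualityOperator_apply,
    ← hodge_eq_hodge_flip_of_harmonic fr (extDeriv_sub_projBoundary k) coclosed, ← map_add,
    add_sub_cancel]

theorem dualityOperator_involutive (fr : Framing) :
    Function.Involutive (dualityOperator (N := N) (half := half) fr) := fun x => by
  have coclosed := boundary_hodge_of_closed rfl fr.flip (extDeriv_sub_projBoundary x)
  rw [dualityOperator_apply fr x, map_add,
    dualityOperator_of_closed fr (extDeriv_hodge_projBoundary fr x), hodge_flip_hodge rfl,
    dualityOperator_of_coclosed fr coclosed, hodge_hodge_flip rfl, add_sub_cancel]

theorem dotProduct_dualityOperator (fr : Framing) (x y : Form N half 2 ℝ) :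
    x ⬝ᵥ dualityOperator fr y = (x - projBoundary x) ⬝ᵥ hodge fr 2 (projBoundary y) +
      projBoundary x ⬝ᵥ hodge fr.flip 2 (y - projBoundary y) +
      (x - projBoundary x) ⬝ᵥ hodge fr.flip 2 (y - projBoundary y) := by
  rw [dualityOperator_apply, dotProduct_add, sub_dotProduct, sub_dotProduct,
    projBoundary_dotProduct_hodge_projBoundary]
  ring

theorem dotProduct_dualityOperator_comm (fr : Framing) (x y : Form N half 2 ℝ) :
    x ⬝ᵥ dualityOperator fr y = dualityOperator fr x ⬝ᵥ y := by
  rw [dotProduct_comm (dualityOperator fr x), dotProduct_dualityOperator,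
    dotProduct_dualityOperator,
    dotProduct_hodge_flip_of_closed fr (extDeriv_sub_projBoundary x) (extDeriv_sub_projBoundary y),
    dotProduct_hodge rfl fr (x - _), dotProduct_hodge rfl fr.flip (projBoundary x),
    dotProduct_hodge rfl fr (x - _), Framing.flip_flip, dotProduct_comm _ (projBoundary y),
    dotProduct_comm _ (y - projBoundary y), dotProduct_comm _ (y - projBoundary y)]
  ring

end DualityOperator

section LatticeComplex

variable {N : ℕ} {half : Bool}

/-- The bijection between the links and the cubes that the Hodge star of the framing pairs. -/
def linkEquiv (N : ℕ) (half : Bool) (fr : Framing) : Cell N half 1 ≃ Cell N half 3 where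
  toFun c := (c.1.shift (fr.offset N c.2.1), ⟨c.2.1ᶜ, card_compl_of_add_eq rfl c.2.2⟩)
  invFun c := (c.1.shift (fr.flip.offset N c.2.1), ⟨c.2.1ᶜ, card_compl_of_add_eq rfl c.2.2⟩)
  left_inv := fun ⟨x, S, hS⟩ => by
    simp only [Site.shift_shift, fr.offset_flip_compl, add_neg_cancel, Site.shift_zero, compl_compl]
  right_inv := fun ⟨x, S, hS⟩ => by
    have offset_compl := fr.flip.offset_flip_compl N S
    rw [Framing.flip_flip] at offset_compl
    simp only [Site.shift_shift, offset_compl, add_neg_cancel, Site.shift_zero, compl_compl]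

/-- The sign with which `dualityOperator` takes the boundary of a cube to the exterior derivative
of the link paired with it by `linkEquiv`. -/
def linkSign (fr : Framing) (c : Cell N half 1) : ℤˣ :=
  -(Units.mkOfMulEqOne _ _ fr.sign_mul_self * Units.mkOfMulEqOne _ _ (fr.cellSign_mul_self c.2.1))

theorem hodge_boundary_eq_extDeriv_linkSign_mul (fr : Framing) (y : Form N half 3 ℝ) :
    hodge fr 2 (boundary y) = extDeriv fun c => linkSign fr c * y (linkEquiv N half fr c) := by
  rw [hodge_boundary rfl, ← extDeriv_smul]
  congr 1
  ext c
  rw [Pi.smul_apply, smul_eq_mul]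
  simp only [linkSign, Units.val_neg, Units.val_mul, Units.val_mkOfMulEqOne, Int.cast_neg,
    Int.cast_mul, neg_mul, mul_assoc]
  change -(fr.sign * (fr.cellSign c.2.1 * val y (c.1.shift (fr.offset N c.2.1)) c.2.1ᶜ)) = _
  rw [val_of_card y _ (card_compl_of_add_eq rfl c.2.2)]
  rfl

/-- The lattice forms of degrees `1`, `2` and `3`. The operator `bT` dual to `b = ∂` is `-d`. -/
def latticeComplex (N : ℕ) [NeZero N] (half : Bool) (fr : Framing) :
    SelfDualComplex (Cell N half 1) (Cell N half 2) (Cell N half 3) where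
  d := extDerivHom N half 1 ℝ
  b := boundaryHom N half 2 ℝ
  dT := boundary
  bT := -(extDerivHom N half 2 ℤ).toAddMonoidHom
  d_dotProduct A k := by
    rw [realVec_boundary]
    exact extDeriv_dotProduct_of_one A (realVec k)
  b_dotProduct y n := by
    refine (boundary_dotProduct_of_three y (realVec n)).trans ?_
    rw [← realVec_extDeriv, ← dotProduct_neg, ← map_neg]
    rfl
  b_dotProduct_d := boundary_dotProduct_extDeriv
  K := dualityOperator fr
  K_symm := dotProduct_dualityOperator_comm fr
  K_involutive := dualityOperator_involutive fr
  Kint := ⟨hodge fr 2, hodge fr.flip 2, hodge_flip_hodge rfl fr, hodge_hodge_flip rfl fr⟩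
  K_realVec k hk := by
    refine (dualityOperator_of_coclosed fr ?_).trans (realVec_hodge fr k).symm
    rw [← realVec_boundary, hk, map_zero]
  bT_Kint_eq_zero_iff k := neg_eq_zero.trans (extDeriv_hodge_eq_zero_iff fr k)
  e := linkEquiv N half fr
  s := linkSign fr
  K_b y := (dualityOperator_boundary fr y).trans (hodge_boundary_eq_extDeriv_linkSign_mul fr y)

end LatticeComplex

section FramingAlgebra

variable {N : ℕ} [NeZero N] {half : Bool}

theorem dotProduct_hodge_comm_of_closed {R : Type} [CommRing R] (fr : Framing)
    {f : Form N half 2 R} (hf : extDeriv f = 0) (l : Form N half 2 R) :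
    f ⬝ᵥ hodge fr 2 l - l ⬝ᵥ hodge fr 2 f = framingForm fr f (extDeriv l) := by
  rw [← dotProduct_hodge_sub_dotProduct_hodge_flip fr hf, dotProduct_hodge rfl fr l,
    dotProduct_comm (hodge _ _ l)]

-- The two Hodge stars agree on `P_∂ l` in `K l`, so only the closed form `l - P_∂ l` contributes.
theorem dotProduct_hodge_sub_dotProduct_dualityOperator (fr : Framing) (F l : Form N half 2 ℝ) :
    F ⬝ᵥ hodge fr 2 l - F ⬝ᵥ dualityOperator fr l =
      framingForm fr (projBoundary l - l) (extDeriv F) := by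
  have difference : hodge fr 2 l - dualityOperator fr l =
      hodge fr 2 (l - projBoundary l) - hodge fr.flip 2 (l - projBoundary l) := by
    rw [dualityOperator_apply, map_sub (hodge fr 2)]
    abel
  rw [← dotProduct_sub, difference, dotProduct_sub, dotProduct_hodge rfl fr.flip,
    Framing.flip_flip, dotProduct_comm (hodge _ _ F), ← neg_sub (_ ⬝ᵥ hodge _ _ F),
    dotProduct_hodge_comm_of_closed fr (extDeriv_sub_projBoundary l), ← neg_sub l, map_neg,
    LinearMap.neg_apply]

theorem projBoundary_eq_of_extDeriv_eq {F F' : Form N half 2 ℝ} (h : extDeriv F = extDeriv F') :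
    projBoundary F = projBoundary F' := by
  rw [← sub_eq_zero]
  refine ((projBoundaryHom N half).map_sub F F').symm.trans (projBoundary_of_closed ?_)
  rw [extDeriv_sub, h, sub_self]

theorem dotProduct_hodge_self_add_framingForm (fr : Framing) (F : Form N half 2 ℝ) :
    F ⬝ᵥ hodge fr 2 F + framingForm fr F (extDeriv F) =
      F ⬝ᵥ dualityOperator fr F + framingForm fr (projBoundary F) (extDeriv F) := by
  have h := dotProduct_hodge_sub_dotProduct_dualityOperator fr F F
  rw [map_sub, LinearMap.sub_apply] at h
  linarith

end FramingAlgebra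

section Integrality

variable {N : ℕ} {half : Bool}

theorem realVec_cupOne {p q : ℕ} (a : Form N half (p + 1) ℤ) (b : Form N half (q + 1) ℤ) :
    realVec (cupOne a b) = (cupOne (realVec a) (realVec b) : Form N half (p + q + 1) ℝ) := by
  refine form_ext fun x S hS => ?_
  rw [val_realVec, val_cupOne _ _ _ hS, val_cupOne _ _ _ hS]
  simp only [val_realVec]
  push_cast
  rfl

variable [NeZero N]

theorem total_realVec (α : Form N half 4 ℤ) : total (realVec α : Form N half 4 ℝ) = total α := by
  rw [total, total, Int.cast_sum]
  exact Finset.sum_congr rfl fun x _ => val_realVec α x Finset.univ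

theorem framingForm_realVec (fr : Framing) (a : Form N half 2 ℤ) (b : Form N half 3 ℤ) :
    framingForm fr (realVec a) (realVec b) = (framingForm fr a b : ℝ) := by
  rw [framingForm_apply, framingForm_apply, ← realVec_cupOne, total_realVec, Int.cast_mul]
  rfl

theorem pontryagin_eq (n : Form N half 2 ℤ) :
    pontryagin n = n ⬝ᵥ hodge .plain 2 n + framingForm .plain n (extDeriv n) := by
  rw [pontryagin, total_cup_eq_dotProduct, framingForm_apply, Framing.sign, Int.cast_one, one_mul]

theorem even_pontryagin_sub {n l : Form N half 2 ℤ} {k : ℤ} (h : extDeriv n = k • extDeriv l) :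
    Even (pontryagin n - k ^ 2 * pontryagin l) := by
  obtain ⟨m, rfl⟩ : ∃ m, n = m + k • l := ⟨n - k • l, by rw [sub_add_cancel]⟩
  have closed : extDeriv m = 0 := by simpa only [extDeriv_add, extDeriv_smul, add_eq_right] using h
  obtain ⟨j, hj⟩ := even_total_cup_self closed
  rw [total_cup_eq_dotProduct] at hj
  have commutator := dotProduct_hodge_comm_of_closed .plain closed l
  refine ⟨j + k * (m ⬝ᵥ hodge .plain 2 l), ?_⟩
  rw [pontryagin_eq, pontryagin_eq, h]
  simp only [map_add, map_smul, dotProduct_add, add_dotProduct, dotProduct_smul, smul_dotProduct,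
    LinearMap.add_apply, LinearMap.smul_apply, smul_eq_mul]
  linear_combination hj - k * commutator

end Integrality

section FramedCharge

variable {N : ℕ} {half : Bool}

theorem fieldStrength_eq (A : Form N half 1 ℝ) (n : Form N half 2 ℤ) :
    fieldStrength A n = extDeriv A + (2 * π) • realVec n := rfl

theorem extDeriv_realVec_eq_smul {n l : Form N half 2 ℤ} {k : ℤ} (h : extDeriv n = k • extDeriv l) :
    extDeriv (realVec n) = (k : ℝ) • extDeriv (realVec l) := by
  rw [← realVec_extDeriv, h, realVec_zsmul, realVec_extDeriv]

theorem extDeriv_fieldStrength (A : Form N half 1 ℝ) (n : Form N half 2 ℤ) :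
    extDeriv (fieldStrength A n) = (2 * π) • extDeriv (realVec n) := by
  rw [fieldStrength_eq, extDeriv_add, extDeriv_extDeriv, zero_add, extDeriv_smul]

variable [NeZero N]

theorem boundary_dotProduct_fieldStrength (y : Form N half 3 ℝ) (A : Form N half 1 ℝ)
    (n : Form N half 2 ℤ) :
    boundary y ⬝ᵥ fieldStrength A n = 2 * π * (boundary y ⬝ᵥ realVec n) := by
  rw [fieldStrength_eq, dotProduct_add, boundary_dotProduct_extDeriv, zero_add, dotProduct_smul,
    smul_eq_mul]

/-- The topological charge `Q` or `Q̃` that belongs to a framing. -/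
def framedCharge (fr : Framing) (A : Form N half 1 ℝ) (n : Form N half 2 ℤ) : ℝ :=
  charge₀ (fieldStrength A n) +
    1 / (4 * π) * framingForm fr (fieldStrength A n) (extDeriv (realVec n))

/-- The number `u` of an integer form, with the sign of the framing. -/
def framedNumber (fr : Framing) (l : Form N half 2 ℤ) : ℝ := fr.sign * uNumber l

theorem framingForm_projBoundary (fr : Framing) (l : Form N half 2 ℤ) :
    framingForm fr (projBoundary (realVec l)) (extDeriv (realVec l)) = framedNumber fr l := by
  rw [framingForm_apply, ← extDeriv_projBoundary]
  rfl

theorem total_cup_self_eq_dotProduct_hodge (fr : Framing) (F : Form N half 2 ℝ) :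
    total (cup F F) = F ⬝ᵥ hodge fr 2 F := by
  cases fr
  · exact total_cup_eq_dotProduct F F
  · exact total_cup_eq_dotProduct_dual F F

theorem charge₀_eq_of_closed (fr : Framing) {F : Form N half 2 ℝ} (hF : extDeriv F = 0) :
    charge₀ F = 1 / (8 * π ^ 2) * (F ⬝ᵥ dualityOperator fr F) := by
  rw [charge₀, total_cup_self_eq_dotProduct_hodge fr.flip, dualityOperator_of_closed fr hF]

theorem projBoundary_fieldStrength (A : Form N half 1 ℝ) {n l : Form N half 2 ℤ} {k : ℤ}
    (h : extDeriv n = k • extDeriv l) :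
    projBoundary (fieldStrength A n) = (2 * π * k) • projBoundary (realVec l) := by
  rw [projBoundary_eq_of_extDeriv_eq (F' := (2 * π * k) • realVec l)]
  · exact (projBoundaryHom N half).map_smul _ _
  · rw [extDeriv_fieldStrength, extDeriv_realVec_eq_smul h, smul_smul, extDeriv_smul]

theorem framedCharge_eq (fr : Framing) (A : Form N half 1 ℝ) {n l : Form N half 2 ℤ} {k : ℤ}
    (h : extDeriv n = k • extDeriv l) :
    framedCharge fr A n =
      1 / (8 * π ^ 2) * (fieldStrength A n ⬝ᵥ dualityOperator fr (fieldStrength A n)) +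
        k ^ 2 / 2 * framedNumber fr l := by
  have correction := dotProduct_hodge_self_add_framingForm fr (fieldStrength A n)
  rw [projBoundary_fieldStrength A h, extDeriv_fieldStrength,
    extDeriv_realVec_eq_smul h] at correction
  rw [framedCharge, charge₀, total_cup_self_eq_dotProduct_hodge fr, extDeriv_realVec_eq_smul h,
    ← framingForm_projBoundary]
  simp only [map_smul, LinearMap.smul_apply, smul_eq_mul] at correction ⊢
  field_simp
  linear_combination 8 * correction

end FramedCharge

section ElectricWeight

variable {N : ℕ} [NeZero N] {half : Bool}

theorem dotProduct_tangent (fr : Framing) {g : Form N half 1 ℤ} {l : Form N half 2 ℤ}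
    (hg : g = (-fr.sign) • hodge fr 1 (extDeriv l)) (A : Form N half 1 ℝ) :
    realVec g ⬝ᵥ A = -(extDeriv A ⬝ᵥ hodge fr 2 (realVec l)) := by
  rw [hg, realVec_zsmul, realVec_hodge, realVec_extDeriv, extDeriv_dotProduct_of_one,
    boundary_hodge rfl, smul_dotProduct, dotProduct_smul, dotProduct_comm A,
    Int.cast_neg, neg_smul]

theorem exists_dotProduct_tangent_eq (fr : Framing) {g : Form N half 1 ℤ} {n l : Form N half 2 ℤ}
    {k : ℤ} (hg : g = (-fr.sign) • hodge fr 1 (extDeriv l)) (h : extDeriv n = k • extDeriv l)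
    (A : Form N half 1 ℝ) : ∃ i : ℤ, realVec g ⬝ᵥ A =
      -(fieldStrength A n ⬝ᵥ dualityOperator fr (realVec l)) - 2 * π * (k * framedNumber fr l) +
        2 * π * i := by
  refine ⟨k * framingForm fr l (extDeriv l) + n ⬝ᵥ hodge fr 2 l, ?_⟩
  have duality := dotProduct_hodge_sub_dotProduct_dualityOperator fr (fieldStrength A n) (realVec l)
  rw [map_sub, extDeriv_fieldStrength, extDeriv_realVec_eq_smul h, LinearMap.sub_apply, map_smul,
    map_smul, map_smul, map_smul, framingForm_projBoundary, ← realVec_extDeriv,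
    framingForm_realVec, fieldStrength_eq, add_dotProduct, smul_dotProduct, ← realVec_hodge,
    realVec_dotProduct_realVec, realVec_hodge, ← fieldStrength_eq] at duality
  simp only [smul_eq_mul] at duality
  rw [dotProduct_tangent fr hg]
  push_cast
  linear_combination -duality

/-- The real phase that `e^{i q_e γ̇·A - iθQ - ipπ𝔓(n)}` acquires, for every `n` with `dn = q_m dl`,
when its quadratic and linear terms are written with `dualityOperator`. -/
def loopPhase (fr : Framing) (l : Form N half 2 ℤ) (p qe qm : ℤ) (θ : ℝ) : ℝ :=
  θ * qm ^ 2 / 2 * framedNumber fr l + 2 * π * (qe * qm) * framedNumber fr l +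
    π * (p * qm ^ 2 * pontryagin l)

theorem exists_electric_phase_eq (fr : Framing) {g : Form N half 1 ℤ} {n l : Form N half 2 ℤ}
    {qm : ℤ} (hg : g = (-fr.sign) • hodge fr 1 (extDeriv l)) (h : extDeriv n = qm • extDeriv l)
    (p qe : ℤ) (θ : ℝ) (A : Form N half 1 ℝ) :
    ∃ k : ℤ, qe * (realVec g ⬝ᵥ A) - θ * framedCharge fr A n - p * π * pontryagin n =
      -loopPhase fr l p qe qm θ -
        θ / (4 * π ^ 2) / 2 * (fieldStrength A n ⬝ᵥ dualityOperator fr (fieldStrength A n)) -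
        qe * (fieldStrength A n ⬝ᵥ dualityOperator fr (realVec l)) + 2 * π * k := by
  obtain ⟨i, tangent_eq⟩ := exists_dotProduct_tangent_eq fr hg h A
  obtain ⟨j, hj⟩ := even_pontryagin_sub h
  have square_eq : (pontryagin n : ℝ) = qm ^ 2 * pontryagin l + 2 * j := by
    exact_mod_cast show pontryagin n = qm ^ 2 * pontryagin l + 2 * j by linarith
  have coefficient : θ / (4 * π ^ 2) / 2 = θ * (1 / (8 * π ^ 2)) := by
    ring
  refine ⟨qe * i - p * j, ?_⟩
  rw [tangent_eq, square_eq, framedCharge_eq fr A h, coefficient, loopPhase]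
  push_cast
  ring

/-- The part of the integrand of the loop that does not involve the magnetic field. -/
def electricWeight (fr : Framing) (g : Form N half 1 ℤ) (p qe : ℤ) (β θ : ℝ) (A : Form N half 1 ℝ)
    (n : Form N half 2 ℤ) : ℂ :=
  Complex.exp (-(β / 2 * (fieldStrength A n ⬝ᵥ fieldStrength A n) : ℝ) +
    Complex.I * (qe * (realVec g ⬝ᵥ A) - θ * framedCharge fr A n - p * π * pontryagin n : ℝ))

theorem electricWeight_eq (fr : Framing) {g : Form N half 1 ℤ} {n l : Form N half 2 ℤ} {qm : ℤ}
    (hg : g = (-fr.sign) • hodge fr 1 (extDeriv l)) (h : extDeriv n = qm • extDeriv l)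
    (p qe : ℤ) (β θ : ℝ) (A : Form N half 1 ℝ) :
    electricWeight fr g p qe β θ A n =
      Complex.exp (-Complex.I * (loopPhase fr l p qe qm θ : ℝ)) *
        gaussianWeight (dualityOperator fr) β (θ / (4 * π ^ 2))
          ((qe : ℝ) • dualityOperator fr (realVec l)) (fieldStrength A n) := by
  obtain ⟨k, phase_eq⟩ := exists_electric_phase_eq fr hg h p qe θ A
  rw [electricWeight, phase_eq, gaussianWeight, ← Complex.exp_add,
    Complex.exp_eq_exp_iff_exists_int, smul_dotProduct, smul_eq_mul,
    dotProduct_comm (dualityOperator fr _)]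
  refine ⟨k, ?_⟩
  push_cast
  ring

theorem summable_electricWeight (fr : Framing) (g : Form N half 1 ℤ) (p qe : ℤ) {β : ℝ}
    (hβ : 0 < β) (θ : ℝ) (A : Form N half 1 ℝ) :
    Summable (electricWeight fr g p qe β θ A) := by
  refine .of_norm_bounded (summable_gaussianWeight 0 hβ 0 0 (extDeriv A) two_pi_pos.ne').norm
    fun n => le_of_eq ?_
  rw [electricWeight, Complex.exp_add, norm_mul, norm_exp_I_mul_ofReal, mul_one,
    ← Complex.ofReal_neg, Complex.norm_exp_ofReal, norm_gaussianWeight, ← neg_mul]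
  simp only [sq]
  rfl

end ElectricWeight

section LoopIntegral

variable {N : ℕ} [NeZero N] {half : Bool}

theorem latticeComplex_bT_sub_smul_eq_zero_iff (fr : Framing) {n l : Form N half 2 ℤ} {k : ℤ} :
    (latticeComplex N half fr).bT (n - k • l) = 0 ↔ extDeriv n = k • extDeriv l := by
  refine neg_eq_zero.trans ?_
  change extDeriv (n - k • l) = 0 ↔ _
  rw [extDeriv_sub, extDeriv_smul, sub_eq_zero]

/-- The unnormalized expectation value of the dyonic loop with tangent `g` in either framing, with
the magnetic coupling expressed by an integer form `l` whose monopoles lie along the loop. -/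
def loopIntegral (fr : Framing) (g : Form N half 1 ℤ) (l : Form N half 2 ℤ) (p qe qm : ℤ)
    (β θ : ℝ) : ℂ :=
  compactIntegral fun Ae : Form N half 1 ℝ => compactIntegral fun Am : Form N half 3 ℝ =>
    ∑' n : Form N half 2 ℤ,
      Complex.exp (-(β / 2 * (fieldStrength Ae n ⬝ᵥ fieldStrength Ae n) : ℝ)
        - Complex.I * (θ * framedCharge fr Ae n : ℝ)
        + Complex.I * (1 / (2 * π) * (boundary Am ⬝ᵥ fieldStrength Ae n) : ℝ)
        - Complex.I * (p * π * pontryagin n : ℝ)) *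
      Complex.exp (Complex.I *
        (qe * (realVec g ⬝ᵥ Ae) - qm * (boundary Am ⬝ᵥ realVec l) : ℝ))

theorem electricWeight_mul_exp (fr : Framing) (g : Form N half 1 ℤ) (n l : Form N half 2 ℤ)
    (p qe qm : ℤ) (β θ : ℝ) (A : Form N half 1 ℝ) (y : Form N half 3 ℝ) :
    electricWeight fr g p qe β θ A n *
        Complex.exp (Complex.I * (boundary y ⬝ᵥ realVec (n - qm • l) : ℝ)) =
      Complex.exp (-(β / 2 * (fieldStrength A n ⬝ᵥ fieldStrength A n) : ℝ)
        - Complex.I * (θ * framedCharge fr A n : ℝ)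
        + Complex.I * (1 / (2 * π) * (boundary y ⬝ᵥ fieldStrength A n) : ℝ)
        - Complex.I * (p * π * pontryagin n : ℝ)) *
      Complex.exp (Complex.I *
        (qe * (realVec g ⬝ᵥ A) - qm * (boundary y ⬝ᵥ realVec l) : ℝ)) := by
  have two_pi_ne_zero : 2 * π ≠ 0 := two_pi_pos.ne'
  rw [electricWeight, ← Complex.exp_add, ← Complex.exp_add, boundary_dotProduct_fieldStrength,
    ← mul_assoc, one_div_mul_cancel two_pi_ne_zero, one_mul, map_sub, realVec_zsmul,
    dotProduct_sub, dotProduct_smul, smul_eq_mul]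
  congr 1
  push_cast
  ring

theorem loopIntegral_eq (fr : Framing) {g : Form N half 1 ℤ} {l : Form N half 2 ℤ}
    (hg : g = (-fr.sign) • hodge fr 1 (extDeriv l)) (p qe qm : ℤ) {β : ℝ} (hβ : 0 < β) (θ : ℝ) :
    loopIntegral fr g l p qe qm β θ =
      Complex.exp (-Complex.I * (loopPhase fr l p qe qm θ : ℝ)) *
        (latticeComplex N half fr).theta β (θ / (4 * π ^ 2)) l qe qm := by
  classical
  rw [SelfDualComplex.theta, ← compactIntegral_const_mul, loopIntegral]
  refine congrArg _ (funext fun A => ?_)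
  simp only [← electricWeight_mul_exp]
  refine ((latticeComplex N half fr).compactIntegral_tsum_constraint
    (summable_electricWeight fr g p qe hβ θ A) (qm • l)).trans ?_
  rw [← tsum_mul_left]
  refine tsum_congr fun n => ?_
  by_cases hn : (latticeComplex N half fr).bT (n - qm • l) = 0
  · rw [if_pos hn, if_pos hn]
    exact electricWeight_eq fr hg ((latticeComplex_bT_sub_smul_eq_zero_iff fr).1 hn) p qe β θ A
  · rw [if_neg hn, if_neg hn, mul_zero]

theorem exp_charge₀_eq_gaussianWeight (fr : Framing) {F : Form N half 2 ℝ} (hF : extDeriv F = 0)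
    (β θ : ℝ) :
    Complex.exp (-(β / 2 * (F ⬝ᵥ F) : ℝ) - Complex.I * (θ * charge₀ F : ℝ)) =
      gaussianWeight (dualityOperator fr) β (θ / (4 * π ^ 2)) 0 F := by
  rw [charge₀_eq_of_closed fr hF, gaussianWeight, zero_dotProduct, Complex.ofReal_zero, mul_zero,
    sub_zero]
  congr 3
  push_cast
  ring

theorem partition_eq (fr : Framing) (l : Form N half 2 ℤ) (β θ : ℝ) :
    partition N half β θ = (latticeComplex N half fr).theta β (θ / (4 * π ^ 2)) l 0 0 := by
  classical
  rw [SelfDualComplex.theta, partition]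
  refine congrArg _ (funext fun A => tsum_congr fun n => ?_)
  have closed_iff : (latticeComplex N half fr).bT (n - (0 : ℤ) • l) = 0 ↔ extDeriv n = 0 := by
    rw [latticeComplex_bT_sub_smul_eq_zero_iff, zero_smul]
  by_cases hn : extDeriv n = 0
  · rw [if_pos hn, if_pos (closed_iff.2 hn), Int.cast_zero, zero_smul]
    refine exp_charge₀_eq_gaussianWeight fr ?_ β θ
    rw [extDeriv_fieldStrength, ← realVec_extDeriv, hn, map_zero, smul_zero]
  · rw [if_neg hn, if_neg (mt closed_iff.1 hn)]

end LoopIntegral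

section Coupling

theorem dual_denominator_pos {β : ℝ} (hβ : 0 < β) (θ : ℝ) :
    0 < (2 * π * β) ^ 2 + (θ / (2 * π)) ^ 2 := by
  positivity

theorem dual_denominator_eq (β θ : ℝ) : (2 * π * β) ^ 2 + (θ / (2 * π)) ^ 2 =
    (β ^ 2 + (θ / (4 * π ^ 2)) ^ 2) * (4 * π ^ 2) := by
  field_simp
  ring

theorem dualBeta_pos {β : ℝ} (hβ : 0 < β) (θ : ℝ) : 0 < dualBeta β θ :=
  div_pos hβ (dual_denominator_pos hβ θ)

theorem dualBeta_eq (β θ : ℝ) :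
    dualBeta β θ = β / (β ^ 2 + (θ / (4 * π ^ 2)) ^ 2) / (4 * π ^ 2) := by
  rw [dualBeta, dual_denominator_eq, div_div]

theorem dualTheta_div_eq (β θ : ℝ) : dualTheta β θ / (4 * π ^ 2) =
    -(θ / (4 * π ^ 2)) / (β ^ 2 + (θ / (4 * π ^ 2)) ^ 2) / (4 * π ^ 2) := by
  rw [dualTheta, dual_denominator_eq, ← neg_div, div_div, div_div, div_div]
  ring

theorem normSq_coupling (β θ : ℝ) :
    Complex.normSq (coupling β θ) = (2 * π * β) ^ 2 + (θ / (2 * π)) ^ 2 := by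
  rw [coupling, mul_comm Complex.I, Complex.normSq_add_mul_I, add_comm]

theorem coupling_ne_zero {β : ℝ} (hβ : 0 < β) (θ : ℝ) : coupling β θ ≠ 0 := by
  rw [← Complex.normSq_pos, normSq_coupling]
  exact dual_denominator_pos hβ θ

theorem coupling_inv (β θ : ℝ) : (coupling β θ)⁻¹ = -coupling (dualBeta β θ) (dualTheta β θ) := by
  rw [Complex.inv_def, normSq_coupling, coupling, coupling, dualBeta, dualTheta, map_add, map_mul,
    Complex.conj_ofReal, Complex.conj_ofReal, Complex.conj_I]
  push_cast
  ring

theorem complexCharge_sq_div_coupling {β : ℝ} (hβ : 0 < β) (θ : ℝ) (qe qm : ℤ) :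
    complexCharge qe qm β θ ^ 2 / coupling β θ =
      qe ^ 2 * (coupling β θ)⁻¹ + 2 * qe * qm + coupling β θ * qm ^ 2 := by
  have := coupling_ne_zero hβ θ
  rw [complexCharge]
  field_simp
  ring

theorem duality_exponent_eq {β : ℝ} (hβ : 0 < β) (θ u : ℝ) (qe qm : ℤ) :
    -Complex.I * u * π * complexCharge qe qm β θ ^ 2 / coupling β θ
      - 2 * π ^ 2 * u * (β * qm ^ 2 - dualBeta β θ * qe ^ 2) =
    -Complex.I * (θ * qm ^ 2 / 2 * u - dualTheta β θ * qe ^ 2 / 2 * u +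
      2 * π * (qe * qm) * u : ℝ) := by
  have pi_ne_zero : (π : ℂ) ≠ 0 := Complex.ofReal_ne_zero.2 Real.pi_ne_zero
  rw [mul_div_assoc, complexCharge_sq_div_coupling hβ, coupling_inv, coupling, coupling]
  push_cast
  field_simp
  ring_nf
  simp only [Complex.I_sq]
  ring

end Coupling

section Duality

theorem neg_one_zpow_eq_exp (z : ℤ) : (-1 : ℂ) ^ z = Complex.exp (-Complex.I * (π * z : ℝ)) := by
  rw [← Complex.exp_neg_pi_mul_I, ← Complex.exp_int_mul]
  congr 1
  push_cast
  ring

/-- The factor between a dyonic loop and its `𝒮`-transform, for a loop whose magnetic coupling is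
expressed by an integer form with numbers `u` and `v`. -/
def dualityFactor (u : ℝ) (v p qe qm : ℤ) (β θ : ℝ) : ℂ :=
  Complex.exp (-Complex.I * u * π * complexCharge qe qm β θ ^ 2 / coupling β θ
    - 2 * π ^ 2 * u * (β * qm ^ 2 - dualBeta β θ * qe ^ 2)) *
  (-1 : ℂ) ^ (p * v * (qm ^ 2 + qe ^ 2))

theorem dualityFactor_neg (u : ℝ) (v p qe qm : ℤ) (β θ : ℝ) :
    dualityFactor (-u) v p qe qm β θ =
      Complex.exp (Complex.I * u * π * complexCharge qe qm β θ ^ 2 / coupling β θ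
        + 2 * π ^ 2 * u * (β * qm ^ 2 - dualBeta β θ * qe ^ 2)) *
      (-1 : ℂ) ^ (p * v * (qm ^ 2 + qe ^ 2)) := by
  rw [dualityFactor]
  congr 2
  push_cast
  ring

variable {N : ℕ} [NeZero N] {half : Bool}

theorem exists_dotProduct_dualityOperator_self_eq (fr : Framing) (l : Form N half 2 ℤ) :
    ∃ j : ℤ, realVec l ⬝ᵥ dualityOperator fr (realVec l) = j - framedNumber fr l := by
  refine ⟨l ⬝ᵥ hodge fr 2 l + framingForm fr l (extDeriv l), ?_⟩
  have duality := dotProduct_hodge_sub_dotProduct_dualityOperator fr (realVec l) (realVec l)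
  rw [map_sub, LinearMap.sub_apply, framingForm_projBoundary, ← realVec_extDeriv,
    framingForm_realVec, ← realVec_hodge, realVec_dotProduct_realVec] at duality
  push_cast
  linear_combination -duality

theorem exp_loopPhase_mul_exp (fr : Framing) (l : Form N half 2 ℤ) (p qe qm : ℤ) {β : ℝ}
    (hβ : 0 < β) (θ : ℝ) :
    Complex.exp (-Complex.I * (loopPhase fr l p qe qm θ : ℝ)) *
        Complex.exp (-Complex.I * (2 * π * (qe * qm) *
          (realVec l ⬝ᵥ dualityOperator fr (realVec l)) : ℝ)) =
      dualityFactor (framedNumber fr l) (pontryagin l) p qe qm β θ *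
        Complex.exp (-Complex.I * (loopPhase fr l p qm (-qe) (dualTheta β θ) : ℝ)) := by
  obtain ⟨j, self_duality⟩ := exists_dotProduct_dualityOperator_self_eq fr l
  rw [dualityFactor, duality_exponent_eq hβ, neg_one_zpow_eq_exp, self_duality, loopPhase,
    loopPhase, ← Complex.exp_add, ← Complex.exp_add, ← Complex.exp_add,
    Complex.exp_eq_exp_iff_exists_int]
  refine ⟨p * pontryagin l * qe ^ 2 - qe * qm * j, ?_⟩
  push_cast
  ring

theorem exists_theta_eq_mul_theta_dual (fr : Framing) {β : ℝ} (hβ : 0 < β) (θ : ℝ) :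
    ∃ C : ℂ, C ≠ 0 ∧ ∀ (l : Form N half 2 ℤ) (qe qm : ℤ),
      (latticeComplex N half fr).theta β (θ / (4 * π ^ 2)) l qe qm = C *
        (Complex.exp (-Complex.I * (2 * π * (qe * qm) *
            (realVec l ⬝ᵥ dualityOperator fr (realVec l)) : ℝ)) *
          (latticeComplex N half fr).theta (dualBeta β θ) (dualTheta β θ / (4 * π ^ 2))
            l qm (-qe)) := by
  rw [dualBeta_eq, dualTheta_div_eq]
  exact (latticeComplex N half fr).exists_theta_duality hβ (θ / (4 * π ^ 2))

theorem loopIntegral_div_partition_duality (fr : Framing) {g : Form N half 1 ℤ}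
    {l : Form N half 2 ℤ} (hg : g = (-fr.sign) • hodge fr 1 (extDeriv l)) (p qe qm : ℤ) {β : ℝ}
    (hβ : 0 < β) (θ : ℝ) :
    loopIntegral fr g l p qe qm β θ / partition N half β θ =
      dualityFactor (framedNumber fr l) (pontryagin l) p qe qm β θ *
        (loopIntegral fr g l p qm (-qe) (dualBeta β θ) (dualTheta β θ) /
          partition N half (dualBeta β θ) (dualTheta β θ)) := by
  obtain ⟨C, hC, theta_duality⟩ := exists_theta_eq_mul_theta_dual (N := N) (half := half) fr hβ θ
  have partition_duality : partition N half β θ =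
      C * partition N half (dualBeta β θ) (dualTheta β θ) := by
    rw [partition_eq fr l, partition_eq fr l, theta_duality l 0 0]
    simp
  have loopIntegral_duality : loopIntegral fr g l p qe qm β θ =
      C * (dualityFactor (framedNumber fr l) (pontryagin l) p qe qm β θ *
        loopIntegral fr g l p qm (-qe) (dualBeta β θ) (dualTheta β θ)) := by
    rw [loopIntegral_eq fr hg p qe qm hβ, loopIntegral_eq fr hg p qm (-qe) (dualBeta_pos hβ θ),
      theta_duality l qe qm, ← mul_assoc (dualityFactor _ _ _ _ _ _ _),
      ← exp_loopPhase_mul_exp fr l p qe qm hβ θ]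
    ring
  rw [loopIntegral_duality, partition_duality, mul_div_mul_left _ _ hC, mul_div_assoc]

end Duality

section LoopOperators

variable {N : ℕ} [NeZero N] {half : Bool}

theorem charge_eq (A : Form N half 1 ℝ) (n : Form N half 2 ℤ) :
    charge A n = framedCharge .plain A n := by
  rw [charge, framedCharge, framingForm_apply, Framing.sign, Int.cast_one, one_mul]
  rfl

theorem dualCharge_eq (A : Form N half 1 ℝ) (n : Form N half 2 ℤ) :
    dualCharge A n = framedCharge .dual A n := by
  rw [dualCharge, framedCharge, framingForm_apply, Framing.sign, Int.cast_neg, Int.cast_one,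
    neg_one_mul, mul_neg, ← sub_eq_add_neg]
  rfl

theorem framedNumber_plain (l : Form N half 2 ℤ) : framedNumber .plain l = uNumber l := by
  rw [framedNumber, Framing.sign, Int.cast_one, one_mul]

theorem framedNumber_dual (l : Form N half 2 ℤ) : framedNumber .dual l = -uNumber l := by
  rw [framedNumber, Framing.sign, Int.cast_neg, Int.cast_one, neg_one_mul]

theorem total_cup_tangent {g : Form N half 1 ℤ} {l : Form N half 2 ℤ}
    (hg : g = (-Framing.plain.sign) • hodge .plain 1 (extDeriv l)) (y : Form N half 3 ℝ) :
    total (cup (realVec g) y) = boundary y ⬝ᵥ realVec l := by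
  refine (sum_val_cup (p := 1) (q := 3) rfl _ _).trans ?_
  rw [hg, realVec_zsmul, realVec_hodge, realVec_extDeriv, smul_dotProduct,
    hodge_dotProduct_hodge rfl, boundary_dotProduct_of_three, dotProduct_comm y, Framing.sign]
  simp

theorem total_cup_tangent_right {g : Form N half 1 ℤ} {l : Form N half 2 ℤ}
    (hg : g = (-Framing.dual.sign) • hodge .dual 1 (extDeriv l)) (y : Form N half 3 ℝ) :
    total (cup y (realVec g)) = -(boundary y ⬝ᵥ realVec l) := by
  refine (sum_val_cup (p := 3) (q := 1) rfl _ _).trans ?_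
  have hodge_tangent : hodge .plain 3 (realVec g) = extDeriv (realVec l) := by
    rw [hg, Framing.sign, neg_neg, one_smul, realVec_hodge, realVec_extDeriv]
    exact hodge_flip_hodge (p := 1) (q := 3) rfl .dual _
  rw [hodge_tangent, boundary_dotProduct_of_three, neg_neg]

theorem evLoop_eq {γ : Contour N half} {l : Form N half 2 ℤ}
    (hg : γ.tangent = (-Framing.plain.sign) • hodge .plain 1 (extDeriv l)) (p qe qm : ℤ)
    (β θ : ℝ) :
    evLoop γ p qe qm β θ =
      loopIntegral .plain γ.tangent l p qe qm β θ / partition N half β θ := by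
  rw [div_eq_inv_mul, ← one_div]
  simp only [evLoop, loopIntegral, charge_eq, ← total_cup_tangent hg]
  rfl

theorem evDualLoop_eq {γ : Contour N half} {l : Form N half 2 ℤ}
    (hg : γ.tangent = (-Framing.dual.sign) • hodge .dual 1 (extDeriv l)) (p qe qm : ℤ)
    (β θ : ℝ) :
    evDualLoop γ p qe qm β θ =
      loopIntegral .dual γ.tangent l p qe qm β θ / partition N half β θ := by
  rw [div_eq_inv_mul, ← one_div]
  simp only [evDualLoop, loopIntegral, dualCharge_eq, sub_eq_add_neg _ (_ * (_ ⬝ᵥ _)), ← mul_neg,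
    ← total_cup_tangent_right hg]
  rfl

theorem evLoop_duality {γ : Contour N half} {l : Form N half 2 ℤ}
    (hg : γ.tangent = (-Framing.plain.sign) • hodge .plain 1 (extDeriv l)) (p qe qm : ℤ) {β : ℝ}
    (hβ : 0 < β) (θ : ℝ) :
    evLoop γ p qe qm β θ = dualityFactor (uNumber l) (pontryagin l) p qe qm β θ *
      evLoop γ p qm (-qe) (dualBeta β θ) (dualTheta β θ) := by
  rw [evLoop_eq hg, evLoop_eq hg, ← framedNumber_plain]
  exact loopIntegral_div_partition_duality .plain hg p qe qm hβ θ

theorem evDualLoop_duality {γ : Contour N half} {l : Form N half 2 ℤ}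
    (hg : γ.tangent = (-Framing.dual.sign) • hodge .dual 1 (extDeriv l)) (p qe qm : ℤ) {β : ℝ}
    (hβ : 0 < β) (θ : ℝ) :
    evDualLoop γ p qe qm β θ = dualityFactor (-uNumber l) (pontryagin l) p qe qm β θ *
      evDualLoop γ p qm (-qe) (dualBeta β θ) (dualTheta β θ) := by
  rw [evDualLoop_eq hg, evDualLoop_eq hg, ← framedNumber_dual]
  exact loopIntegral_div_partition_duality .dual hg p qe qm hβ θ

end LoopOperators

section Dualize

variable {N : ℕ} {R : Type} [CommRing R] {r : ℕ}

/-- The translation `x ↦ x + ŝ/2` from the dual lattice back to the lattice. Since `x + ŝ/2` has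
the coordinate vector of `x` raised by `1`, this is not the inverse of `toDual`. -/
def ofDual : Site N true ≃ Site N false where
  toFun x := ⟨x.coord + 1⟩
  invFun x := ⟨x.coord - 1⟩
  left_inv x := by simp only [add_sub_cancel_right]
  right_inv x := by simp only [sub_add_cancel]

theorem ofDual_shift (x : Site N true) (v : Fin 4 → ZMod N) :
    ofDual (x.shift v) = (ofDual x).shift v :=
  congrArg Site.mk (add_right_comm _ _ _)

/-- The pullback of a form to the dual lattice along the translation `ofDual`. -/
def dualize (α : Form N false r R) : Form N true r R := fun c => α (ofDual c.1, c.2)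

theorem val_dualize (α : Form N false r R) (x : Site N true) (S : Finset (Fin 4)) :
    val (dualize α) x S = val α (ofDual x) S := rfl

theorem extDeriv_dualize (α : Form N false r R) : extDeriv (dualize α) = dualize (extDeriv α) := by
  ext c
  simp only [extDeriv, dualize, val_dualize, ofDual_shift]

theorem boundary_dualize (α : Form N false (r + 1) R) :
    boundary (dualize α) = dualize (boundary α) := by
  ext c
  simp only [boundary, dualize, val_dualize, ofDual_shift]

theorem cup_dualize {p q : ℕ} (a : Form N false p R) (b : Form N false q R) :
    cup (dualize a) (dualize b) = dualize (cup a b) := by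
  ext c
  simp only [cup, dualize, val_dualize, ofDual_shift]

theorem cupOne_dualize {p q : ℕ} (a : Form N false (p + 1) R) (b : Form N false (q + 1) R) :
    cupOne (dualize a) (dualize b) = dualize (cupOne a b) := by
  refine form_ext fun x S hS => ?_
  rw [val_dualize, val_cupOne _ _ _ hS, val_cupOne _ _ _ hS]
  simp only [val_dualize, ofDual_shift]

variable [NeZero N]

theorem total_dualize (α : Form N false 4 R) : total (dualize α) = total α :=
  Fintype.sum_equiv ofDual _ _ fun _ => rfl

theorem pontryagin_dualize (l : Form N false 2 ℤ) : pontryagin (dualize l) = pontryagin l := by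
  rw [pontryagin, pontryagin, extDeriv_dualize, cup_dualize, cupOne_dualize]
  exact congrArg₂ _ (total_dualize _) (total_dualize _)

theorem projBoundary_dualize (a : Form N false 2 ℝ) :
    projBoundary (dualize a) = dualize (projBoundary a) := by
  obtain ⟨y, hy⟩ := exists_boundary_eq_projBoundary a
  have same_extDeriv : extDeriv (dualize a) = extDeriv (boundary (dualize y)) := by
    rw [boundary_dualize, hy, extDeriv_dualize, extDeriv_dualize, extDeriv_projBoundary]
  rw [projBoundary_eq_of_extDeriv_eq same_extDeriv, projBoundary_boundary, boundary_dualize, hy]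

theorem uNumber_dualize (l : Form N false 2 ℤ) : uNumber (dualize l) = uNumber l := by
  have toReal_dualize : toReal (dualize l) = dualize (toReal l) := rfl
  rw [uNumber, uNumber, toReal_dualize, projBoundary_dualize, extDeriv_dualize, cupOne_dualize]
  exact total_dualize _

end Dualize

section Tangent

variable {N : ℕ}

theorem tangent_eq_of_isMonopoleSolution {half : Bool} [NeZero N] {γ : Contour N half}
    {l : Form N half 2 ℤ} (hl : IsMonopoleSolution γ l) :
    γ.tangent = (-Framing.plain.sign) • hodge .plain 1 (extDeriv l) := by
  refine form_ext fun x S hS => ?_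
  obtain ⟨μ, rfl⟩ := Finset.card_eq_one.1 hS
  rw [val_smul, val_hodge _ _ _ hS, ← neg_eq_iff_eq_neg.2 (hl x μ)]
  simp only [Framing.sign, Framing.cellSign, Framing.offset, Int.cast_id, neg_one_mul]

theorem toDual_eq_iff {x : Site N false} {y : Site N true} :
    Villain.toDual x = y ↔ x = ⟨y.coord⟩ := by
  obtain ⟨x⟩ := x
  obtain ⟨y⟩ := y
  simp only [Villain.toDual, Site.mk.injEq]

theorem val_tangent_toDual (γ : Contour N false) (x : Site N true) (S : Finset (Fin 4)) :
    val γ.toDual.tangent x S = val γ.tangent ⟨x.coord⟩ S := by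
  by_cases hS : S.card = 1
  · rw [val_of_card _ _ hS, val_of_card _ _ hS]
    simp only [Contour.tangent, Contour.toDual, List.countP_map, Function.comp_def,
      OrientedLink.target_toDual]
    simp only [OrientedLink.toDual, toDual_eq_iff]
  · rw [val_of_card_ne _ _ hS, val_of_card_ne _ _ hS]

theorem shuffleSign_compl_singleton (μ : Fin 4) :
    shuffleSign {μ}ᶜ {μ} = -shuffleSign {μ} {μ}ᶜ := by
  revert μ
  decide

theorem ofDual_shift_neg_dirs_compl (x : Site N true) (μ : Fin 4) :
    (ofDual x).shift (-dirs N {μ}ᶜ) = (⟨x.coord⟩ : Site N false).shift (dirs N {μ}) := by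
  refine congrArg Site.mk (funext fun ν => ?_)
  by_cases hν : ν = μ <;> simp [ofDual, dirs, hν]

theorem tangent_toDual_eq_of_isMonopoleSolution [NeZero N] {γ : Contour N false}
    {l : Form N false 2 ℤ} (hl : IsMonopoleSolution γ l) :
    γ.toDual.tangent = (-Framing.dual.sign) • hodge .dual 1 (extDeriv (dualize l)) := by
  refine form_ext fun x S hS => ?_
  obtain ⟨μ, rfl⟩ := Finset.card_eq_one.1 hS
  rw [val_smul, val_hodge _ _ _ hS, extDeriv_dualize, val_dualize, ofDual_shift,
    val_tangent_toDual, ← neg_eq_iff_eq_neg.2 (hl ⟨x.coord⟩ μ)]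
  simp only [Framing.sign, Framing.cellSign, Framing.offset, Int.cast_id,
    shuffleSign_compl_singleton, ofDual_shift_neg_dirs_compl]
  ring

end Tangent

section LoopData

variable {N : ℕ} [NeZero N]

theorem LoopData.sTransform_mk (fr : Framing) (qe qm : ℤ) (β θ : ℝ) :
    (LoopData.mk fr ![qe, qm] β θ).sTransform =
      LoopData.mk fr ![qm, -qe] (dualBeta β θ) (dualTheta β θ) := by
  cases fr <;> rfl

theorem LoopData.ev_plain (γ : Contour N false) (p qe qm : ℤ) (β θ : ℝ) :
    (LoopData.mk .plain ![qe, qm] β θ).ev γ p = evLoop γ p qe qm β θ := rfl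

theorem LoopData.ev_dual (γ : Contour N false) (p qe qm : ℤ) (β θ : ℝ) :
    (LoopData.mk .dual ![qe, qm] β θ).ev γ p = evDualLoop γ.toDual p qe qm β θ := rfl

end LoopData

end

end Villain

theorem mainTheorem3 (N : ℕ) [NeZero N] (β θ : ℝ) (hβ : 0 < β) (p qe qm : ℤ)
    (γ : Contour N false) (l : Form N false 2 ℤ) (hl : IsMonopoleSolution γ l) :
    (LoopData.mk .plain ![qe, qm] β θ).ev γ p =
        Complex.exp (-Complex.I * uNumber l * π * complexCharge qe qm β θ ^ 2 / coupling β θ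
          - 2 * π ^ 2 * uNumber l * (β * qm ^ 2 - dualBeta β θ * qe ^ 2)) *
        (-1 : ℂ) ^ (p * pontryagin l * (qm ^ 2 + qe ^ 2)) *
        (LoopData.mk .plain ![qe, qm] β θ).sTransform.ev γ p ∧
    (LoopData.mk .dual ![qe, qm] β θ).ev γ p =
        Complex.exp (Complex.I * uNumber l * π * complexCharge qe qm β θ ^ 2 / coupling β θ
          + 2 * π ^ 2 * uNumber l * (β * qm ^ 2 - dualBeta β θ * qe ^ 2)) *
        (-1 : ℂ) ^ (p * pontryagin l * (qm ^ 2 + qe ^ 2)) *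
        (LoopData.mk .dual ![qe, qm] β θ).sTransform.ev γ p ∧
    ∀ fr : Framing,
      (LoopData.mk fr ![qe, qm] β θ).sTransform =
        LoopData.mk fr ![qm, -qe] (dualBeta β θ) (dualTheta β θ) ∧
      (![qm, -qe] : Fin 2 → ℤ) = Matrix.mulVec !![0, 1; -1, 0] ![qe, qm] := by
  refine ⟨?_, ?_, fun fr => ⟨LoopData.sTransform_mk fr qe qm β θ, ?_⟩⟩
  · rw [LoopData.sTransform_mk, LoopData.ev_plain, LoopData.ev_plain]
    exact evLoop_duality (tangent_eq_of_isMonopoleSolution hl) p qe qm hβ θ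
  · rw [LoopData.sTransform_mk, LoopData.ev_dual, LoopData.ev_dual, ← dualityFactor_neg,
      ← uNumber_dualize, ← pontryagin_dualize]
    exact evDualLoop_duality (tangent_toDual_eq_of_isMonopoleSolution hl) p qe qm hβ θ
  · ext i
    fin_cases i <;> simp [Matrix.mulVec, dotProduct, Fin.sum_univ_two]
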